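/- Let $\kappa>0$ and $\rho=\frac{\kappa-4}{2}$. Put $c=13-6\frac{\kappa}{4}-6\frac{4}{\kappa}$, $h_{r,s}=\frac{\kappa}{16}(r^2-1)-\frac12(rs-1)+\frac1\kappa(s^2-1)$, $h_x=h_{1,2}=\frac{6-\kappa}{2\kappa}$, $h_y=\frac{\rho(\rho+4-\kappa)}{4\kappa}$. Let $\mathcal F=C^\infty(\{(x,y)\in\mathbb R^2:x\ne y\})[a_2,a_3,\dots]$ (complex-valued smooth coefficients, formal variables $a_l$, $l\ge2$), and define operators on $\mathcal F$ (all indices $m_i,k_j$ are $\ge 2$): $$L_2=-\partial_{a_2}+\sum_{l\ge4}(l-3)a_{l-2}\partial_{a_l},\qquad L_1=\sum_{l\ge3}(l-2)a_{l-1}\partial_{a_l}+\partial_x+\partial_y,$$ $$L_0=\sum_{l\ge2}l\,a_l\partial_{a_l}+x\partial_x+y\partial_y+h_x+h_y,$$ $$L_{-1}=\sum_{l\ge2}\Big((l+2)a_{l+1}+\sum_{m_1+m_2=l+1}a_{m_1}a_{m_2}\Big)\partial_{a_l}+(x^2-3a_2)\partial_x+(y^2-3a_2)\partial_y+2xh_x+2yh_y,$$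 $$L_{-2}=\sum_{l\ge2}\Big((l+4)a_{l+2}-4a_2a_l+3\sum_{m_1+m_2=l+2}a_{m_1}a_{m_2}+\sum_{m_1+m_2+m_3=l+2}a_{m_1}a_{m_2}a_{m_3}\Big)\partial_{a_l}$$ $$\qquad+(x^3-4xa_2-5a_3)\partial_x+(y^3-4ya_2-5a_3)\partial_y+(3x^2-4a_2)h_x+(3y^2-4a_2)h_y-\tfrac c2a_2,$$ and, for $n>2$, $L_n=\frac1{(n-2)!}[[\dots[L_2,L_1],\dots],L_1]$ and $L_{-n}=\frac1{(n-2)!}[L_{-1},[\dots,[L_{-1},L_{-2}]\dots]]$ with $n-2$ brackets. Let $$A_{\kappa;\rho}=\frac\kappa2\partial_x^2+\frac2{y-x}\partial_y-\frac{\rho(\rho+4-\kappa)/(2\kappa)}{(y-x)^2}+2\sum_{l\ge2}\Big(\sum_{\substack{0\le m\le l-2\\0\le r\le\lfloor(l-2-m)/2\rfloor}}x^m(-1)^r\frac{(m+r)!}{m!\,r!}\sum_{k_1+\dots+k_r=l-m-2}a_{k_1}\cdots a_{k_r}\Big)\partial_{a_l};$$ its kernel $\operatorname{Ker}A_{\kappa;\rho}\subset\mathcal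 F$ is called the space of local martingales of SLE$_\kappa(\rho)$. Let $$Z=(x-y)^{\rho/\kappa}=(x-y)^{\frac{\kappa-4}{2\kappa}},\qquad \Lambda=(x-y)^{\frac{\kappa-4}{2\kappa}}\log(x-y),$$ with the principal branch of the logarithm. Write $\mathcal U v$ for the smallest subspace that contains $v$ and is stable under all $L_n$. Then: (1) The operators $L_n$, $n\in\mathbb Z$, make $\mathcal F$ a module over the Virasoro algebra of central charge $c$, that is, $[L_m,L_n]=(m-n)L_{m+n}+\frac{m^3-m}{12}c\,\delta_{m+n,0}$, and $\operatorname{Ker}A_{\kappa;\rho}$ is a submodule. (2) $Z\in\operatorname{Ker}A_{\kappa;\rho}$, $L_0Z=h_{0,1}Z$ with $h_{0,1}=\frac{8-\kappa}{16}$, and $L_nZ=0$ for $n>0$. (3) $\Lambda\in\operatorname{Ker}A_{\kappa;\rho}$, $(L_0-h_{0,1})\Lambda=Z$, and $L_n\Lambda=0$ for $n>0$. (4) $\mathcal UZ\subset\mathcal U\Lambda\subset\operatorname{Ker}A_{\kappa;\rho}$, and $\mathcal U\Lambda$ is an indecomposable staggered module with left module $\mathcal UZ$: both $\mathcal UZ$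 and $\mathcal U\Lambda/\mathcal UZ$ are highest weight modules of highest weight $h_{0,1}$, and $L_0$ is not diagonalizable on $\mathcal U\Lambda$. (5) If $\kappa$ is irrational, there is a short exact sequence of Virasoro modules $$0\to V_{c,h_{0,1}}\xrightarrow{\ \iota\ }\mathcal U\Lambda\xrightarrow{\ \pi\ }V_{c,h_{0,1}}\to0,$$ where $V_{c,h}$ is the Verma module of central charge $c$ and highest weight $h$ with highest weight vector $v_{c,h}$, and $\iota(v_{c,h_{0,1}})=Z$, $\pi(\Lambda)=v_{c,h_{0,1}}$. (6) If $\kappa$ is irrational, $\mathcal U\Lambda$ is isomorphic to its contragredient module $(\mathcal U\Lambda)^*$, the direct sum of the duals of the generalized $L_0$-eigenspaces of $\mathcal U\Lambda$ with the action $\langle L_nv^*,v\rangle=\langle v^*,L_{-n}v\rangle$. -/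

import Mathlib

open scoped ContDiff Nat

noncomputable section

namespace SLEVir

/-! ### Representations of the Virasoro algebra of central charge `c` -/

/-- A representation on `M` of the Virasoro algebra, spanned by `L_n` (`n ∈ ℤ`) and a central
element acting as the number `c`:
`[L_m, L_n] = (m - n) L_{m+n} + (m³ - m)/12 · δ_{m+n,0} · c`. -/
structure VirasoroRep (c : ℂ) (M : Type*) [AddCommGroup M] [Module ℂ M] where
  L : ℤ → Module.End ℂ M
  comm : ∀ m n : ℤ, L m * L n - L n * L m =
    ((m : ℂ) - n) • L (m + n) +
      if m + n = 0 then ((((m : ℂ) ^ 3 - m) / 12) * c) • (1 : Module.End ℂ M) else 0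

namespace VirasoroRep

variable {c : ℂ} {M N : Type*} [AddCommGroup M] [Module ℂ M] [AddCommGroup N] [Module ℂ N]

/-- `W` is a submodule (subrepresentation). -/
def Stable (R : VirasoroRep c M) (W : Submodule ℂ M) : Prop :=
  ∀ n : ℤ, ∀ v ∈ W, R.L n v ∈ W

/-- The submodule `𝒰 v` generated by `v`: the smallest subrepresentation containing `v`. -/
def cyclic (R : VirasoroRep c M) (v : M) : Submodule ℂ M :=
  sInf {W | R.Stable W ∧ v ∈ W}

theorem cyclic_stable (R : VirasoroRep c M) (v : M) : R.Stable (R.cyclic v) := by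
  intro n w hw
  simp only [cyclic, Submodule.mem_sInf, Set.mem_ofPred_eq] at hw ⊢
  exact fun W hW => hW.1 n w (hw W hW)

theorem mem_cyclic (R : VirasoroRep c M) (v : M) : v ∈ R.cyclic v := by
  simp only [cyclic, Submodule.mem_sInf, Set.mem_ofPred_eq]
  exact fun W hW => hW.2

/-- The representation on a subrepresentation. -/
def sub (R : VirasoroRep c M) (W : Submodule ℂ M) (hW : R.Stable W) : VirasoroRep c W where
  L n := (R.L n).restrict (hW n)
  comm m n := by
    ext ⟨v, hv⟩
    have h := LinearMap.congr_fun (R.comm m n) v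
    split_ifs at h ⊢ <;> simpa using h

/-- The representation on the quotient by a subrepresentation. -/
def quot (R : VirasoroRep c M) (W : Submodule ℂ M) (hW : R.Stable W) :
    VirasoroRep c (M ⧸ W) where
  L n := W.mapQ W (R.L n) (fun v hv => hW n v hv)
  comm m n := by
    ext v
    have h := congrArg W.mkQ (LinearMap.congr_fun (R.comm m n) v)
    split_ifs at h ⊢ <;> simpa using h

/-- `f` is a homomorphism of representations. -/
def IsHom (R : VirasoroRep c M) (S : VirasoroRep c N) (f : M →ₗ[ℂ] N) : Prop :=
  ∀ (n : ℤ) (v : M), f (R.L n v) = S.L n (f v)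

/-- `R` and `S` are isomorphic representations. -/
def Isomorphic (R : VirasoroRep c M) (S : VirasoroRep c N) : Prop :=
  ∃ e : M ≃ₗ[ℂ] N, R.IsHom S (e : M →ₗ[ℂ] N)

/-- `R` is a highest weight representation of highest weight `h`: it is generated by a non-zero
`w` with `L_0 w = h w` and `L_n w = 0` for all `n > 0`. -/
def IsHighestWeight (R : VirasoroRep c M) (h : ℂ) : Prop :=
  ∃ w : M, w ≠ 0 ∧ R.L 0 w = h • w ∧ (∀ n : ℤ, 0 < n → R.L n w = 0) ∧ R.cyclic w = ⊤

/-- `L_0` is diagonalizable: the space is spanned by eigenvectors of `L_0`. -/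
def DiagonalizableL0 (R : VirasoroRep c M) : Prop :=
  ⨆ μ : ℂ, Module.End.eigenspace (R.L 0) μ = ⊤

/-- `R` is a staggered module with left module the subrepresentation `W`: `W` is a highest weight
module of highest weight `hl`, the quotient by `W` is a highest weight module of highest weight
`hr`, and `L_0` is not diagonalizable. -/
def IsStaggered (R : VirasoroRep c M) (W : Submodule ℂ M) (hl hr : ℂ) : Prop :=
  ∃ hW : R.Stable W, (R.sub W hW).IsHighestWeight hl ∧ (R.quot W hW).IsHighestWeight hr ∧
    ¬ R.DiagonalizableL0

/-- `R` is non-zero and not the direct sum of two non-zero subrepresentations. -/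
def Indecomposable (R : VirasoroRep c M) : Prop :=
  Nontrivial M ∧ ∀ W₁ W₂ : Submodule ℂ M, R.Stable W₁ → R.Stable W₂ → IsCompl W₁ W₂ →
    W₁ = ⊥ ∨ W₂ = ⊥

/-- `L_n` maps the generalized eigenspace of `L_0` of eigenvalue `η` to that of eigenvalue
`η - n`. -/
theorem map_maxGenEigenspace (R : VirasoroRep c M) (n : ℤ) (η : ℂ) {v : M}
    (hv : v ∈ Module.End.maxGenEigenspace (R.L 0) η) :
    R.L n v ∈ Module.End.maxGenEigenspace (R.L 0) (η - n) := by
  rw [Module.End.mem_maxGenEigenspace] at hv ⊢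
  obtain ⟨k, hk⟩ := hv
  refine ⟨k, ?_⟩
  have h1 : (R.L 0 - (η - n) • (1 : Module.End ℂ M)) * R.L n =
      R.L n * (R.L 0 - η • (1 : Module.End ℂ M)) := by
    have h := R.comm 0 n
    have h2 : R.L 0 * R.L n - R.L n * R.L 0 = -(n : ℂ) • R.L n := by
      rw [h]; split_ifs <;> simp
    rw [sub_eq_iff_eq_add] at h2
    simp only [sub_mul, mul_sub, h2, smul_mul_assoc, mul_smul_comm, one_mul, mul_one, sub_smul,
      neg_smul]
    abel
  have h3 : ∀ j : ℕ, (R.L 0 - (η - n) • (1 : Module.End ℂ M)) ^ j * R.L n =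
      R.L n * (R.L 0 - η • (1 : Module.End ℂ M)) ^ j := by
    intro j
    induction j with
    | zero => simp
    | succ j ih => rw [pow_succ, mul_assoc, h1, ← mul_assoc, ih, mul_assoc, pow_succ]
  have h4 := LinearMap.congr_fun (h3 k) v
  simp only [Module.End.mul_apply] at h4
  rw [h4, hk, map_zero]

/-- The space of the contragredient module: linear functionals that vanish on all but finitely
many of the generalized eigenspaces `M_[η]` of `L_0`. When `M` is the direct sum of its
finite dimensional generalized eigenspaces `M_[η]`, this is the direct sum of the duals
of the `M_[η]`. -/
def restrictedDual (R : VirasoroRep c M) : Submodule ℂ (Module.Dual ℂ M) where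
  carrier := {f | {η : ℂ | ∃ v ∈ Module.End.maxGenEigenspace (R.L 0) η, f v ≠ 0}.Finite}
  zero_mem' := by simp
  add_mem' := by
    intro f g hf hg
    refine (hf.union hg).subset ?_
    rintro η ⟨v, hv, h⟩
    by_contra hcon
    simp only [Set.mem_union, Set.mem_ofPred_eq, not_or, not_exists, not_and, not_not] at hcon
    exact h (by rw [LinearMap.add_apply, hcon.1 v hv, hcon.2 v hv, add_zero])
  smul_mem' := by
    intro a f hf
    refine Set.Finite.subset hf ?_
    rintro η ⟨v, hv, h⟩
    refine ⟨v, hv, fun h0 => h ?_⟩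
    rw [LinearMap.smul_apply, h0, smul_zero]

theorem restrictedDual_transpose (R : VirasoroRep c M) (n : ℤ) {f : Module.Dual ℂ M}
    (hf : f ∈ R.restrictedDual) :
    Module.Dual.transpose (R.L (-n)) f ∈ R.restrictedDual := by
  have hfin : Set.Finite
      ((fun η : ℂ => η + n) ⁻¹'
        {η : ℂ | ∃ v ∈ Module.End.maxGenEigenspace (R.L 0) η, f v ≠ 0}) :=
    Set.Finite.preimage ((add_left_injective (n : ℂ)).injOn) hf
  refine Set.Finite.subset hfin ?_
  rintro η ⟨v, hv, h⟩
  refine ⟨R.L (-n) v, ?_, h⟩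
  have := R.map_maxGenEigenspace (-n) η hv
  simpa using this

/-- The contragredient module, with action `⟨L_n v*, v⟩ = ⟨v*, L_{-n} v⟩`. -/
def contragredient (R : VirasoroRep c M) : VirasoroRep c R.restrictedDual where
  L n := (Module.Dual.transpose (R := ℂ) (R.L (-n))).restrict
    (fun _ hf => R.restrictedDual_transpose n hf)
  comm m n := by
    ext ⟨f, hf⟩ v
    have h := congrArg f (LinearMap.congr_fun (R.comm (-n) (-m)) v)
    have e : -n + -m = -(m + n) := by ring
    rw [e] at h
    by_cases h0 : m + n = 0
    · have hn : (n : ℂ) = -m := by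
        have : n = -m := by omega
        rw [this]; push_cast; ring
      simp only [h0, neg_zero, if_true, map_add, map_sub, LinearMap.sub_apply, LinearMap.add_apply,
        Module.End.mul_apply, LinearMap.smul_apply, map_smul, Module.End.one_apply,
        smul_eq_mul, Int.cast_neg, hn, neg_neg] at h ⊢
      simpa [Module.Dual.transpose_apply, hn] using h
    · have h0' : ¬ -(m + n) = 0 := by omega
      simp only [h0', h0, if_false, add_zero, map_sub, LinearMap.sub_apply,
        Module.End.mul_apply, LinearMap.smul_apply, map_smul,
        smul_eq_mul, Int.cast_neg] at h ⊢
      have e2 : -(n : ℂ) - -(m : ℂ) = m - n := by ring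
      rw [e2] at h
      simpa [Module.Dual.transpose_apply] using h

end VirasoroRep

/-! ### The algebra `𝒰` and Verma modules -/

/-- The defining relations of the universal enveloping algebra of the Virasoro algebra with the
central element identified with `c`. -/
inductive VirRel (c : ℂ) : FreeAlgebra ℂ ℤ → FreeAlgebra ℂ ℤ → Prop
  | comm (m n : ℤ) : VirRel c
      (FreeAlgebra.ι ℂ m * FreeAlgebra.ι ℂ n - FreeAlgebra.ι ℂ n * FreeAlgebra.ι ℂ m)
      (((m : ℂ) - n) • FreeAlgebra.ι ℂ (m + n) +
        if m + n = 0 then ((((m : ℂ) ^ 3 - m) / 12) * c) • (1 : FreeAlgebra ℂ ℤ) else 0)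

/-- `𝒰`: the universal enveloping algebra of the Virasoro algebra modulo `C = c·1`. -/
abbrev VirU (c : ℂ) : Type := RingQuot (VirRel c)

/-- The generator `L_n` of `𝒰`. -/
def VirU.gen (c : ℂ) (n : ℤ) : VirU c :=
  RingQuot.mkAlgHom ℂ (VirRel c) (FreeAlgebra.ι ℂ n)

theorem VirU.gen_comm (c : ℂ) (m n : ℤ) :
    VirU.gen c m * VirU.gen c n - VirU.gen c n * VirU.gen c m =
      ((m : ℂ) - n) • VirU.gen c (m + n) +
        if m + n = 0 then ((((m : ℂ) ^ 3 - m) / 12) * c) • (1 : VirU c) else 0 := by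
  have h := RingQuot.mkAlgHom_rel ℂ (VirRel.comm (c := c) m n)
  split_ifs at h ⊢ <;> simpa [VirU.gen] using h

/-- The left ideal of `𝒰` generated by `L_n`, `n > 0`, and `L_0 - h`. -/
def vermaIdeal (c h : ℂ) : Submodule (VirU c) (VirU c) :=
  Submodule.span (VirU c)
    ({u | ∃ n : ℤ, 0 < n ∧ u = VirU.gen c n} ∪ {VirU.gen c 0 - algebraMap ℂ (VirU c) h})

/-- The Verma module of central charge `c` and highest weight `h`. -/
abbrev Verma (c h : ℂ) : Type := VirU c ⧸ vermaIdeal c h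

/-- The action of the Virasoro algebra on the Verma module, by left multiplication. -/
def vermaRep (c h : ℂ) : VirasoroRep c (Verma c h) where
  L n := Algebra.lsmul ℂ ℂ (Verma c h) (VirU.gen c n)
  comm m n := by
    have e := congrArg (Algebra.lsmul ℂ ℂ (Verma c h)) (VirU.gen_comm c m n)
    split_ifs at e ⊢ <;> simpa using e

/-- The highest weight vector `v_{c,h}`. -/
def vermaVec (c h : ℂ) : Verma c h := Submodule.Quotient.mk 1

/-! ### Smooth functions of `(x, y)`, `x ≠ y` -/

/-- The open set of `(x, y) ∈ ℝ²` with `x ≠ y`. -/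
abbrev Conf : Set (ℝ × ℝ) := {p | p.1 ≠ p.2}

theorem isOpen_Conf : IsOpen Conf := isOpen_ne_fun continuous_fst continuous_snd

/-- Extension by zero of a function on `Conf`. -/
def ext0 (f : Conf → ℂ) : ℝ × ℝ → ℂ := Function.extend Subtype.val f 0

theorem ext0_apply (f : Conf → ℂ) {p : ℝ × ℝ} (hp : p ∈ Conf) : ext0 f p = f ⟨p, hp⟩ :=
  Subtype.val_injective.extend_apply f 0 ⟨p, hp⟩

theorem contDiffOn_ext0 {f : Conf → ℂ} {g : ℝ × ℝ → ℂ} (hg : ContDiffOn ℝ ∞ g Conf)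
    (h : ∀ p : Conf, f p = g p) : ContDiffOn ℝ ∞ (ext0 f) Conf :=
  hg.congr fun p hp => by rw [ext0_apply f hp, h]

/-- `C^∞({(x, y) : x ≠ y})`, as a subalgebra of the complex-valued functions. -/
def smoothSubalgebra : Subalgebra ℂ (Conf → ℂ) where
  carrier := {f | ContDiffOn ℝ ∞ (ext0 f) Conf}
  mul_mem' {f g} hf hg := contDiffOn_ext0 (ContDiffOn.mul hf hg) fun p => by
    simp [ext0_apply _ p.2]
  add_mem' {f g} hf hg := contDiffOn_ext0 (ContDiffOn.add hf hg) fun p => by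
    simp [ext0_apply _ p.2]
  algebraMap_mem' r := contDiffOn_ext0 (contDiffOn_const (c := r)) fun p => rfl

/-- `C^∞({(x, y) : x ≠ y})`, the complex-valued smooth functions. -/
def Smooth : Type := smoothSubalgebra

instance : CommRing Smooth := inferInstanceAs (CommRing smoothSubalgebra)

instance : Algebra ℂ Smooth := inferInstanceAs (Algebra ℂ smoothSubalgebra)

/-- The underlying function. -/
def Smooth.fn (f : Smooth) : Conf → ℂ := f.1

@[ext] theorem Smooth.ext {f g : Smooth} (h : ∀ p, f.fn p = g.fn p) : f = g :=
  Subtype.ext (funext h)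

theorem Smooth.contDiffOn (f : Smooth) : ContDiffOn ℝ ∞ (ext0 f.fn) Conf := f.2

/-- A function on `Conf` that extends to a smooth function `g`, as an element of `Smooth`. -/
def Smooth.mk (f : Conf → ℂ) (g : ℝ × ℝ → ℂ) (hg : ContDiffOn ℝ ∞ g Conf)
    (h : ∀ p : Conf, f p = g p) : Smooth :=
  (⟨f, contDiffOn_ext0 hg h⟩ : smoothSubalgebra)

theorem Smooth.differentiableAt (f : Smooth) (p : Conf) :
    DifferentiableAt ℝ (ext0 f.fn) p :=
  (f.contDiffOn.contDiffAt (isOpen_Conf.mem_nhds p.2)).differentiableAt (by simp)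

/-- The derivative of a smooth function in the constant direction `v`. -/
def dirDeriv (v : ℝ × ℝ) : Smooth →ₗ[ℂ] Smooth where
  toFun f := Smooth.mk (fun p => fderiv ℝ (ext0 f.fn) p v) (fun p => fderiv ℝ (ext0 f.fn) p v)
    ((f.contDiffOn.fderiv_of_isOpen isOpen_Conf (m := ∞) (by simp)).clm_apply
      contDiffOn_const) (fun _ => rfl)
  map_add' f g := by
    ext p
    have h : ext0 (f + g).fn =ᶠ[nhds (p : ℝ × ℝ)] ext0 f.fn + ext0 g.fn := by
      filter_upwards [isOpen_Conf.mem_nhds p.2] with q hq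
      rw [Pi.add_apply, ext0_apply _ hq, ext0_apply _ hq, ext0_apply _ hq]
      rfl
    change fderiv ℝ (ext0 (f + g).fn) p v =
      fderiv ℝ (ext0 f.fn) p v + fderiv ℝ (ext0 g.fn) p v
    rw [h.fderiv_eq, fderiv_add (f.differentiableAt p) (g.differentiableAt p)]
    rfl
  map_smul' a f := by
    ext p
    have h : ext0 (a • f).fn =ᶠ[nhds (p : ℝ × ℝ)] a • ext0 f.fn := by
      filter_upwards [isOpen_Conf.mem_nhds p.2] with q hq
      rw [Pi.smul_apply, ext0_apply _ hq, ext0_apply _ hq]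
      rfl
    change fderiv ℝ (ext0 (a • f).fn) p v = a • fderiv ℝ (ext0 f.fn) p v
    rw [h.fderiv_eq, fderiv_const_smul (f.differentiableAt p) a]
    rfl

/-- The coordinate function `x`. -/
def xS : Smooth := Smooth.mk (fun p => ((p.1.1 : ℝ) : ℂ)) (fun p => ((p.1 : ℝ) : ℂ))
  (Complex.ofRealCLM.contDiff.comp contDiff_fst).contDiffOn (fun _ => rfl)

/-- The coordinate function `y`. -/
def yS : Smooth := Smooth.mk (fun p => ((p.1.2 : ℝ) : ℂ)) (fun p => ((p.2 : ℝ) : ℂ))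
  (Complex.ofRealCLM.contDiff.comp contDiff_snd).contDiffOn (fun _ => rfl)

/-- The function `1 / (y - x)`. -/
def invS : Smooth := Smooth.mk (fun p => (((p.1.2 - p.1.1 : ℝ) : ℂ))⁻¹)
  (fun p => (((p.2 - p.1 : ℝ) : ℂ))⁻¹)
  (ContDiffOn.inv
    (Complex.ofRealCLM.contDiff.comp (contDiff_snd.sub contDiff_fst)).contDiffOn
    (fun p hp h0 => hp (by
      have h1 : p.2 - p.1 = 0 := Complex.ofReal_eq_zero.mp h0
      linarith))) (fun _ => rfl)

theorem contDiffOn_log_sub :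
    ContDiffOn ℝ ∞ (fun p : ℝ × ℝ => Complex.log ((p.1 - p.2 : ℝ) : ℂ)) Conf := by
  intro p hp
  refine ContDiffAt.contDiffWithinAt ?_
  have hsub : ContDiff ℝ ∞ (fun p : ℝ × ℝ => p.1 - p.2) := contDiff_fst.sub contDiff_snd
  have hlog : ContDiffAt ℝ ∞ (fun p : ℝ × ℝ => ((Real.log (p.1 - p.2) : ℝ) : ℂ)) p :=
    Complex.ofRealCLM.contDiff.contDiffAt.comp p
      (hsub.contDiffAt.log (sub_ne_zero.mpr hp))
  rcases lt_or_gt_of_ne hp with h | h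
  · refine (hlog.add (contDiffAt_const (c := (Real.pi : ℂ) * Complex.I))).congr_of_eventuallyEq ?_
    filter_upwards [(isOpen_lt continuous_fst continuous_snd).mem_nhds h] with q hq
    have hq' : q.1 - q.2 < 0 := sub_neg.mpr hq
    rw [Complex.log, Complex.arg_ofReal_of_neg hq', Complex.norm_real, Real.norm_eq_abs,
      Real.log_abs]
  · refine hlog.congr_of_eventuallyEq ?_
    filter_upwards [(isOpen_lt continuous_snd continuous_fst).mem_nhds h] with q hq
    exact (Complex.ofReal_log (sub_pos.mpr hq).le).symm

/-- The function `log (x - y)` (principal branch, so it is `log |x - y| + π i` where `x < y`). -/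
def logS : Smooth := Smooth.mk (fun p => Complex.log ((p.1.1 - p.1.2 : ℝ) : ℂ))
  (fun p => Complex.log ((p.1 - p.2 : ℝ) : ℂ)) contDiffOn_log_sub (fun _ => rfl)

/-- The function `(x - y) ^ α` (principal branch). -/
def powS (α : ℂ) : Smooth := Smooth.mk (fun p => ((p.1.1 - p.1.2 : ℝ) : ℂ) ^ α)
  (fun p => Complex.exp (Complex.log ((p.1 - p.2 : ℝ) : ℂ) * α))
  (contDiffOn_log_sub.mul contDiffOn_const).cexp
  (fun p => Complex.cpow_def_of_ne_zero
    (fun h => p.2 (sub_eq_zero.mp (Complex.ofReal_eq_zero.mp h))) α)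

/-! ### The space `ℱ = C^∞({x ≠ y})[a_2, a_3, …]` and the differential operators on it -/

/-- The index set of the formal variables `a_l`, `l ≥ 2`. -/
abbrev Idx : Type := {l : ℕ // 2 ≤ l}

/-- `ℱ = C^∞({x ≠ y})[a_2, a_3, a_4, …]`. -/
abbrev F : Type := MvPolynomial Idx Smooth

/-- The formal variable `a_l`, with the convention `a_0 = a_1 = 0`; so in a sum of products of
`a_m`'s only the terms with all `m ≥ 2` contribute. -/
def a (l : ℕ) : F := if h : 2 ≤ l then MvPolynomial.X ⟨l, h⟩ else 0

/-- `x` as an element of `ℱ`. -/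
def xF : F := MvPolynomial.C xS

/-- `y` as an element of `ℱ`. -/
def yF : F := MvPolynomial.C yS

/-- The operator of multiplication by `f`. -/
abbrev mulOp (f : F) : Module.End ℂ F := LinearMap.mulLeft ℂ f

/-- The directional derivative in the variables `(x, y)`, acting on the coefficients. -/
def coeffDeriv (v : ℝ × ℝ) : Module.End ℂ F where
  toFun f := AddMonoidAlgebra.map (dirDeriv v).toAddMonoidHom f
  map_add' f g := by
    ext s : 1
    simp
  map_smul' r f := by
    ext s : 1
    simp

/-- `∂/∂x`. -/
def dx : Module.End ℂ F := coeffDeriv (1, 0)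

/-- `∂/∂y`. -/
def dy : Module.End ℂ F := coeffDeriv (0, 1)

/-- The operator `∑_{l ≥ 2} P_l ∂/∂a_l`. -/
def aDeriv (P : ℕ → F) : Module.End ℂ F :=
  (MvPolynomial.mkDerivation Smooth (fun l : Idx => P l) : F →ₗ[Smooth] F).restrictScalars ℂ

/-- `∑ a_{m_1} ⋯ a_{m_r}` over all `m_1, …, m_r ≥ 2` with `m_1 + ⋯ + m_r = n`. -/
def aSum (r n : ℕ) : F := ∑ m ∈ Finset.Nat.antidiagonalTuple r n, ∏ j, a (m j)

/-- `L_2 = - ∂/∂a_2 + ∑_{l ≥ 4} (l - 3) a_{l-2} ∂/∂a_l`. -/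
def opL2 : Module.End ℂ F :=
  aDeriv fun l => if l = 2 then -1 else ((l : ℂ) - 3) • a (l - 2)

/-- `L_1 = ∑_{l ≥ 3} (l - 2) a_{l-1} ∂/∂a_l + ∂/∂x + ∂/∂y`. -/
def opL1 : Module.End ℂ F :=
  aDeriv (fun l => ((l : ℂ) - 2) • a (l - 1)) + dx + dy

/-- `L_0`, for weights `h_x`, `h_y`. -/
def opL0 (hx hy : ℂ) : Module.End ℂ F :=
  aDeriv (fun l => (l : ℂ) • a l) + mulOp xF * dx + mulOp yF * dy + (hx + hy) • 1

/-- `L_{-1}`, for weights `h_x`, `h_y`. -/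
def opLm1 (hx hy : ℂ) : Module.End ℂ F :=
  aDeriv (fun l => ((l : ℂ) + 2) • a (l + 1) + aSum 2 (l + 1))
    + mulOp (xF ^ 2 - 3 * a 2) * dx + mulOp (yF ^ 2 - 3 * a 2) * dy
    + mulOp ((2 * hx) • xF + (2 * hy) • yF)

/-- `L_{-2}`, for central charge `c` and weights `h_x`, `h_y`. -/
def opLm2 (c hx hy : ℂ) : Module.End ℂ F :=
  aDeriv (fun l => ((l : ℂ) + 4) • a (l + 2) - 4 * a 2 * a l
      + 3 * aSum 2 (l + 2) + aSum 3 (l + 2))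
    + mulOp (xF ^ 3 - 4 * xF * a 2 - 5 * a 3) * dx
    + mulOp (yF ^ 3 - 4 * yF * a 2 - 5 * a 3) * dy
    + mulOp (hx • (3 * xF ^ 2 - 4 * a 2) + hy • (3 * yF ^ 2 - 4 * a 2) - (c / 2) • a 2)

/-- The iterated commutator `[[…[L_2, L_1], …], L_1]` with `k` brackets. -/
def bracketPos : ℕ → Module.End ℂ F
  | 0 => opL2
  | k + 1 => bracketPos k * opL1 - opL1 * bracketPos k

/-- The iterated commutator `[L_{-1}, […, [L_{-1}, L_{-2}]]]` with `k` brackets. -/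
def bracketNeg (c hx hy : ℂ) : ℕ → Module.End ℂ F
  | 0 => opLm2 c hx hy
  | k + 1 => opLm1 hx hy * bracketNeg c hx hy k - bracketNeg c hx hy k * opLm1 hx hy

/-- The operators `L_n`, `n ∈ ℤ`: for `n ≥ 2` one has
`L_n = 1/(n-2)! [[…[L_2, L_1], …], L_1]` and `L_{-n} = 1/(n-2)! [L_{-1}, […, [L_{-1}, L_{-2}]]]`,
with `n - 2` brackets. -/
def opL (c hx hy : ℂ) : ℤ → Module.End ℂ F
  | Int.ofNat 0 => opL0 hx hy
  | Int.ofNat 1 => opL1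
  | Int.ofNat (k + 2) => ((k ! : ℂ)⁻¹) • bracketPos k
  | Int.negSucc 0 => opLm1 hx hy
  | Int.negSucc (k + 1) => ((k ! : ℂ)⁻¹) • bracketNeg c hx hy k

/-- The coefficient of `∂/∂a_l` in the drift operator, `l ≥ 2`. -/
def driftCoeff (l : ℕ) : F :=
  2 * ∑ m ∈ Finset.range (l - 1), ∑ r ∈ Finset.range ((l - 2 - m) / 2 + 1),
    ((-1) ^ r * (((m + r)! : ℂ) / (m ! * r !))) • (xF ^ m * aSum r (l - m - 2))

/-- The drift operator `A_{κ;ρ}` of `SLE_κ(ρ)`. -/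
def opA (κ ρ : ℝ) : Module.End ℂ F :=
  ((κ : ℂ) / 2) • (dx * dx) + (2 : ℂ) • (mulOp (MvPolynomial.C invS) * dy)
    - ((ρ : ℂ) * (ρ + 4 - κ) / (2 * κ)) • mulOp (MvPolynomial.C invS ^ 2)
    + aDeriv driftCoeff

/-- The space `Ker A_{κ;ρ}` of local martingales of `SLE_κ(ρ)`. -/
def kerA (κ ρ : ℝ) : Submodule ℂ F := LinearMap.ker (opA κ ρ)

/-! ### The parameters -/

/-- `c(κ) = 13 - 6 κ/4 - 6 · 4/κ`. -/
def cc (κ : ℝ) : ℂ := 13 - 6 * ((κ : ℂ) / 4) - 6 * (4 / (κ : ℂ))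

/-- `h_{r,s}(κ)`. -/
def hKac (κ : ℝ) (r s : ℤ) : ℂ :=
  ((κ : ℂ) / 4) / 4 * ((r : ℂ) ^ 2 - 1) - 1 / 2 * ((r : ℂ) * s - 1)
    + (4 / (κ : ℂ)) / 4 * ((s : ℂ) ^ 2 - 1)

/-- The operators `L_n` on `ℱ` for `SLE_κ(ρ)`: central charge `c(κ)` and weights
`h_x = h_{1,2}(κ)`, `h_y = ρ(ρ + 4 - κ)/(4κ)`. -/
def sleL (κ ρ : ℝ) : ℤ → Module.End ℂ F :=
  opL (cc κ) (hKac κ 1 2) ((ρ : ℂ) * (ρ + 4 - κ) / (4 * κ))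

/-- The partition function `Z = (x - y)^{ρ/κ}` of `SLE_κ(ρ)`. -/
def Zpart (κ ρ : ℝ) : F := MvPolynomial.C (powS ((ρ : ℂ) / κ))

/-- The logarithmic partner `Λ = (x - y)^{(κ-4)/(2κ)} log (x - y)`. -/
def logPartner (κ : ℝ) : F :=
  MvPolynomial.C (powS (((κ : ℂ) - 4) / (2 * κ)) * logS)

end SLEVir

end

/-!
The operators `L_n` are first order differential operators `D + s`, and everything about their
vector fields `D` can be read off from the values on `x`, `y` and on the generating series
`G = 1 + ∑ a_l t^l` (`IsVectorField.ext_gser`): for instance `L_n G = t^n (θ - 1) G` for `n ≥ 2`,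
and `t L_{-1} G = (θ - 1) G + G² - 3 a_2 t²`, where `θ = t d/dt`.

*Virasoro relations.* For the modes `L_1`, `L_2`, `L_0`, `L_{-1}`, `L_{-2}`, and for all pairs of
positive modes, the relations are identities between such series. The relations between modes of
opposite sign follow from the Jacobi identity (`Rel.of_generators`). The defect of a relation
between two negative modes commutes with `L_1` and `L_2`; since `L_n` acts as `-∂/∂a_n` on
polynomials in `a_2, …, a_n`, the coefficients of this first order operator are free of the
variables `a_l`, and translation invariance and homogeneity make them vanish (`IsSplit.eq_zero`).

*Local martingales.* The drift of `A` has generating series `2 t² U`, with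
`U = (G - x t)⁻¹`. The commutator of `A` with `D + s` is `2 (∂_x D x) A` for the generating modes
(`opA_fo`, `opA_posD`, `opA_negOne`, `opA_negTwo`), so that `Ker A` is stable. On functions of
`x - y` one has `(x - y)² A = (κ/2) (L_0 - h_{0,1})²` (`sq_mul_opA_C`). This gives `A Z = A Λ = 0`.
It also shows that a local martingale killed by all `L_n`, `n > 0`, which is necessarily a
function of `x - y`, has weight `h_{0,1}`: the module `𝒰 Λ` contains no singular vector of positive
level, for any `κ` (`kerA_no_singular`).

*Structure of `𝒰 Λ`.* A module generated by a vector `ξ` that is annihilated by `L_n`, `n > 0`, and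
by `(L_0 - h)²` is graded, with lowest space spanned by `ξ` and `(L_0 - h) ξ`. This makes `𝒰 Λ`
staggered and indecomposable. A homomorphism with prescribed value on `ξ` exists towards every
graded module without singular vectors of positive level (`exists_hom_of_no_singular`), because its
graph contains no vector `(0, y)` with `y ≠ 0`. Applied to the contragredient module of `𝒰 Λ`, this
gives the self-duality, both sides being of the same finite dimension at each level. Applied to the
Verma module, it gives the projection of the exact sequence.

*The Verma module.* It remains to see that the Verma module of weight `h_{0,1}` has no singular
vectors of positive level when `κ` is irrational (`verma_no_singular`). This is proved in the Fock
space, the polynomials in the power sums `p_1, p_2, …`, with the Virasoro action of a free boson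
with background charge. In the basis of products of (rescaled) elementary symmetric functions, the
operators `∑ L_{-n} α_n` and `∑ p_n L_n` are triangular (`IsSecondOrder.triangular`), and their
diagonal entries are proportional to `s κ - 8 m` with integers `s > 0` and `m`, so they do not
vanish for irrational `κ`. Invertibility of the first operator shows that the vacuum generates the
Fock space, invertibility of the second that there are no singular vectors. Comparing the
dimensions of the levels, the map from the Verma module to the Fock space is injective.
-/

open scoped ContDiff Nat

noncomputable section

namespace SLEVir

/-! ### Derivations of power series -/

section PowerSeriesDerivations

open PowerSeries

variable {A : Type*} [CommRing A] [Algebra ℂ A]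

/-- The derivation `t d/dt` of power series. -/
def theta : Derivation ℂ A⟦X⟧ A⟦X⟧ := ((X : A⟦X⟧) • derivative A).restrictScalars ℂ

theorem coeff_theta (n : ℕ) (f : A⟦X⟧) : coeff n (theta f) = (n : ℂ) • coeff n f := by
  have h : theta f = X * derivative A f := rfl
  rw [h]
  cases n with
  | zero => simp
  | succ n =>
    rw [coeff_succ_X_mul, coeff_derivative, Algebra.smul_def]
    push_cast; simp [mul_comm]

theorem theta_X : theta (X : A⟦X⟧) = X := by
  ext n; rw [coeff_theta, coeff_X]; split_ifs with h <;> simp [h]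

theorem theta_C (r : A) : theta (C r) = 0 := by
  ext n; rw [coeff_theta, coeff_C]; split_ifs with h <;> simp [h]

/-- The action of a derivation on the coefficients of power series. -/
def coeffwise (D : Derivation ℂ A A) : Derivation ℂ A⟦X⟧ A⟦X⟧ :=
  Derivation.mk'
    { toFun := fun f => PowerSeries.mk fun n => D (coeff n f)
      map_add' := fun f g => by ext n; simp
      map_smul' := fun r f => by ext n; simp }
    fun f g => by
      ext n
      simp only [LinearMap.coe_mk, AddHom.coe_mk, coeff_mk, smul_eq_mul, map_add, coeff_mul,
        map_sum, Derivation.leibniz, Finset.sum_add_distrib]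
      congr 1
      exact Finset.Nat.sum_antidiagonal_swap (n := n)
        (f := fun x : ℕ × ℕ => coeff x.1 g * D (coeff x.2 f))

@[simp] theorem coeff_coeffwise (D : Derivation ℂ A A) (n : ℕ) (f : A⟦X⟧) :
    coeff n (coeffwise D f) = D (coeff n f) := by
  change coeff n (PowerSeries.mk fun n => D (coeff n f)) = _
  simp

@[simp] theorem coeffwise_X (D : Derivation ℂ A A) : coeffwise D X = 0 := by
  ext n; rw [coeff_coeffwise, coeff_X]; split_ifs <;> simp

@[simp] theorem coeffwise_C (D : Derivation ℂ A A) (r : A) : coeffwise D (C r) = C (D r) := by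
  ext n; rw [coeff_coeffwise, coeff_C, coeff_C]; split_ifs <;> simp

theorem coeffwise_theta (D : Derivation ℂ A A) (f : A⟦X⟧) :
    coeffwise D (theta f) = theta (coeffwise D f) := by
  ext n; simp [coeff_theta]

end PowerSeriesDerivations

end SLEVir

namespace SLEVir

/-! ### Words in the lowering operators and the structure of cyclic modules -/

namespace VirasoroRep

variable {c : ℂ} {M N : Type*} [AddCommGroup M] [Module ℂ M] [AddCommGroup N] [Module ℂ N]

theorem comm_apply (R : VirasoroRep c M) (m n : ℤ) (v : M) :
    R.L m (R.L n v) = R.L n (R.L m v) + ((m : ℂ) - n) • R.L (m + n) v +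
      if m + n = 0 then ((((m : ℂ) ^ 3 - m) / 12) * c) • v else 0 := by
  have h := LinearMap.congr_fun (R.comm m n) v
  rw [LinearMap.sub_apply, sub_eq_iff_eq_add] at h
  rw [← Module.End.mul_apply, h]
  split_ifs <;> simp [add_comm, add_left_comm]

/-- The generalized eigenspace of `L_0` for the eigenvalue `η`. -/
abbrev gen (R : VirasoroRep c M) (η : ℂ) : Submodule ℂ M :=
  Module.End.maxGenEigenspace (R.L 0) η

theorem cyclic_le (R : VirasoroRep c M) {v : M} {W : Submodule ℂ M} (hW : R.Stable W)
    (hv : v ∈ W) : R.cyclic v ≤ W := sInf_le ⟨hW, hv⟩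

theorem gen_disjoint (R : VirasoroRep c M) {η θ : ℂ} (h : η ≠ θ) {x : M} (hx : x ∈ R.gen η)
    (hy : x ∈ R.gen θ) : x = 0 := by
  have h1 := (Module.End.independent_maxGenEigenspace (R.L 0)).pairwiseDisjoint h
  exact Submodule.disjoint_def.mp h1 x hx hy

theorem gen_mem_apply (R : VirasoroRep c M) {η : ℂ} {x : M} (hx : x ∈ R.gen η) (n : ℤ) :
    R.L n x ∈ R.gen (η - n) := R.map_maxGenEigenspace n η hx

theorem mem_gen_of_eigen (R : VirasoroRep c M) {η : ℂ} {x : M} (hx : R.L 0 x = η • x) :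
    x ∈ R.gen η := by
  rw [Module.End.mem_maxGenEigenspace]
  exact ⟨1, by simp [hx]⟩

/-- The operator `L_{-(i_1+1)} ⋯ L_{-(i_k+1)}` attached to the list `[i_1, …, i_k]`. -/
def word (R : VirasoroRep c M) (l : List ℕ) : Module.End ℂ M :=
  (l.map fun i : ℕ => R.L (-((i : ℤ) + 1))).prod

@[simp] theorem word_nil (R : VirasoroRep c M) : R.word [] = 1 := rfl

theorem word_cons (R : VirasoroRep c M) (i : ℕ) (l : List ℕ) (v : M) :
    R.word (i :: l) v = R.L (-((i : ℤ) + 1)) (R.word l v) := by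
  simp [word]

/-- The amount by which a word raises the eigenvalue of `L_0`. -/
def wt (l : List ℕ) : ℕ := (l.map (· + 1)).sum

@[simp] theorem wt_nil : wt [] = 0 := rfl

@[simp] theorem wt_cons (i : ℕ) (l : List ℕ) : wt (i :: l) = i + 1 + wt l := by simp [wt]

theorem word_mem_gen (R : VirasoroRep c M) {η : ℂ} {b : M} (hb : b ∈ R.gen η) (l : List ℕ) :
    R.word l b ∈ R.gen (η + wt l) := by
  induction l with
  | nil => simpa using hb
  | cons i l ih =>
    rw [word_cons]
    have := R.gen_mem_apply ih (-((i : ℤ) + 1))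
    convert this using 2
    push_cast [wt_cons]; ring

theorem finite_wt_eq (N : ℕ) : {l : List ℕ | wt l = N}.Finite := by
  induction N using Nat.strong_induction_on with
  | _ N ih =>
    have h : {l : List ℕ | wt l = N} ⊆
        {[]} ∪ ⋃ i ∈ Set.Iio N, (fun l => i :: l) '' {l : List ℕ | wt l = N - (i + 1)} := by
      rintro (_ | ⟨i, l⟩) hl
      · simp
      · right
        simp only [Set.mem_ofPred_eq, wt_cons] at hl
        simp only [Set.mem_Iio, Set.mem_iUnion, Set.mem_image, Set.mem_ofPred_eq]
        exact ⟨i, by omega, l, by omega, rfl⟩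
    refine Set.Finite.subset ?_ h
    refine (Set.finite_singleton _).union (Set.Finite.biUnion (Set.finite_Iio N) fun i hi => ?_)
    simp only [Set.mem_Iio] at hi
    exact (ih _ (by omega)).image _

/-- The span of the words of total weight `n` applied to the vectors of `B`. -/
def level (R : VirasoroRep c M) (B : Submodule ℂ M) (n : ℕ) : Submodule ℂ M :=
  ⨆ l ∈ {l : List ℕ | wt l = n}, B.map (R.word l)

/-- A space of vectors on which the `L_n`, `n > 0`, vanish and which is stable under `L_0`, with
the single generalized eigenvalue `h`. -/
structure IsVacuum (R : VirasoroRep c M) (h : ℂ) (B : Submodule ℂ M) : Prop where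
  pos : ∀ n : ℤ, 0 < n → ∀ b ∈ B, R.L n b = 0
  zero : ∀ b ∈ B, R.L 0 b ∈ B
  le_gen : B ≤ R.gen h

theorem word_mem_level (R : VirasoroRep c M) {B : Submodule ℂ M} {b : M} (hb : b ∈ B)
    (l : List ℕ) : R.word l b ∈ R.level B (wt l) :=
  Submodule.mem_iSup_of_mem l (Submodule.mem_iSup_of_mem rfl (Submodule.mem_map_of_mem hb))

theorem level_zero (R : VirasoroRep c M) (B : Submodule ℂ M) : R.level B 0 = B := by
  have : {l : List ℕ | wt l = 0} = {[]} := by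
    ext l; cases l <;> simp
  rw [level, this]; simp [Module.End.one_eq_id]

theorem level_le_gen (R : VirasoroRep c M) {h : ℂ} {B : Submodule ℂ M} (hB : R.IsVacuum h B)
    (n : ℕ) : R.level B n ≤ R.gen (h + n) := by
  refine iSup₂_le fun l hl => ?_
  rintro _ ⟨b, hb, rfl⟩
  have := R.word_mem_gen (hB.le_gen hb) l
  rwa [show wt l = n from hl] at this

theorem level_finiteDimensional (R : VirasoroRep c M) (B : Submodule ℂ M)
    [FiniteDimensional ℂ B] (n : ℕ) : FiniteDimensional ℂ (R.level B n) := by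
  have := (finite_wt_eq n).to_subtype
  rw [level, iSup_subtype']
  infer_instance

/-- The span of all words applied to a vacuum space is a submodule: positive modes are commuted to
the right, which shortens words. -/
theorem iSup_level_stable (R : VirasoroRep c M) {h : ℂ} {B : Submodule ℂ M}
    (hB : R.IsVacuum h B) : R.Stable (⨆ n, R.level B n) := by
  set S := ⨆ n, R.level B n with hS
  have hw : ∀ (l : List ℕ), ∀ b ∈ B, R.word l b ∈ S := fun l b hb =>
    Submodule.mem_iSup_of_mem _ (R.word_mem_level hb l)
  have hind : ∀ {W : Submodule ℂ M} (f : Module.End ℂ M),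
      (∀ l : List ℕ, ∀ b ∈ B, f (R.word l b) ∈ W) → ∀ x ∈ S, f x ∈ W := by
    intro W f hf x hx
    have : S ≤ W.comap f := by
      refine iSup_le fun n => iSup₂_le fun l _ => ?_
      rintro _ ⟨b, hb, rfl⟩
      exact hf l b hb
    exact this hx
  have hneg : ∀ (i : ℕ), ∀ x ∈ S, R.L (-((i : ℤ) + 1)) x ∈ S := fun i =>
    hind _ fun l b hb => by rw [← word_cons]; exact hw _ _ hb
  have key : ∀ (l : List ℕ) (n : ℤ), ∀ b ∈ B, R.L n (R.word l b) ∈ S := by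
    intro l
    induction l with
    | nil =>
      intro n b hb
      rcases lt_trichotomy n 0 with hn | rfl | hn
      · obtain ⟨i, rfl⟩ : ∃ i : ℕ, n = -((i : ℤ) + 1) := ⟨(-n - 1).toNat, by omega⟩
        exact hneg i _ (hw [] b hb)
      · exact hw [] _ (hB.zero b hb)
      · simp [hB.pos n hn b hb]
    | cons i l ih =>
      intro n b hb
      rcases lt_or_ge n 0 with hn | hn
      · obtain ⟨j, rfl⟩ : ∃ i : ℕ, n = -((i : ℤ) + 1) := ⟨(-n - 1).toNat, by omega⟩
        exact hneg j _ (hw _ b hb)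
      · rw [word_cons, R.comm_apply]
        refine S.add_mem (S.add_mem (hneg i _ (ih n b hb)) (S.smul_mem _ (ih _ b hb))) ?_
        split_ifs
        · exact S.smul_mem _ (hw l b hb)
        · exact S.zero_mem
  exact fun n => hind (R.L n) fun l b hb => key l n b hb

theorem level_le_of_stable (R : VirasoroRep c M) {B W : Submodule ℂ M} (hW : R.Stable W)
    (hB : B ≤ W) (n : ℕ) : R.level B n ≤ W := by
  refine iSup₂_le fun l hl => ?_
  clear hl
  rintro _ ⟨b, hb, rfl⟩
  induction l with
  | nil => exact hB hb
  | cons i l ih => rw [word_cons]; exact hW _ _ ih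

/-- In the module generated by a vacuum space, the generalized eigenspaces of `L_0` are the spans
of the words of fixed weight. -/
theorem mem_level_of_mem_gen (R : VirasoroRep c M) {h : ℂ} {B : Submodule ℂ M}
    (hB : R.IsVacuum h B) {x : M} (hx : x ∈ ⨆ n, R.level B n) {n : ℕ}
    (hx' : x ∈ R.gen (h + n)) : x ∈ R.level B n := by
  have hsplit : ⨆ m, R.level B m ≤ R.level B n ⊔ ⨆ m ≠ n, R.level B m := by
    refine iSup_le fun m => ?_
    rcases eq_or_ne m n with rfl | hm
    · exact le_sup_left
    · exact le_sup_of_le_right (le_iSup₂_of_le m hm le_rfl)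
  obtain ⟨y, hy, z, hz, rfl⟩ := Submodule.mem_sup.mp (hsplit hx)
  have hz1 : z ∈ R.gen (h + n) := by
    have := Submodule.sub_mem _ hx' (R.level_le_gen hB n hy)
    simpa using this
  have hz2 : z ∈ ⨆ θ ≠ h + (n : ℂ), R.gen θ := by
    refine (iSup₂_le fun m hm => ?_ : (⨆ m ≠ n, R.level B m) ≤ _) hz
    refine (R.level_le_gen hB m).trans
      (le_iSup₂_of_le (h + (m : ℂ)) (fun hh => hm ?_) le_rfl)
    exact_mod_cast add_left_cancel hh
  have h1 := (Module.End.independent_maxGenEigenspace (R.L 0)) (h + n)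
  rw [Submodule.disjoint_def.mp h1 z hz1 hz2, add_zero]
  exact hy

/-- A subspace stable under `L_0` that meets a finite sum of generalized eigenspaces non-trivially
meets one of them non-trivially. -/
theorem exists_mem_gen (R : VirasoroRep c M) {Y : Submodule ℂ M} (hY : ∀ y ∈ Y, R.L 0 y ∈ Y)
    (η : ℕ → ℂ) (s : Finset ℕ) :
    ∀ y ∈ Y, y ≠ 0 → y ∈ ⨆ n ∈ s, R.gen (η n) → ∃ n ∈ s, ∃ z ∈ Y, z ≠ 0 ∧ z ∈ R.gen (η n) := by
  induction s using Finset.induction_on with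
  | empty => intro y _ h0 h; simp at h; exact absurd h h0
  | insert n s _ ih =>
    intro y hy h0 h
    rw [Finset.iSup_insert] at h
    obtain ⟨u, hu, w, hw, rfl⟩ := Submodule.mem_sup.mp h
    obtain ⟨k, hk⟩ := (Module.End.mem_maxGenEigenspace _ _ _).mp hu
    set f := R.L 0 - η n • (1 : Module.End ℂ M) with hf
    have hfY : ∀ j : ℕ, ∀ z ∈ Y, (f ^ j) z ∈ Y := by
      intro j
      induction j with
      | zero => simp
      | succ j ihj =>
        intro z hz
        rw [pow_succ, Module.End.mul_apply]
        refine ihj _ ?_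
        simpa [hf] using Y.sub_mem (hY z hz) (Y.smul_mem _ hz)
    have hfg : ∀ j : ℕ, ∀ z ∈ ⨆ m ∈ s, R.gen (η m), (f ^ j) z ∈ ⨆ m ∈ s, R.gen (η m) := by
      intro j
      induction j with
      | zero => simp
      | succ j ihj =>
        intro z hz
        rw [pow_succ, Module.End.mul_apply]
        refine ihj _ ?_
        have : (⨆ m ∈ s, R.gen (η m)) ≤ (⨆ m ∈ s, R.gen (η m)).comap f := by
          refine iSup₂_le fun m hm x hx => ?_
          refine Submodule.mem_iSup_of_mem m (Submodule.mem_iSup_of_mem hm ?_)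
          have h1 := R.gen_mem_apply hx 0
          simp only [Int.cast_zero, sub_zero] at h1
          simpa [hf] using (R.gen (η m)).sub_mem h1 ((R.gen (η m)).smul_mem _ hx)
        exact this hz
    by_cases hz : (f ^ k) (u + w) = 0
    · exact ⟨n, Finset.mem_insert_self _ _, u + w, hy, h0,
        (Module.End.mem_maxGenEigenspace _ _ _).mpr ⟨k, hz⟩⟩
    · have h2 : (f ^ k) (u + w) ∈ ⨆ m ∈ s, R.gen (η m) := by
        rw [map_add, hk, zero_add]; exact hfg k w hw
      obtain ⟨m, hm, z, h3⟩ := ih _ (hfY k _ hy) hz h2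
      exact ⟨m, Finset.mem_insert_of_mem hm, z, h3⟩

/-- `M` is the sum of the generalized eigenspaces of `L_0` with eigenvalues in `h + ℕ`. -/
def Graded (R : VirasoroRep c M) (h : ℂ) : Prop := ⨆ n : ℕ, R.gen (h + n) = ⊤

theorem graded_of_level (R : VirasoroRep c M) {h : ℂ} {B : Submodule ℂ M}
    (hB : R.IsVacuum h B) (ht : ⨆ n, R.level B n = ⊤) : R.Graded h :=
  top_le_iff.mp (ht ▸ iSup_mono fun n => R.level_le_gen hB n)

theorem Graded.exists_mem_gen {R : VirasoroRep c M} {h : ℂ} (hR : R.Graded h)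
    {Y : Submodule ℂ M} (hY : ∀ y ∈ Y, R.L 0 y ∈ Y) {y : M} (hy : y ∈ Y) (h0 : y ≠ 0) :
    ∃ n : ℕ, ∃ z ∈ Y, z ≠ 0 ∧ z ∈ R.gen (h + n) := by
  have : y ∈ ⨆ n : ℕ, R.gen (h + n) := by rw [hR]; trivial
  obtain ⟨s, hs⟩ := (Submodule.mem_iSup_iff_exists_finset).mp this
  obtain ⟨n, _, h1⟩ := R.exists_mem_gen hY (fun n : ℕ => h + n) s y hy h0 hs
  exact ⟨n, h1⟩

/-- A non-zero submodule of a graded module contains a singular vector: a non-zero vector of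
lowest level is annihilated by all positive modes. -/
theorem Graded.exists_singular {R : VirasoroRep c M} {h : ℂ} (hR : R.Graded h)
    {Y : Submodule ℂ M} (hY : R.Stable Y) (h0 : Y ≠ ⊥) :
    ∃ n : ℕ, ∃ z ∈ Y, z ≠ 0 ∧ z ∈ R.gen (h + n) ∧ ∀ m : ℤ, 0 < m → R.L m z = 0 := by
  classical
  obtain ⟨y, hy, hy0⟩ := Submodule.exists_mem_ne_zero_of_ne_bot h0
  have hex := hR.exists_mem_gen (fun y hy => hY 0 y hy) hy hy0
  obtain ⟨z, hz, hz0, hzg⟩ := Nat.find_spec hex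
  refine ⟨Nat.find hex, z, hz, hz0, hzg, fun m hm => ?_⟩
  by_contra hne
  have hg := R.gen_mem_apply hzg m
  obtain ⟨k, w, hw, hw0, hwg⟩ := hR.exists_mem_gen
    (Y := Y ⊓ R.gen (h + (Nat.find hex : ℕ) - m))
    (fun y hy => ⟨hY 0 y hy.1, by simpa using R.gen_mem_apply hy.2 0⟩) ⟨hY m z hz, hg⟩ hne
  by_cases hk : h + (k : ℂ) = h + (Nat.find hex : ℕ) - m
  · have hk' : (k : ℤ) = (Nat.find hex : ℕ) - m := by
      have : (k : ℂ) = (Nat.find hex : ℕ) - m := by linear_combination hk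
      exact_mod_cast this
    exact Nat.find_min hex (m := k) (by omega) ⟨w, hw.1, hw0, hwg⟩
  · exact hw0 (R.gen_disjoint hk hwg hw.2)

/-! ### Vacuum spaces spanned by a vector and its image under `L_0 - h` -/

/-- A vector annihilated by the positive modes and by `(L_0 - h)²`. -/
structure IsLogVacuum (R : VirasoroRep c M) (h : ℂ) (ξ : M) : Prop where
  pos : ∀ n : ℤ, 0 < n → R.L n ξ = 0
  log : R.L 0 (R.L 0 ξ - h • ξ) = h • (R.L 0 ξ - h • ξ)

/-- The span of `ξ` and `(L_0 - h) ξ`. -/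
def vac (R : VirasoroRep c M) (h : ℂ) (ξ : M) : Submodule ℂ M :=
  Submodule.span ℂ {ξ, R.L 0 ξ - h • ξ}

instance (R : VirasoroRep c M) (h : ℂ) (ξ : M) : FiniteDimensional ℂ (R.vac h ξ) :=
  FiniteDimensional.span_of_finite ℂ (Set.toFinite _)

theorem IsLogVacuum.isVacuum {R : VirasoroRep c M} {h : ℂ} {ξ : M} (hξ : R.IsLogVacuum h ξ) :
    R.IsVacuum h (R.vac h ξ) where
  pos n hn b hb := by
    obtain ⟨a, b, rfl⟩ := Submodule.mem_span_pair.mp hb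
    have h1 : R.L n (R.L 0 ξ) = 0 := by
      rw [R.comm_apply, hξ.pos n hn, add_zero, hξ.pos n hn]
      simp [hn.ne']
    simp [hξ.pos n hn, h1]
  zero b hb := by
    obtain ⟨a, b, rfl⟩ := Submodule.mem_span_pair.mp hb
    refine Submodule.mem_span_pair.mpr ⟨a * h, a + b * h, ?_⟩
    rw [map_add, map_smul, map_smul, hξ.log]
    module
  le_gen := by
    refine Submodule.span_le.mpr ?_
    have h2 : R.L 0 ξ - h • ξ ∈ R.gen h := R.mem_gen_of_eigen hξ.log
    rintro x (rfl | rfl)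
    · simp only [SetLike.mem_coe, Module.End.mem_maxGenEigenspace]
      refine ⟨2, ?_⟩
      have := hξ.log
      rw [pow_two, Module.End.mul_apply]
      simpa [sub_eq_zero] using this
    · exact h2

theorem IsLogVacuum.cyclic_eq {R : VirasoroRep c M} {h : ℂ} {ξ : M} (hξ : R.IsLogVacuum h ξ) :
    R.cyclic ξ = ⨆ n, R.level (R.vac h ξ) n := by
  apply le_antisymm
  · refine R.cyclic_le (R.iSup_level_stable hξ.isVacuum) (Submodule.mem_iSup_of_mem 0 ?_)
    rw [level_zero]
    exact Submodule.subset_span (by simp)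
  · refine iSup_le fun n => R.level_le_of_stable (R.cyclic_stable ξ) ?_ n
    refine Submodule.span_le.mpr ?_
    have h1 := R.mem_cyclic ξ
    rintro x (rfl | rfl)
    · exact h1
    · exact Submodule.sub_mem _ (R.cyclic_stable ξ 0 ξ h1) (Submodule.smul_mem _ _ h1)

theorem IsLogVacuum.graded {R : VirasoroRep c M} {h : ℂ} {ξ : M} (hξ : R.IsLogVacuum h ξ)
    (ht : R.cyclic ξ = ⊤) : R.Graded h :=
  R.graded_of_level hξ.isVacuum (hξ.cyclic_eq.symm.trans ht)

theorem IsLogVacuum.mem_vac {R : VirasoroRep c M} {h : ℂ} {ξ : M} (hξ : R.IsLogVacuum h ξ)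
    {x : M} (hx : x ∈ R.cyclic ξ) (hx' : x ∈ R.gen h) : x ∈ R.vac h ξ := by
  rw [hξ.cyclic_eq] at hx
  have := R.mem_level_of_mem_gen hξ.isVacuum hx (n := 0) (by simpa using hx')
  rwa [level_zero] at this

theorem isLogVacuum_of_hw (R : VirasoroRep c M) {h : ℂ} {w : M} (h0 : R.L 0 w = h • w)
    (hp : ∀ n : ℤ, 0 < n → R.L n w = 0) : R.IsLogVacuum h w :=
  ⟨hp, by simp [h0]⟩

/-! ### Subrepresentations, products, and the action of the enveloping algebra -/

@[simp] theorem sub_L_coe (R : VirasoroRep c M) {W : Submodule ℂ M} (hW : R.Stable W) (n : ℤ)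
    (x : W) : (((R.sub W hW).L n x : W) : M) = R.L n x := rfl

theorem sub_mem_gen (R : VirasoroRep c M) {W : Submodule ℂ M} (hW : R.Stable W) {η : ℂ} {x : W} :
    x ∈ (R.sub W hW).gen η ↔ (x : M) ∈ R.gen η := by
  have key : ∀ k : ℕ, (((((R.sub W hW).L 0 - η • (1 : Module.End ℂ W)) ^ k) x : W) : M) =
      ((R.L 0 - η • (1 : Module.End ℂ M)) ^ k) x := by
    intro k
    induction k with
    | zero => simp
    | succ k ih => rw [pow_succ', pow_succ', Module.End.mul_apply, Module.End.mul_apply, ← ih]; simp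
  rw [Module.End.mem_maxGenEigenspace, Module.End.mem_maxGenEigenspace]
  refine exists_congr fun k => ?_
  rw [← key k, ZeroMemClass.coe_eq_zero]

theorem sub_cyclic (R : VirasoroRep c M) {W : Submodule ℂ M} (hW : R.Stable W) (x : W) :
    (R.sub W hW).cyclic x = (R.cyclic (x : M)).comap W.subtype := by
  apply le_antisymm
  · exact cyclic_le _ (fun n y hy => R.cyclic_stable _ n _ hy) (R.mem_cyclic _)
  · intro y hy
    have : R.cyclic (x : M) ≤ ((R.sub W hW).cyclic x).map W.subtype := by
      refine R.cyclic_le ?_ ⟨x, mem_cyclic _ _, rfl⟩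
      rintro n _ ⟨z, hz, rfl⟩
      exact ⟨(R.sub W hW).L n z, cyclic_stable _ _ n z hz, rfl⟩
    obtain ⟨z, hz, hzy⟩ := this hy
    rwa [← Subtype.ext hzy]

theorem sub_cyclic_self (R : VirasoroRep c M) (v : M) :
    (R.sub (R.cyclic v) (R.cyclic_stable v)).cyclic ⟨v, R.mem_cyclic v⟩ = ⊤ := by
  rw [sub_cyclic]; ext x; simp

/-- The direct sum of two representations. -/
def prod (R : VirasoroRep c M) (S : VirasoroRep c N) : VirasoroRep c (M × N) where
  L n := (R.L n).prodMap (S.L n)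
  comm m n := by
    refine LinearMap.ext fun v => Prod.ext ?_ ?_
    · have h := LinearMap.congr_fun (R.comm m n) v.1
      split_ifs at h ⊢ <;> simpa using h
    · have h := LinearMap.congr_fun (S.comm m n) v.2
      split_ifs at h ⊢ <;> simpa using h

@[simp] theorem prod_L_apply (R : VirasoroRep c M) (S : VirasoroRep c N) (n : ℤ) (v : M × N) :
    (R.prod S).L n v = (R.L n v.1, S.L n v.2) := rfl

theorem IsLogVacuum.prod {R : VirasoroRep c M} {S : VirasoroRep c N} {h : ℂ} {ξ : M} {χ : N}
    (hξ : R.IsLogVacuum h ξ) (hχ : S.IsLogVacuum h χ) : (R.prod S).IsLogVacuum h (ξ, χ) where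
  pos n hn := by simp [hξ.pos n hn, hχ.pos n hn]
  log := by
    have h1 := hξ.log
    have h2 := hχ.log
    exact Prod.ext h1 h2

theorem prod_mem_gen (R : VirasoroRep c M) (S : VirasoroRep c N) {η : ℂ} {y : N}
    (hy : y ∈ S.gen η) : ((0, y) : M × N) ∈ (R.prod S).gen η := by
  rw [Module.End.mem_maxGenEigenspace] at hy ⊢
  obtain ⟨k, hk⟩ := hy
  refine ⟨k, ?_⟩
  have key : ∀ k : ℕ, (((R.prod S).L 0 - η • (1 : Module.End ℂ (M × N))) ^ k) (0, y) =
      (0, ((S.L 0 - η • (1 : Module.End ℂ N)) ^ k) y) := by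
    intro k
    induction k with
    | zero => simp
    | succ k ih => rw [pow_succ', pow_succ', Module.End.mul_apply, Module.End.mul_apply, ih]; simp
  rw [key, hk]; rfl

/-- The action of `𝒰` on a representation. -/
def act (R : VirasoroRep c M) : VirU c →ₐ[ℂ] Module.End ℂ M :=
  RingQuot.liftAlgHom ℂ ⟨FreeAlgebra.lift ℂ R.L, by
    rintro _ _ ⟨m, n⟩
    have h := R.comm m n
    split_ifs at h ⊢ <;> simpa using h⟩

@[simp] theorem act_gen (R : VirasoroRep c M) (n : ℤ) : R.act (VirU.gen c n) = R.L n := by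
  simp [act, VirU.gen]

theorem _root_.SLEVir.VirU.induction {c : ℂ} {p : VirU c → Prop}
    (h1 : ∀ r : ℂ, p (algebraMap ℂ _ r))
    (hg : ∀ n, p (VirU.gen c n)) (hm : ∀ a b, p a → p b → p (a * b))
    (ha : ∀ a b, p a → p b → p (a + b)) (u : VirU c) : p u := by
  obtain ⟨u, rfl⟩ := RingQuot.mkAlgHom_surjective ℂ (VirRel c) u
  induction u using FreeAlgebra.induction with
  | grade0 r => simpa using h1 r
  | grade1 n => exact hg n
  | mul a b h1 h2 => rw [map_mul]; exact hm _ _ h1 h2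
  | add a b h1 h2 => rw [map_add]; exact ha _ _ h1 h2

theorem Stable.act_mem {R : VirasoroRep c M} {W : Submodule ℂ M} (hW : R.Stable W) (u : VirU c) :
    ∀ w ∈ W, R.act u w ∈ W := by
  induction u using VirU.induction with
  | h1 r => intro w hw; simpa [Algebra.algebraMap_eq_smul_one] using W.smul_mem r hw
  | hg n => intro w hw; simpa using hW n w hw
  | hm a b ha hb => intro w hw; simpa using ha _ (hb w hw)
  | ha a b ha hb => intro w hw; simpa using W.add_mem (ha w hw) (hb w hw)

/-- The orbit map `u ↦ u v` from `𝒰`. -/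
def orbit (R : VirasoroRep c M) (v : M) : VirU c →ₗ[ℂ] M :=
  (LinearMap.applyₗ v).comp R.act.toLinearMap

@[simp] theorem orbit_apply (R : VirasoroRep c M) (v : M) (u : VirU c) :
    R.orbit v u = R.act u v := rfl

theorem range_orbit (R : VirasoroRep c M) (v : M) : LinearMap.range (R.orbit v) = R.cyclic v := by
  apply le_antisymm
  · rintro _ ⟨u, rfl⟩
    exact (R.cyclic_stable v).act_mem u v (R.mem_cyclic v)
  · refine R.cyclic_le ?_ ⟨1, by simp⟩
    rintro n _ ⟨u, rfl⟩
    exact ⟨VirU.gen c n * u, by simp⟩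

theorem IsHom.act_apply {R : VirasoroRep c M} {S : VirasoroRep c N} {f : M →ₗ[ℂ] N}
    (hf : R.IsHom S f) (u : VirU c) : ∀ v, f (R.act u v) = S.act u (f v) := by
  induction u using VirU.induction with
  | h1 r => intro v; simp [Algebra.algebraMap_eq_smul_one]
  | hg n => intro v; simpa using hf n v
  | hm a b ha hb => intro v; simp [ha, hb]
  | ha a b ha hb => intro v; simp [ha, hb]

theorem prod_act (R : VirasoroRep c M) (S : VirasoroRep c N) (u : VirU c) :
    ∀ v : M × N, (R.prod S).act u v = (R.act u v.1, S.act u v.2) := by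
  induction u using VirU.induction with
  | h1 r => intro v; simp [Algebra.algebraMap_eq_smul_one]; rfl
  | hg n => intro v; simp
  | hm a b ha hb => intro v; simp [ha, hb]
  | ha a b ha hb => intro v; simp [ha, hb]

/-- A homomorphism out of a cyclic module exists as soon as relations are respected. -/
theorem exists_hom_of_orbit (R : VirasoroRep c M) (S : VirasoroRep c N) {ξ : M} {χ : N}
    (ht : R.cyclic ξ = ⊤) (hrel : ∀ u, R.act u ξ = 0 → S.act u χ = 0) :
    ∃ f : M →ₗ[ℂ] N, R.IsHom S f ∧ f ξ = χ := by
  have hsurj : Function.Surjective (R.orbit ξ) := by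
    rw [← LinearMap.range_eq_top, range_orbit, ht]
  let f : M →ₗ[ℂ] N := ((LinearMap.ker (R.orbit ξ)).liftQ (S.orbit χ) fun u hu => by
    simpa using hrel u (by simpa using hu)).comp
    ((R.orbit ξ).quotKerEquivOfSurjective hsurj).symm.toLinearMap
  have hf : ∀ u, f (R.act u ξ) = S.act u χ := by
    intro u
    have : ((R.orbit ξ).quotKerEquivOfSurjective hsurj).symm (R.act u ξ) =
        Submodule.Quotient.mk u := by
      rw [LinearEquiv.symm_apply_eq]; rfl
    simp only [f, LinearMap.comp_apply, LinearEquiv.coe_coe, this]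
    rfl
  refine ⟨f, fun n v => ?_, by simpa using hf 1⟩
  obtain ⟨u, rfl⟩ := hsurj v
  have := hf (VirU.gen c n * u)
  simp only [map_mul, Module.End.mul_apply, act_gen] at this
  simp [this, hf]

/-- Extension of a map of logarithmic vacuum vectors to the cyclic modules. The submodule of
those `y` with `(0, y)` in the module generated by `(ξ, χ)` has no singular vectors, so it
vanishes. -/
theorem exists_hom_of_no_singular {R : VirasoroRep c M} {S : VirasoroRep c N} {h : ℂ} {ξ : M}
    {χ : N} (ht : R.cyclic ξ = ⊤) (hξ : R.IsLogVacuum h ξ) (hχ : S.IsLogVacuum h χ)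
    (hS : S.Graded h)
    (hsing : ∀ n : ℕ, 0 < n → ∀ y ∈ S.gen (h + n), (∀ m : ℤ, 0 < m → S.L m y = 0) → y = 0)
    (hli : ∀ a b : ℂ, a • ξ + b • (R.L 0 ξ - h • ξ) = 0 →
      a • χ + b • (S.L 0 χ - h • χ) = 0) :
    ∃ f : M →ₗ[ℂ] N, R.IsHom S f ∧ f ξ = χ := by
  refine exists_hom_of_orbit R S ht fun u hu => ?_
  set Y : Submodule ℂ N := ((R.prod S).cyclic (ξ, χ)).comap (LinearMap.inr ℂ M N) with hYdef
  have hYm : ∀ y, y ∈ Y ↔ ((0, y) : M × N) ∈ (R.prod S).cyclic (ξ, χ) := fun y => Iff.rfl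
  have hY : S.Stable Y := by
    intro n y hy
    rw [hYm] at hy ⊢
    simpa using (R.prod S).cyclic_stable _ n _ hy
  have hbot : Y = ⊥ := by
    by_contra hne
    obtain ⟨n, z, hz, hz0, hzg, hzp⟩ := hS.exists_singular hY hne
    rcases Nat.eq_zero_or_pos n with rfl | hn
    · apply hz0
      have h1 := (hξ.prod hχ).mem_vac ((hYm z).mp hz)
        (R.prod_mem_gen S (by simpa using hzg))
      obtain ⟨a, b, hab⟩ := Submodule.mem_span_pair.mp h1
      have h2 := congrArg Prod.fst hab
      have h3 := congrArg Prod.snd hab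
      simp only [prod_L_apply, Prod.smul_mk, Prod.mk_sub_mk, Prod.mk_add_mk] at h2 h3
      rw [← h3, hli a b h2]
    · exact hz0 (hsing n hn z hzg hzp)
  have : S.act u χ ∈ Y := by
    rw [hYm]
    have h1 := ((R.prod S).cyclic_stable (ξ, χ)).act_mem u _ ((R.prod S).mem_cyclic _)
    rwa [prod_act, hu] at h1
  rw [hbot] at this
  exact (Submodule.mem_bot ℂ).mp this

end VirasoroRep
end SLEVir

namespace SLEVir

/-! ### Self-duality of modules generated by a logarithmic vacuum vector -/

namespace VirasoroRep

variable {c : ℂ} {M N : Type*} [AddCommGroup M] [Module ℂ M] [AddCommGroup N] [Module ℂ N]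

theorem IsHom.gen_mem {R : VirasoroRep c M} {S : VirasoroRep c N} {f : M →ₗ[ℂ] N}
    (hf : R.IsHom S f) {η : ℂ} {x : M} (hx : x ∈ R.gen η) : f x ∈ S.gen η := by
  rw [Module.End.mem_maxGenEigenspace] at hx ⊢
  obtain ⟨k, hk⟩ := hx
  refine ⟨k, ?_⟩
  have key : ∀ (k : ℕ) (x : M), f (((R.L 0 - η • (1 : Module.End ℂ M)) ^ k) x) =
      ((S.L 0 - η • (1 : Module.End ℂ N)) ^ k) (f x) := by
    intro k
    induction k with
    | zero => simp
    | succ k ih =>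
      intro x
      rw [pow_succ, pow_succ, Module.End.mul_apply, Module.End.mul_apply, ih]
      simp [hf 0 x]
  rw [← key, hk, map_zero]

theorem gen_pow_mem (R : VirasoroRep c M) {η θ : ℂ} (k : ℕ) :
    ∀ x ∈ R.gen η, ((R.L 0 - θ • (1 : Module.End ℂ M)) ^ k) x ∈ R.gen η := by
  induction k with
  | zero => simp
  | succ k ih =>
    intro x hx
    rw [pow_succ, Module.End.mul_apply]
    refine ih _ ?_
    have h1 := R.gen_mem_apply hx 0
    simp only [Int.cast_zero, sub_zero] at h1
    simpa using (R.gen η).sub_mem h1 ((R.gen η).smul_mem _ hx)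

theorem Graded.isCompl {R : VirasoroRep c M} {h : ℂ} (hR : R.Graded h) (n : ℕ) :
    IsCompl (R.gen (h + n)) (⨆ m ≠ n, R.gen (h + (m : ℕ))) := by
  constructor
  · refine ((Module.End.independent_maxGenEigenspace (R.L 0)) (h + n)).mono_right ?_
    refine iSup₂_le fun m hm => le_iSup₂_of_le (h + (m : ℂ)) (fun hh => hm ?_) le_rfl
    exact_mod_cast add_left_cancel hh
  · rw [codisjoint_iff, ← top_le_iff, ← hR]
    refine iSup_le fun m => ?_
    rcases eq_or_ne m n with rfl | hm
    · exact le_sup_left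
    · exact le_sup_of_le_right (le_iSup₂_of_le m hm le_rfl)

/-- The part of a linear functional on the generalized eigenspace of level `n`. -/
def Graded.part {R : VirasoroRep c M} {h : ℂ} (hR : R.Graded h) (n : ℕ) (f : Module.Dual ℂ M) :
    Module.Dual ℂ M :=
  f.comp ((R.gen (h + n)).subtype.comp
    (Submodule.projectionOnto _ _ (hR.isCompl n)))

theorem Graded.part_self {R : VirasoroRep c M} {h : ℂ} (hR : R.Graded h) {n : ℕ}
    (f : Module.Dual ℂ M) {x : M} (hx : x ∈ R.gen (h + n)) : hR.part n f x = f x := by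
  have := Submodule.projectionOnto_apply_left (hR.isCompl n) ⟨x, hx⟩
  simp only [part, LinearMap.comp_apply, this, Submodule.subtype_apply]

theorem Graded.part_other {R : VirasoroRep c M} {h : ℂ} (hR : R.Graded h) {n m : ℕ}
    (hm : m ≠ n) (f : Module.Dual ℂ M) {x : M} (hx : x ∈ R.gen (h + m)) : hR.part n f x = 0 := by
  have : x ∈ ⨆ m ≠ n, R.gen (h + (m : ℕ)) :=
    Submodule.mem_iSup_of_mem m (Submodule.mem_iSup_of_mem hm hx)
  have h2 := (Submodule.projectionOnto_apply_eq_zero_iff (hR.isCompl n)).mpr this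
  simp only [part, LinearMap.comp_apply, h2, map_zero]

theorem Graded.dual_ext {R : VirasoroRep c M} {h : ℂ} (hR : R.Graded h) {f g : Module.Dual ℂ M}
    (hfg : ∀ n : ℕ, ∀ x ∈ R.gen (h + n), f x = g x) : f = g := by
  have : ⨆ n : ℕ, R.gen (h + n) ≤ LinearMap.eqLocus f g := iSup_le fun n x hx => hfg n x hx
  rw [hR] at this
  exact LinearMap.ext fun x => this trivial

theorem Graded.exists_nat {R : VirasoroRep c M} {h : ℂ} (hR : R.Graded h) {η : ℂ} {x : M}
    (hx : x ∈ R.gen η) (h0 : x ≠ 0) : ∃ n : ℕ, η = h + n := by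
  obtain ⟨n, z, hz, hz0, hzn⟩ := hR.exists_mem_gen (Y := R.gen η)
    (fun y hy => by simpa using R.gen_mem_apply hy 0) hx h0
  refine ⟨n, ?_⟩
  by_contra hne
  exact hz0 (R.gen_disjoint hne hz hzn)

theorem Graded.mem_restrictedDual {R : VirasoroRep c M} {h : ℂ} (hR : R.Graded h)
    {f : Module.Dual ℂ M} (s : Finset ℕ)
    (hf : ∀ n : ℕ, n ∉ s → ∀ x ∈ R.gen (h + n), f x = 0) : f ∈ R.restrictedDual := by
  refine (s.finite_toSet.image fun n : ℕ => h + (n : ℂ)).subset ?_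
  rintro η ⟨v, hv, hfv⟩
  obtain ⟨n, rfl⟩ := hR.exists_nat hv (fun h0 => hfv (by rw [h0, map_zero]))
  refine ⟨n, ?_, rfl⟩
  by_contra hn
  exact hfv (hf n hn v hv)

@[simp] theorem contragredient_L_coe (R : VirasoroRep c M) (n : ℤ) (f : R.restrictedDual) :
    ((R.contragredient.L n f : R.restrictedDual) : Module.Dual ℂ M) =
      (f : Module.Dual ℂ M).comp (R.L (-n)) := rfl

theorem contragredient_pow_apply (R : VirasoroRep c M) (η : ℂ) (k : ℕ) (f : R.restrictedDual) :
    ((((R.contragredient.L 0 - η • (1 : Module.End ℂ R.restrictedDual)) ^ k) f :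
      R.restrictedDual) : Module.Dual ℂ M) =
      (f : Module.Dual ℂ M).comp ((R.L 0 - η • (1 : Module.End ℂ M)) ^ k) := by
  induction k with
  | zero => rfl
  | succ k ih =>
    rw [pow_succ', Module.End.mul_apply, pow_succ]
    ext x
    have h1 := LinearMap.congr_fun ih (R.L 0 x)
    have h2 := LinearMap.congr_fun ih x
    simp only [LinearMap.comp_apply] at h1 h2
    simp [h1, h2]

/-- Different generalized eigenspaces of the contragredient module and of the module are
orthogonal. -/
theorem contragredient_gen_apply (R : VirasoroRep c M) {η θ : ℂ} (hne : η ≠ θ)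
    {f : R.restrictedDual} (hf : f ∈ R.contragredient.gen η) {x : M} (hx : x ∈ R.gen θ) :
    (f : Module.Dual ℂ M) x = 0 := by
  obtain ⟨k, hk⟩ := (Module.End.mem_maxGenEigenspace _ _ _).mp hf
  obtain ⟨j, hj⟩ := (Module.End.mem_maxGenEigenspace _ _ _).mp hx
  have hk' : ∀ y, (f : Module.Dual ℂ M) (((R.L 0 - η • (1 : Module.End ℂ M)) ^ k) y) = 0 := by
    intro y
    have := R.contragredient_pow_apply η k f
    rw [hk] at this
    exact (LinearMap.congr_fun this y).symm
  have hcop : IsCoprime ((Polynomial.X - Polynomial.C η) ^ k)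
      ((Polynomial.X - Polynomial.C θ) ^ j) :=
    (Polynomial.isCoprime_X_sub_C_of_isUnit_sub (sub_ne_zero.mpr hne).isUnit).pow
  obtain ⟨a, b, hab⟩ := hcop
  have h1 := congrArg (fun p => Polynomial.aeval (R.L 0) p x) hab
  have e : ∀ μ : ℂ, algebraMap ℂ (Module.End ℂ M) μ = μ • 1 := fun μ =>
    Algebra.algebraMap_eq_smul_one μ
  rw [mul_comm a] at h1
  simp only [map_add, map_mul, map_pow, map_sub, Polynomial.aeval_X, Polynomial.aeval_C, e,
    map_one, LinearMap.add_apply, Module.End.mul_apply, hj, map_zero, add_zero,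
    Module.End.one_apply] at h1
  rw [← h1, hk']

/-- A functional concentrated in one level lies in the corresponding generalized eigenspace of the
contragredient module. -/
theorem Graded.mem_contragredient_gen {R : VirasoroRep c M} {h : ℂ} (hR : R.Graded h) {n : ℕ}
    [FiniteDimensional ℂ (R.gen (h + n))] {f : R.restrictedDual}
    (hf : ∀ m : ℕ, m ≠ n → ∀ x ∈ R.gen (h + m), (f : Module.Dual ℂ M) x = 0) :
    f ∈ R.contragredient.gen (h + n) := by
  have hkill : ∃ k : ℕ, ∀ x ∈ R.gen (h + n),
      ((R.L 0 - (h + n) • (1 : Module.End ℂ M)) ^ k) x = 0 := by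
    have hfg : (R.gen (h + n)).FG := Module.Finite.iff_fg.mp inferInstance
    obtain ⟨s, hs⟩ := hfg
    have h1 : ∀ x : M, ∃ k : ℕ, x ∈ s → ((R.L 0 - (h + n) • (1 : Module.End ℂ M)) ^ k) x = 0 := by
      intro x
      by_cases hx : x ∈ s
      · have : x ∈ R.gen (h + n) := hs ▸ Submodule.subset_span hx
        obtain ⟨k, hk⟩ := (Module.End.mem_maxGenEigenspace _ _ _).mp this
        exact ⟨k, fun _ => hk⟩
      · exact ⟨0, fun h => absurd h hx⟩
    choose k hk using h1
    refine ⟨s.sup k, ?_⟩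
    have : Submodule.span ℂ (s : Set M) ≤
        LinearMap.ker ((R.L 0 - (h + n) • (1 : Module.End ℂ M)) ^ s.sup k) := by
      refine Submodule.span_le.mpr fun x hx => ?_
      have hle : k x ≤ s.sup k := Finset.le_sup hx
      rw [SetLike.mem_coe, LinearMap.mem_ker, ← Nat.sub_add_cancel hle, pow_add,
        Module.End.mul_apply, hk x hx, map_zero]
    intro x hx
    exact this (hs.symm ▸ hx)
  obtain ⟨k, hk⟩ := hkill
  rw [Module.End.mem_maxGenEigenspace]
  refine ⟨k, Subtype.ext ?_⟩
  rw [contragredient_pow_apply]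
  refine hR.dual_ext fun m x hx => ?_
  rcases eq_or_ne m n with rfl | hm
  · simp [hk x hx]
  · simpa using hf m hm _ (R.gen_pow_mem k x hx)

theorem Graded.contragredient {R : VirasoroRep c M} {h : ℂ} (hR : R.Graded h)
    (hfin : ∀ n : ℕ, FiniteDimensional ℂ (R.gen (h + n))) : R.contragredient.Graded h := by
  rw [Graded, ← top_le_iff]
  rintro ⟨f, hf⟩ -
  have hfs : Set.Finite {n : ℕ | ∃ v ∈ R.gen (h + n), f v ≠ 0} :=
    Set.Finite.preimage (f := fun n : ℕ => h + (n : ℂ))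
      (fun a _ b _ hab => by exact_mod_cast add_left_cancel hab) hf
  have hpart : ∀ n : ℕ, hR.part n f ∈ R.restrictedDual := fun n =>
    hR.mem_restrictedDual {n} fun m hm x hx => hR.part_other (by simpa using hm) f hx
  have hsum : (⟨f, hf⟩ : R.restrictedDual) = ∑ n ∈ hfs.toFinset, ⟨hR.part n f, hpart n⟩ := by
    apply Subtype.ext
    rw [AddSubmonoidClass.coe_finsetSum]
    refine hR.dual_ext fun m x hx => ?_
    rw [LinearMap.sum_apply]
    by_cases hm : m ∈ hfs.toFinset
    · rw [Finset.sum_eq_single_of_mem m hm fun n _ hn => hR.part_other hn.symm f hx]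
      exact (hR.part_self f hx).symm
    · have h0 : f x = 0 := by
        by_contra h0
        exact hm (by simpa using ⟨x, by simpa using hx, h0⟩)
      rw [Finset.sum_eq_zero fun n hn => ?_]
      · exact h0
      · exact hR.part_other (fun hmn => hm (by rwa [hmn])) f hx
  rw [hsum]
  refine Submodule.sum_mem _ fun n _ => Submodule.mem_iSup_of_mem n ?_
  exact hR.mem_contragredient_gen fun m hm x hx => hR.part_other hm f hx

theorem surjective_of_injective_of_dual {V W : Type*} [AddCommGroup V] [Module ℂ V]
    [AddCommGroup W] [Module ℂ W] [FiniteDimensional ℂ V] (f : V →ₗ[ℂ] W)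
    (hf : Function.Injective f) (g : W →ₗ[ℂ] Module.Dual ℂ V) (hg : Function.Injective g) :
    Function.Surjective f := by
  have : FiniteDimensional ℂ W := Module.Finite.of_injective g hg
  have h1 := LinearMap.finrank_le_finrank_of_injective hf
  have h2 := LinearMap.finrank_le_finrank_of_injective hg
  rw [Subspace.dual_finrank_eq] at h2
  exact (LinearMap.injective_iff_surjective_of_finrank_eq_finrank (h1.antisymm h2)).mp hf

/-- A module generated by a logarithmic vacuum vector that has no singular vectors at positive
levels is isomorphic to its contragredient module: the functional dual to `(L_0 - h) ξ` is a
logarithmic vacuum vector of the contragredient module. -/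
theorem IsLogVacuum.isomorphic_contragredient {R : VirasoroRep c M} {h : ℂ} {ξ : M}
    (hξ : R.IsLogVacuum h ξ) (ht : R.cyclic ξ = ⊤)
    (hli : ∀ a b : ℂ, a • ξ + b • (R.L 0 ξ - h • ξ) = 0 → a = 0 ∧ b = 0)
    (hsing : ∀ n : ℕ, 0 < n → ∀ y ∈ R.gen (h + n), (∀ m : ℤ, 0 < m → R.L m y = 0) → y = 0) :
    R.Isomorphic R.contragredient := by
  set ζ := R.L 0 ξ - h • ξ with hζ
  have hR := hξ.graded ht
  have hlev : ∀ n : ℕ, R.gen (h + n) ≤ R.level (R.vac h ξ) n := fun n x hx =>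
    R.mem_level_of_mem_gen hξ.isVacuum (by rw [← hξ.cyclic_eq, ht]; trivial) hx
  have hfin : ∀ n : ℕ, FiniteDimensional ℂ (R.gen (h + n)) := fun n =>
    have := R.level_finiteDimensional (R.vac h ξ) n
    Submodule.finiteDimensional_of_le (hlev n)
  have hS := hR.contragredient hfin
  have hξg : ξ ∈ R.gen (h + (0 : ℕ)) := by
    simpa using hξ.isVacuum.le_gen (Submodule.subset_span (by simp))
  have hζg : ζ ∈ R.gen (h + (0 : ℕ)) := by
    simpa using hξ.isVacuum.le_gen (Submodule.subset_span (by simp [hζ]))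
  have hvac : ∀ x ∈ R.gen (h + (0 : ℕ)), ∃ a b : ℂ, a • ξ + b • ζ = x := fun x hx => by
    have := hξ.mem_vac (x := x) (by rw [ht]; trivial) (by simpa using hx)
    exact Submodule.mem_span_pair.mp this
  obtain ⟨f, hfξ, hfζ⟩ : ∃ f : Module.Dual ℂ M, f ξ = 0 ∧ f ζ = 1 := by
    have hnm : ζ ∉ Submodule.span ℂ {ξ} := by
      intro hm
      obtain ⟨a, ha⟩ := Submodule.mem_span_singleton.mp hm
      have := (hli a (-1) (by rw [ha]; simp)).2
      norm_num at this
    obtain ⟨f, hf, hle⟩ := Submodule.exists_le_ker_of_notMem hnm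
    refine ⟨(f ζ)⁻¹ • f, ?_, by simp [hf]⟩
    have : f ξ = 0 := hle (Submodule.mem_span_singleton_self ξ)
    simp [this]
  set g := hR.part 0 f with hg
  have hgξ : g ξ = 0 := (hR.part_self f hξg).trans hfξ
  have hgζ : g ζ = 1 := (hR.part_self f hζg).trans hfζ
  have hg0 : ∀ m : ℕ, m ≠ 0 → ∀ x ∈ R.gen (h + m), g x = 0 := fun m hm x hx =>
    hR.part_other hm f hx
  have hgm : g ∈ R.restrictedDual :=
    hR.mem_restrictedDual {0} fun m hm x hx => hg0 m (by simpa using hm) x hx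
  set χ : R.restrictedDual := ⟨g, hgm⟩ with hχdef
  have hχ : R.contragredient.IsLogVacuum h χ := by
    constructor
    · intro n hn
      apply Subtype.ext
      rw [contragredient_L_coe]
      refine hR.dual_ext fun m x hx => ?_
      have h1 := R.gen_mem_apply hx (-n)
      obtain ⟨k, rfl⟩ : ∃ k : ℕ, n = k := ⟨n.toNat, by omega⟩
      refine hg0 (m + k) (by omega) _ ?_
      convert h1 using 2
      push_cast; ring
    · rw [← sub_eq_zero, ← Submodule.coe_eq_zero]
      have e : R.contragredient.L 0 (R.contragredient.L 0 χ - h • χ) -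
          h • (R.contragredient.L 0 χ - h • χ) =
          ((R.contragredient.L 0 - h • (1 : Module.End ℂ R.restrictedDual)) ^ 2) χ := by
        rw [pow_two, Module.End.mul_apply]; simp
      rw [e, contragredient_pow_apply]
      refine hR.dual_ext fun m x hx => ?_
      rcases Nat.eq_zero_or_pos m with rfl | hm
      · obtain ⟨a, b, rfl⟩ := hvac x hx
        have h1 : (R.L 0 - h • (1 : Module.End ℂ M)) ξ = ζ := by simp [hζ]
        have h2 : (R.L 0 - h • (1 : Module.End ℂ M)) ζ = 0 := by
          have := hξ.log
          rw [← hζ] at this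
          simp [this]
        simp [pow_two, h1, h2, Module.End.mul_apply, -LinearMap.sub_apply]
      · simpa using hg0 m hm.ne' _ (R.gen_pow_mem 2 x hx)
  have hχζ : ∀ x, ((R.contragredient.L 0 χ - h • χ : R.restrictedDual) : Module.Dual ℂ M) x =
      g (R.L 0 x) - h * g x := fun x => by simp [hχdef]
  have hζ0 : R.L 0 ζ = h • ζ := hξ.log
  have hξ0 : R.L 0 ξ = ζ + h • ξ := by simp [hζ]
  obtain ⟨T, hT, hTξ⟩ := exists_hom_of_no_singular ht hξ hχ hS
    (by
      intro n hn y hy hym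
      apply Subtype.ext
      refine hR.dual_ext fun m x hx => ?_
      rcases eq_or_ne n m with rfl | hm
      · have : R.level (R.vac h ξ) n ≤ LinearMap.ker (y : Module.Dual ℂ M) := by
          refine iSup₂_le fun l hl => ?_
          rintro _ ⟨b, hb, rfl⟩
          cases l with
          | nil => exact absurd hl (by simp; omega)
          | cons i l =>
            have h1 := congrArg Subtype.val (hym (i + 1) (by omega))
            rw [contragredient_L_coe] at h1
            have h2 := LinearMap.congr_fun h1 (R.word l b)
            rw [LinearMap.mem_ker, word_cons]
            exact h2
        exact this (hlev n hx)
      · exact R.contragredient_gen_apply (fun hh => hm (by exact_mod_cast add_left_cancel hh))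
          hy hx)
    (by
      intro a b hab
      obtain ⟨rfl, rfl⟩ := hli a b hab
      simp)
  have hinj : Function.Injective T := by
    rw [← LinearMap.ker_eq_bot]
    by_contra hne
    have hst : R.Stable (LinearMap.ker T) := by
      intro n x hx
      rw [LinearMap.mem_ker] at hx ⊢
      rw [hT, hx, map_zero]
    obtain ⟨n, z, hz, hz0, hzg, hzp⟩ := hR.exists_singular hst hne
    rcases Nat.eq_zero_or_pos n with rfl | hn
    · obtain ⟨a, b, rfl⟩ := hvac z hzg
      have h1 : T (a • ξ + b • ζ) = a • χ + b • (R.contragredient.L 0 χ - h • χ) := by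
        rw [hζ]; simp only [map_add, map_smul, map_sub, hT 0 ξ, hTξ]
      rw [LinearMap.mem_ker, h1] at hz
      have h2 := fun x => LinearMap.congr_fun (congrArg Subtype.val hz) x
      simp only [Submodule.coe_add, Submodule.coe_smul, LinearMap.add_apply,
        LinearMap.smul_apply, hχζ, smul_eq_mul] at h2
      have ha := h2 ζ
      have hb := h2 ξ
      simp [hχdef, hζ0, hξ0, hgξ, hgζ] at ha hb
      exact hz0 (by simp [ha, hb])
    · exact hz0 (hsing n hn z hzg hzp)
  have hsurj : Function.Surjective T := by
    rw [← LinearMap.range_eq_top, ← top_le_iff, ← hS]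
    refine iSup_le fun n => ?_
    have := hfin n
    let G := R.gen (h + n)
    let G' := R.contragredient.gen (h + n)
    let ψ : G →ₗ[ℂ] G' := T.restrict fun x hx => hT.gen_mem hx
    let ρ : G' →ₗ[ℂ] Module.Dual ℂ G :=
      { toFun := fun f => (f.1 : Module.Dual ℂ M).comp G.subtype
        map_add' := fun _ _ => rfl
        map_smul' := fun _ _ => rfl }
    have hρ : Function.Injective ρ := by
      intro f f' hff
      apply Subtype.ext
      apply Subtype.ext
      refine hR.dual_ext fun m x hx => ?_
      rcases eq_or_ne n m with rfl | hm
      · exact LinearMap.congr_fun hff ⟨x, hx⟩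
      · have hne : h + (n : ℂ) ≠ h + m := fun hh => hm (by exact_mod_cast add_left_cancel hh)
        rw [R.contragredient_gen_apply hne f.2 hx, R.contragredient_gen_apply hne f'.2 hx]
    have hψ : Function.Injective ψ := fun x y hxy =>
      Subtype.ext (hinj (congrArg Subtype.val hxy))
    have h3 := surjective_of_injective_of_dual (V := ↥(R.gen (h + n)))
      (W := ↥(R.contragredient.gen (h + n))) ψ hψ ρ hρ
    intro f hf
    obtain ⟨x, hx⟩ := h3 ⟨f, hf⟩
    exact ⟨x, congrArg Subtype.val hx⟩
  exact ⟨LinearEquiv.ofBijective T ⟨hinj, hsurj⟩, fun n v => hT n v⟩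

end VirasoroRep
end SLEVir

namespace SLEVir

/-! ### The Fock space representation -/

namespace Fock

open MvPolynomial Finset

/-- The bosonic Fock space: polynomials in the power sums `p_1, p_2, …`. The variable `X n` stands
for `p_{n+1}`. -/
abbrev Fk : Type := MvPolynomial ℕ ℂ

/-- The power sum `p_n`, with the convention `p_0 = 0`. -/
def p : ℕ → Fk
  | 0 => 0
  | n + 1 => X n

/-- The bosonic modes: `α_{-n}` is multiplication by `p_n`, `α_n = n ∂/∂p_n` for `n > 0`, and `α_0`
is the scalar `q`. -/
def al (q : ℂ) : ℤ → Module.End ℂ Fk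
  | Int.ofNat 0 => q • 1
  | Int.ofNat (n + 1) => ((n : ℂ) + 1) • (pderiv n : Derivation ℂ Fk Fk).toLinearMap
  | Int.negSucc n => LinearMap.mulLeft ℂ (X n)

theorem al_zero (q : ℂ) : al q 0 = q • 1 := rfl

theorem al_pos (q : ℂ) (n : ℕ) (f : Fk) : al q ((n : ℤ) + 1) f = ((n : ℂ) + 1) • pderiv n f := rfl

theorem al_neg (q : ℂ) (n : ℕ) (f : Fk) : al q (-((n : ℤ) + 1)) f = X n * f := by
  have : -((n : ℤ) + 1) = Int.negSucc n := by omega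
  rw [this]; rfl

theorem int_cases (k : ℤ) : (∃ n : ℕ, k = (n : ℤ) + 1) ∨ k = 0 ∨ ∃ n : ℕ, k = -((n : ℤ) + 1) := by
  rcases lt_trichotomy k 0 with h | h | h
  · exact Or.inr (Or.inr ⟨(-k - 1).toNat, by omega⟩)
  · exact Or.inr (Or.inl h)
  · exact Or.inl ⟨(k - 1).toNat, by omega⟩

theorem pderiv_var (i j : ℕ) : pderiv i (X j : Fk) = if j = i then 1 else 0 := by
  rw [pderiv_X, Pi.single_apply]

theorem pderiv_comm (i j : ℕ) (f : Fk) : pderiv i (pderiv j f) = pderiv j (pderiv i f) := by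
  have : ⁅(pderiv i : Derivation ℂ Fk Fk), (pderiv j : Derivation ℂ Fk Fk)⁆ = 0 := by
    refine MvPolynomial.derivation_ext fun k => ?_
    rw [Derivation.commutator_apply, pderiv_var, pderiv_var]
    split_ifs <;> simp
  have h := DFunLike.congr_fun this f
  rw [Derivation.commutator_apply] at h
  exact sub_eq_zero.mp h

/-- The Heisenberg relations `[α_m, α_k] = m δ_{m+k,0}`. -/
theorem al_comm (q : ℂ) (m k : ℤ) (f : Fk) :
    al q m (al q k f) = al q k (al q m f) + if m + k = 0 then (m : ℂ) • f else 0 := by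
  rcases int_cases m with ⟨m, rfl⟩ | rfl | ⟨m, rfl⟩ <;>
    rcases int_cases k with ⟨k, rfl⟩ | rfl | ⟨k, rfl⟩
  · rw [if_neg (by omega)]
    simp only [al_pos, Derivation.map_smul, pderiv_comm m k]
    module
  · rw [if_neg (by omega)]; simp [al_zero]
  · rw [al_pos, al_neg, al_neg, al_pos, Derivation.leibniz, pderiv_var]
    rcases eq_or_ne m k with rfl | h
    · rw [if_pos (by omega)]
      simp [smul_eq_mul]
    · rw [if_neg (by omega), if_neg (by omega)]
      simp [smul_eq_mul]
  · simp [al_zero]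
  · simp [al_zero]
  · simp [al_zero]
  · rw [al_neg, al_pos, al_pos, al_neg, Derivation.leibniz, pderiv_var]
    rcases eq_or_ne k m with rfl | h
    · rw [if_pos (by omega)]
      simp [smul_eq_mul]
      module
    · rw [if_neg (by omega), if_neg (by omega)]
      simp [smul_eq_mul]
  · rw [if_neg (by omega)]; simp [al_zero]
  · rw [if_neg (by omega), al_neg, al_neg, al_neg, al_neg]
    ring

/-- The derivation `p_j ↦ j p_{j-m}`. -/
def dd (m : ℤ) : Derivation ℂ Fk Fk :=
  mkDerivation ℂ fun i : ℕ => ((i : ℂ) + 1) • p ((i : ℤ) + 1 - m).toNat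

theorem dd_X (m : ℤ) (i : ℕ) : dd m (X i) = ((i : ℂ) + 1) • p ((i : ℤ) + 1 - m).toNat := by
  simp [dd, mkDerivation_X]

theorem dd_comm_al (q : ℂ) (m k : ℤ) (f : Fk) :
    dd m (al q k f) = al q k (dd m f) +
      if (0 < k ∧ 0 < m + k) ∨ (k < 0 ∧ m + k < 0) then -(k : ℂ) • al q (m + k) f else 0 := by
  rcases int_cases k with ⟨k, rfl⟩ | rfl | ⟨k, rfl⟩
  · by_cases h : 0 < m + (k + 1)
    · rw [if_pos (by omega)]
      obtain ⟨j, hj⟩ : ∃ j : ℕ, m + ((k : ℤ) + 1) = j + 1 := ⟨(m + k).toNat, by omega⟩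
      have key : ⁅dd m, (pderiv k : Derivation ℂ Fk Fk)⁆ = (-((j : ℂ) + 1)) • pderiv j := by
        refine MvPolynomial.derivation_ext fun i => ?_
        rw [Derivation.commutator_apply, dd_X, pderiv_var, Derivation.smul_apply, pderiv_var]
        have h1 : dd m (if i = k then 1 else 0) = 0 := by
          split_ifs <;> simp
        rw [h1, Derivation.map_smul]
        rcases lt_trichotomy i j with hij | rfl | hij
        · rw [if_neg hij.ne]
          rcases Nat.eq_zero_or_pos ((i : ℤ) + 1 - m).toNat with h0 | h0
          · rw [h0]; simp [p]
          · obtain ⟨r, hr⟩ := Nat.exists_eq_succ_of_ne_zero h0.ne'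
            rw [hr]; simp only [p, pderiv_var]
            rw [if_neg (by omega)]; simp
        · have : ((i : ℤ) + 1 - m).toNat = k + 1 := by omega
          rw [this]; simp only [p, pderiv_var, if_true, zero_sub]; module
        · rw [if_neg hij.ne']
          obtain ⟨r, hr⟩ : ∃ r, ((i : ℤ) + 1 - m).toNat = r + 1 :=
            ⟨((i : ℤ) - m).toNat, by omega⟩
          rw [hr]; simp only [p, pderiv_var]
          rw [if_neg (by omega)]; simp
      have h2 := DFunLike.congr_fun key f
      rw [Derivation.commutator_apply, sub_eq_iff_eq_add, Derivation.smul_apply] at h2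
      rw [hj, al_pos, al_pos, al_pos, Derivation.map_smul, h2]
      push_cast; module
    · rw [if_neg (by omega), add_zero]
      have key : ⁅dd m, (pderiv k : Derivation ℂ Fk Fk)⁆ = 0 := by
        refine MvPolynomial.derivation_ext fun i => ?_
        rw [Derivation.commutator_apply, dd_X, pderiv_var]
        have h1 : dd m (if i = k then 1 else 0) = 0 := by
          split_ifs <;> simp
        rw [h1, Derivation.map_smul]
        obtain ⟨r, hr⟩ : ∃ r, ((i : ℤ) + 1 - m).toNat = r + 1 :=
            ⟨((i : ℤ) - m).toNat, by omega⟩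
        rw [hr]; simp only [p, pderiv_var]
        rw [if_neg (by omega)]; simp
      have h2 := DFunLike.congr_fun key f
      rw [Derivation.commutator_apply, sub_eq_iff_eq_add, Derivation.zero_apply, zero_add] at h2
      rw [al_pos, al_pos, Derivation.map_smul, h2]
  · simp [al_zero]
  · rw [al_neg, al_neg, Derivation.leibniz, dd_X]
    by_cases h : m + (-((k : ℤ) + 1)) < 0
    · rw [if_pos (by omega)]
      obtain ⟨j, hj⟩ : ∃ j : ℕ, m + (-((k : ℤ) + 1)) = -((j : ℤ) + 1) := ⟨(k - m).toNat, by omega⟩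
      have : ((k : ℤ) + 1 - m).toNat = j + 1 := by omega
      rw [hj, al_neg, this]
      simp only [p, smul_eq_mul]
      push_cast
      simp only [Algebra.smul_def, map_neg]
      ring
    · rw [if_neg (by omega)]
      have : ((k : ℤ) + 1 - m).toNat = 0 := by omega
      rw [this]
      simp [p]

/-- The Feigin–Fuchs operators `L_m = ½ ∑ :α_i α_{m-i}: - Q (m + 1) α_m`. The terms of the normally
ordered sum with one creation and one annihilation operator make up the derivation `dd m`. -/
def Lop (Q q : ℂ) (m : ℤ) : Module.End ℂ Fk :=
  (dd m).toLinearMap +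
    (1 / 2 : ℂ) • (∑ i ∈ Ioo 0 m, al q i * al q (m - i) + ∑ i ∈ Ioo m 0, al q i * al q (m - i)) +
    if m = 0 then (q ^ 2 / 2 - Q * q) • 1 else (q - Q * (m + 1)) • al q m

theorem quad_comm_al (q : ℂ) (m k : ℤ) (s : Finset ℤ) (hs : ∀ i, i ∈ s → m - i ∈ s) (f : Fk) :
    (∑ i ∈ s, al q i * al q (m - i)) (al q k f) =
      al q k ((∑ i ∈ s, al q i * al q (m - i)) f) +
        if -k ∈ s then (-(2 * k : ℂ)) • al q (m + k) f else 0 := by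
  simp only [LinearMap.sum_apply, Module.End.mul_apply, map_sum]
  have h1 : ∀ i ∈ s, al q i (al q (m - i) (al q k f)) = al q k (al q i (al q (m - i) f)) +
      ((if i = -k then (-(k : ℂ)) • al q (m + k) f else 0) +
        if i = m + k then (-(k : ℂ)) • al q (m + k) f else 0) := by
    intro i _
    rw [al_comm q (m - i) k, map_add, al_comm q i k, add_assoc]
    congr 2
    · by_cases h : i = -k
      · subst h; simp [sub_eq_add_neg]
      · rw [if_neg (by omega), if_neg h]
    · by_cases h : i = m + k
      · subst h; simp [sub_eq_add_neg]
      · rw [if_neg (by omega), if_neg h, map_zero]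
  rw [sum_congr rfl h1, sum_add_distrib, sum_add_distrib, sum_ite_eq', sum_ite_eq']
  congr 1
  have h2 : m + k ∈ s ↔ -k ∈ s := by
    constructor
    · intro h; convert hs _ h using 1; ring
    · intro h; convert hs _ h using 1; ring
  simp only [h2]
  split_ifs
  · module
  · simp

/-- `[L_m, α_k] = -k α_{m+k} - Q m (m + 1) δ_{m+k,0}`. -/
theorem Lop_comm_al (Q q : ℂ) (m k : ℤ) (f : Fk) :
    Lop Q q m (al q k f) = al q k (Lop Q q m f) + (-(k : ℂ) • al q (m + k) f +
      if m + k = 0 then (-(Q * m * (m + 1))) • f else 0) := by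
  simp only [Lop, LinearMap.add_apply, LinearMap.smul_apply]
  rw [quad_comm_al q m k _ (fun i hi => by simp only [mem_Ioo] at hi ⊢; omega),
    quad_comm_al q m k _ (fun i hi => by simp only [mem_Ioo] at hi ⊢; omega)]
  have hd := dd_comm_al q m k f
  have hd' : (dd m).toLinearMap (al q k f) = _ := hd
  rw [hd']
  have h3 : (if m = 0 then (q ^ 2 / 2 - Q * q) • (1 : Module.End ℂ Fk)
      else (q - Q * (m + 1)) • al q m) (al q k f) =
      al q k ((if m = 0 then (q ^ 2 / 2 - Q * q) • (1 : Module.End ℂ Fk)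
      else (q - Q * (m + 1)) • al q m) f) +
      if m + k = 0 then ((q - Q * (m + 1)) * m) • f else 0 := by
    by_cases hm : m = 0
    · subst hm; simp
    · rw [if_neg hm, LinearMap.smul_apply, LinearMap.smul_apply, al_comm q m k]
      split_ifs <;> simp [smul_smul]
  rw [h3]
  simp only [map_add, map_smul, mem_Ioo, smul_add, Derivation.coeFn_coe]
  by_cases hmk : m + k = 0
  · obtain rfl : k = -m := by omega
    simp only [add_neg_cancel, al_zero, LinearMap.smul_apply, Module.End.one_apply, Int.cast_neg]
    split_ifs <;> first | (exfalso; omega) | module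
  · by_cases hk : k = 0
    · subst hk
      simp only [Int.cast_zero]
      split_ifs <;> first | (exfalso; omega) | module
    · split_ifs <;> first | (exfalso; omega) | module

theorem al_one_pos (q : ℂ) {n : ℤ} (hn : 0 < n) : al q n 1 = 0 := by
  rcases int_cases n with ⟨n, rfl⟩ | rfl | ⟨n, rfl⟩
  · rw [al_pos]; simp
  · omega
  · omega

theorem eps_al_neg (q : ℂ) {n : ℤ} (hn : n < 0) (f : Fk) : constantCoeff (al q n f) = 0 := by
  rcases int_cases n with ⟨n, rfl⟩ | rfl | ⟨n, rfl⟩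
  · omega
  · omega
  · rw [al_neg]; simp

theorem eps_dd (m : ℤ) (f : Fk) : constantCoeff (dd m f) = 0 := by
  have hp : ∀ n, constantCoeff (p n) = 0 := by
    intro n; cases n <;> simp [p]
  induction f using MvPolynomial.induction_on with
  | C a => simp
  | add f g hf hg => simp [hf, hg]
  | mul_X f i hf =>
    rw [Derivation.leibniz, dd_X]
    simp [hf, hp, constantCoeff_smul]

theorem eps_Lop_neg (Q q : ℂ) {m : ℤ} (hm : m < 0) (f : Fk) :
    constantCoeff (Lop Q q m f) = 0 := by
  simp only [Lop, LinearMap.add_apply, LinearMap.smul_apply, if_neg hm.ne]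
  have h1 : ∑ i ∈ Ioo 0 m, al q i * al q (m - i) = 0 := by
    rw [Ioo_eq_empty (by omega)]; rfl
  have h2 : constantCoeff ((∑ i ∈ Ioo m 0, al q i * al q (m - i)) f) = 0 := by
    rw [LinearMap.sum_apply, map_sum]
    refine sum_eq_zero fun i hi => ?_
    rw [Module.End.mul_apply, eps_al_neg q (mem_Ioo.mp hi).2]
  have h3 := eps_dd m f
  simp only [Derivation.coeFn_coe] at h3 ⊢
  rw [h1, LinearMap.zero_apply, zero_add, map_add, map_add, h3, constantCoeff_smul, h2,
    constantCoeff_smul, eps_al_neg q hm]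
  simp

/-- The weight of the vacuum. -/
def hq (Q q : ℂ) : ℂ := q ^ 2 / 2 - Q * q

theorem Lop_zero (Q q : ℂ) (f : Fk) : Lop Q q 0 f = dd 0 f + hq Q q • f := by
  simp [Lop, hq]

theorem Lop_pos_one (Q q : ℂ) {m : ℤ} (hm : 0 < m) : Lop Q q m 1 = 0 := by
  simp only [Lop, LinearMap.add_apply, LinearMap.smul_apply, if_neg hm.ne']
  have h1 : ∑ i ∈ Ioo m 0, al q i * al q (m - i) = 0 := by
    rw [Ioo_eq_empty (by omega)]; rfl
  have h2 : (∑ i ∈ Ioo 0 m, al q i * al q (m - i)) 1 = 0 := by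
    rw [LinearMap.sum_apply]
    refine sum_eq_zero fun i hi => ?_
    rw [Module.End.mul_apply, al_one_pos q (by have := mem_Ioo.mp hi; omega), map_zero]
  simp [h1, h2, al_one_pos q hm]

/-- Vacuum expectation of `L_m L_n`, `m > 0 > n`. -/
theorem eps_Lop_Lop (Q q : ℂ) {m n : ℤ} (hm : 0 < m) (hn : n < 0) :
    constantCoeff (Lop Q q m (Lop Q q n 1)) =
      if m + n = 0 then 2 * m * hq Q q + ((m : ℂ) ^ 3 - m) / 12 * (1 - 12 * Q ^ 2) else 0 := by
  have hLn : Lop Q q n 1 = (1 / 2 : ℂ) • ∑ i ∈ Ioo n 0, al q i (al q (n - i) 1) +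
      (q - Q * (n + 1)) • al q n 1 := by
    simp only [Lop, LinearMap.add_apply, LinearMap.smul_apply, if_neg hn.ne]
    rw [Ioo_eq_empty (a := 0) (b := n) (by omega)]
    simp [LinearMap.sum_apply]
  have h1 : ∀ b : ℤ, b < 0 → ∀ a : ℤ, constantCoeff (al q a (al q b 1)) =
      if a + b = 0 then (a : ℂ) else 0 := by
    intro b hb a
    rcases lt_trichotomy a 0 with ha | rfl | ha
    · rw [eps_al_neg q ha, if_neg (by omega)]
    · rw [al_zero]; simp [eps_al_neg q hb, hb.ne, constantCoeff_smul]
    · rw [al_comm, al_one_pos q ha, map_zero, zero_add]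
      split_ifs <;> simp [constantCoeff_smul]
  have h2 : ∀ b : ℤ, b ≠ 0 → constantCoeff (al q b 1) = 0 := by
    intro b hb
    rcases lt_or_gt_of_ne hb with h | h
    · exact eps_al_neg q h 1
    · simp [al_one_pos q h]
  have h3 : ∀ i ∈ Ioo n 0, constantCoeff (Lop Q q m (al q i (al q (n - i) 1))) =
      if m + n = 0 then (-(i : ℂ)) * (m + i) else 0 := by
    intro i hi
    have hi := mem_Ioo.mp hi
    rw [Lop_comm_al, map_add, eps_al_neg q hi.2, zero_add, map_add]
    have : constantCoeff (if m + i = 0 then (-(Q * m * (m + 1))) • al q (n - i) 1 else 0) = 0 := by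
      split_ifs
      · simp [constantCoeff_smul, eps_al_neg q (show n - i < 0 by omega)]
      · simp
    rw [this, constantCoeff_smul, h1 _ (by omega)]
    have e : m + i + (n - i) = m + n := by ring
    rw [e]
    split_ifs <;> simp
  rw [hLn, map_add, map_smul, map_smul, map_sum, map_add, constantCoeff_smul, constantCoeff_smul,
    map_sum, sum_congr rfl h3, Lop_comm_al, Lop_pos_one Q q hm, map_zero, zero_add]
  by_cases hmn : m + n = 0
  · obtain rfl : n = -m := by omega
    have hs : ∀ j : ℕ, ∑ i ∈ Ioo (-(j : ℤ)) 0, (-(i : ℂ)) * ((j : ℂ) + i) =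
        ((j : ℂ) ^ 3 - j) / 6 := by
      intro j
      have e1 : ∑ i ∈ Ioo (-(j : ℤ)) 0, (-(i : ℂ)) * ((j : ℂ) + i) =
          ∑ i ∈ range j, (i : ℂ) * ((j : ℂ) - i) := by
        have h0 : ∑ i ∈ range j, (i : ℂ) * ((j : ℂ) - i) =
            ∑ i ∈ (range j).filter (0 < ·), (i : ℂ) * ((j : ℂ) - i) := by
          symm
          apply sum_filter_of_ne
          intro i _ hi
          rcases Nat.eq_zero_or_pos i with rfl | h
          · simp at hi
          · exact h
        rw [h0]
        refine sum_bij' (fun i _ => (-i).toNat) (fun i _ => -(i : ℤ)) ?_ ?_ ?_ ?_ ?_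
        · intro i hi; simp only [mem_Ioo, mem_filter, mem_range] at hi ⊢; omega
        · intro i hi; simp only [mem_Ioo, mem_filter, mem_range] at hi ⊢; omega
        · intro i hi; simp only [mem_Ioo] at hi; omega
        · intro i hi; simp
        · intro i hi
          simp only [mem_Ioo] at hi
          have : (((-i).toNat : ℕ) : ℂ) = -(i : ℂ) := by
            have : (((-i).toNat : ℕ) : ℤ) = -i := by omega
            exact_mod_cast congrArg (Int.cast : ℤ → ℂ) this
          rw [this]; ring
      have e2 : ∀ x : ℂ, ∀ j : ℕ, ∑ i ∈ range j, (i : ℂ) * (x - i) =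
          x * (j * (j - 1) / 2) - (j * (j - 1) * (2 * j - 1) / 6) := by
        intro x j
        induction j with
        | zero => simp
        | succ j ih => rw [sum_range_succ, ih]; push_cast; ring
      rw [e1, e2]; ring
    obtain ⟨j, rfl⟩ : ∃ j : ℕ, m = j := ⟨m.toNat, by omega⟩
    simp only [add_neg_cancel, if_true, al_zero, Int.cast_natCast, Int.cast_neg]
    rw [hs j]
    simp [constantCoeff_smul, hq]
    ring
  · simp only [if_neg hmn, sum_const_zero, add_zero]
    simp [constantCoeff_smul, h2 _ hmn]

theorem Lop_one_of_al (f : Fk) (h : ∀ n : ℕ, pderiv n f = 0) : f = C (constantCoeff f) := by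
  ext d
  rw [coeff_C]
  split_ifs with hd
  · subst hd; rfl
  · obtain ⟨i, hi⟩ : ∃ i, d i ≠ 0 := by
      by_contra hcon
      push Not at hcon
      exact hd (Finsupp.ext fun i => by simp [hcon i])
    have h1 := congrArg (coeff (d - Finsupp.single i 1)) (h i)
    rw [coeff_pderiv, coeff_zero] at h1
    have hle : Finsupp.single i 1 ≤ d := by
      rw [Finsupp.single_le_iff]; omega
    rw [tsub_add_cancel_of_le hle] at h1
    rcases mul_eq_zero.mp h1 with h2 | h2
    · exact h2
    · exact absurd h2 (Nat.cast_add_one_ne_zero _)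

/-- The Virasoro relations: the defect of the commutation relation commutes with all `α_k`, so it
vanishes as soon as its vacuum expectation does. -/
theorem Lop_comm (Q q : ℂ) (m n : ℤ) : Lop Q q m * Lop Q q n - Lop Q q n * Lop Q q m =
    ((m : ℂ) - n) • Lop Q q (m + n) + if m + n = 0 then
      ((((m : ℂ) ^ 3 - m) / 12) * (1 - 12 * Q ^ 2)) • (1 : Module.End ℂ Fk) else 0 := by
  wlog hmn : n ≤ m generalizing m n
  · have h := this n m (by omega)
    rw [← neg_sub, h, add_comm n m]
    by_cases h0 : m + n = 0
    · obtain rfl : n = -m := by omega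
      simp only [h0, if_true]; push_cast; module
    · simp only [if_neg h0]; module
  set X := Lop Q q m * Lop Q q n - Lop Q q n * Lop Q q m -
    (((m : ℂ) - n) • Lop Q q (m + n) + if m + n = 0 then
      ((((m : ℂ) ^ 3 - m) / 12) * (1 - 12 * Q ^ 2)) • (1 : Module.End ℂ Fk) else 0) with hX
  suffices hX0 : X = 0 from sub_eq_zero.mp hX0
  have hcomm : ∀ (k : ℤ) (f : Fk), X (al q k f) = al q k (X f) := by
    intro k f
    have hi : ∀ (r : ℂ) (g : Fk), (if m + n = 0 then r • (1 : Module.End ℂ Fk) else 0) g =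
        (if m + n = 0 then r else 0) • g := by
      intro r g; split_ifs <;> simp
    simp only [hX, LinearMap.sub_apply, LinearMap.add_apply, Module.End.mul_apply,
      LinearMap.smul_apply, hi]
    have e1 : m + (n + k) = m + n + k := by ring
    have e2 : n + (m + k) = m + n + k := by ring
    rw [Lop_comm_al Q q n k, Lop_comm_al Q q m k, Lop_comm_al Q q (m + n) k]
    simp only [map_add, map_smul, map_sub]
    rw [Lop_comm_al Q q n k, Lop_comm_al Q q m k, Lop_comm_al Q q n (m + k),
      Lop_comm_al Q q m (n + k), e1, e2]
    have hs1 : ∀ (P : Prop) [Decidable P] (r : ℂ) (g : Fk), (if P then r • g else 0) =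
      (if P then r else 0) • g := by intro P _ r g; split_ifs <;> simp
    simp only [hs1, map_smul]
    by_cases h0 : m + n + k = 0
    · have hk : (k : ℂ) = -m - n := by
        have : k = -m - n := by omega
        rw [this]; push_cast; rfl
      simp only [h0, if_true]
      push_cast
      rw [hk]
      module
    · simp only [if_neg h0]
      push_cast
      module
  have hconst : X 1 = C (constantCoeff (X 1)) := by
    refine Lop_one_of_al _ fun i => ?_
    have h := hcomm ((i : ℤ) + 1) 1
    rw [al_one_pos q (by omega), map_zero, al_pos] at h
    have h0 : ((i : ℂ) + 1) ≠ 0 := by exact_mod_cast Nat.succ_ne_zero i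
    exact (smul_eq_zero.mp h.symm).resolve_left h0
  have heps : constantCoeff (X 1) = 0 := by
    simp only [hX, LinearMap.sub_apply, LinearMap.add_apply, Module.End.mul_apply,
      LinearMap.smul_apply, map_sub, map_add, constantCoeff_smul, smul_eq_mul]
    have h01 : ∀ f, constantCoeff (Lop Q q 0 f) = hq Q q * constantCoeff f := by
      intro f
      rw [Lop_zero, map_add, eps_dd, constantCoeff_smul]; simp
    have hL0 : Lop Q q 0 1 = hq Q q • 1 := by rw [Lop_zero]; simp
    rcases lt_trichotomy n 0 with hn | rfl | hn
    · rcases lt_trichotomy m 0 with hm | rfl | hm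
      · rw [eps_Lop_neg Q q hm, eps_Lop_neg Q q hn, eps_Lop_neg Q q (by omega : m + n < 0),
          if_neg (by omega)]
        simp
      · rw [h01, eps_Lop_neg Q q hn, zero_add, eps_Lop_neg Q q hn, eps_Lop_neg Q q hn,
          if_neg hn.ne]
        simp
      · rw [eps_Lop_Lop Q q hm hn, Lop_pos_one Q q hm]
        by_cases h0 : m + n = 0
        · obtain rfl : n = -m := by omega
          simp only [h0, if_true, hL0]
          simp [constantCoeff_smul]
          ring
        · have : constantCoeff (Lop Q q (m + n) 1) = 0 := by
            rcases lt_or_gt_of_ne h0 with h | h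
            · exact eps_Lop_neg Q q h 1
            · simp [Lop_pos_one Q q h]
          simp [h0, this]
    · rcases lt_or_eq_of_le hmn with hm | rfl
      · simp [hL0, Lop_pos_one Q q hm, hm.ne', map_smul]
      · simp
    · have hm : 0 < m := by omega
      rw [if_neg (by omega)]
      simp [Lop_pos_one Q q hm, Lop_pos_one Q q hn, Lop_pos_one Q q (by omega : 0 < m + n)]
  have hX1 : X 1 = 0 := by rw [hconst, heps, C_0]
  refine LinearMap.ext fun f => ?_
  rw [LinearMap.zero_apply]
  induction f using MvPolynomial.induction_on with
  | C a => rw [← mul_one (C a), C_mul', map_smul, hX1, smul_zero]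
  | add f g hf hg => rw [map_add, hf, hg, add_zero]
  | mul_X f i hf =>
    have := hcomm (-((i : ℤ) + 1)) f
    rw [al_neg, al_neg, hf, mul_zero] at this
    rwa [mul_comm]

/-- The Fock space as a Virasoro module of central charge `1 - 12 Q²`. -/
def rep (Q q : ℂ) : VirasoroRep (1 - 12 * Q ^ 2) Fk where
  L := Lop Q q
  comm := Lop_comm Q q

end Fock
end SLEVir

namespace SLEVir
namespace Fock
open MvPolynomial Finset

/-! ### Elementary symmetric functions in the Fock space -/

/-- The rescaled elementary symmetric functions, with generating series `exp (σ ∑ p_n t^n / n)`,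
defined through Newton's identities. -/
def el (σ : ℂ) : ℕ → Fk
  | 0 => 1
  | n + 1 => (σ / (n + 1)) • ∑ k : Fin (n + 1), p (k + 1) * el σ (n - k)

@[simp] theorem el_zero (σ : ℂ) : el σ 0 = 1 := by rw [el]

theorem el_newton (σ : ℂ) (n : ℕ) :
    (n : ℂ) • el σ n = σ • ∑ k ∈ range n, p (k + 1) * el σ (n - 1 - k) := by
  cases n with
  | zero => simp
  | succ n =>
    rw [el, smul_smul, Fin.sum_univ_eq_sum_range (fun k => p (k + 1) * el σ (n - k))]
    have : (n : ℂ) + 1 ≠ 0 := Nat.cast_add_one_ne_zero n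
    push_cast
    rw [mul_div_cancel₀ _ this]

/-- The generating series of the power sums. -/
def pser : PowerSeries Fk := PowerSeries.mk p

/-- The generating series of the elementary symmetric functions. -/
def eser (σ : ℂ) : PowerSeries Fk := PowerSeries.mk (el σ)

theorem coeff_mul_eser (σ : ℂ) {f : PowerSeries Fk} (hf : PowerSeries.coeff 0 f = 0) (a : ℕ) :
    PowerSeries.coeff a (f * eser σ) =
      ∑ i ∈ range a, PowerSeries.coeff (i + 1) f * el σ (a - 1 - i) := by
  rw [PowerSeries.coeff_mul, Nat.sum_antidiagonal_eq_sum_range_succ_mk, sum_range_succ', hf]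
  simp only [zero_mul, add_zero]
  refine sum_congr rfl fun i _ => ?_
  rw [eser, PowerSeries.coeff_mk]
  congr 2
  omega

theorem coeff_zero_pser : PowerSeries.coeff 0 pser = 0 := by simp [pser, p]

theorem theta_eser (σ : ℂ) : theta (eser σ) = σ • (pser * eser σ) := by
  ext1 a
  rw [coeff_theta, PowerSeries.coeff_smul, coeff_mul_eser σ coeff_zero_pser]
  simpa [eser, pser] using el_newton σ a

theorem eq_zero_of_theta (σ : ℂ) {f : PowerSeries Fk} (h : theta f = σ • (pser * f))
    (h0 : PowerSeries.coeff 0 f = 0) : f = 0 := by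
  ext1 n
  induction n using Nat.strong_induction_on with
  | _ n ih =>
    rcases Nat.eq_zero_or_pos n with rfl | hn
    · simpa using h0
    · have h1 := congrArg (PowerSeries.coeff n) h
      rw [coeff_theta, PowerSeries.coeff_smul, PowerSeries.coeff_mul, sum_eq_zero, smul_zero] at h1
      · simpa [hn.ne'] using h1
      · rintro ⟨i, j⟩ hij
        rw [HasAntidiagonal.mem_antidiagonal] at hij
        rcases Nat.eq_zero_or_pos i with rfl | hi
        · simp [coeff_zero_pser]
        · rw [ih j (by simp at hij; omega)]; simp

/-- A derivation acts on the elementary symmetric functions through its action on the power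
sums. -/
theorem coeffwise_eser (σ : ℂ) (D : Derivation ℂ Fk Fk) (r : PowerSeries Fk)
    (hr : coeffwise D pser = theta r) (h0 : PowerSeries.coeff 0 r = 0) :
    coeffwise D (eser σ) = σ • (r * eser σ) := by
  rw [← sub_eq_zero]
  apply eq_zero_of_theta σ
  · rw [map_sub, ← coeffwise_theta, theta_eser, Derivation.map_smul, Derivation.map_smul,
      Derivation.leibniz, Derivation.leibniz, theta_eser, hr]
    simp only [smul_eq_mul, mul_sub, smul_sub, smul_add, mul_smul_comm]
    rw [show r * (pser * eser σ) = pser * (r * eser σ) by ring, mul_comm (eser σ) (theta r)]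
    abel
  · rw [map_sub, coeff_coeffwise, PowerSeries.coeff_smul, PowerSeries.coeff_mul]
    simp [eser, h0]

/-- The annihilation operator `α_{i+1}` as a derivation. -/
def alD (i : ℕ) : Derivation ℂ Fk Fk := ((i : ℂ) + 1) • pderiv i

theorem alD_p (i k : ℕ) : alD i (p k) = if k = i + 1 then C ((i : ℂ) + 1) else 0 := by
  cases k with
  | zero => simp [p]
  | succ k =>
    rw [p, alD, Derivation.smul_apply, pderiv_var]
    by_cases h : k = i
    · simp [h, smul_eq_C_mul]
    · rw [if_neg h, if_neg (by omega), smul_zero]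

theorem al_eq_alD (q : ℂ) (i : ℕ) (f : Fk) : al q ((i : ℤ) + 1) f = alD i f := rfl

/-- `e_{a-1-i}`, or `0` if `i ≥ a`. -/
def elI (σ : ℂ) (a i : ℕ) : Fk := if i < a then el σ (a - 1 - i) else 0

theorem alD_el (σ : ℂ) (i a : ℕ) : alD i (el σ a) = σ • elI σ a i := by
  have h := coeffwise_eser σ (alD i) (PowerSeries.X ^ (i + 1)) ?_ ?_
  · have h1 := congrArg (PowerSeries.coeff a) h
    rw [coeff_coeffwise, PowerSeries.coeff_smul, PowerSeries.coeff_X_pow_mul'] at h1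
    simp only [eser, PowerSeries.coeff_mk] at h1
    rw [h1, elI]
    congr 1
    by_cases hi : i < a
    · rw [if_pos (by omega), if_pos hi]; congr 1; omega
    · rw [if_neg (by omega), if_neg hi]
  · ext1 k
    rw [coeff_coeffwise, coeff_theta, PowerSeries.coeff_X_pow, pser, PowerSeries.coeff_mk, alD_p]
    split_ifs with hk
    · subst hk; simp [smul_eq_C_mul]
    · simp
  · rw [PowerSeries.coeff_X_pow]; simp

theorem dd_p (m : ℤ) (k : ℕ) : dd m (p k) = (k : ℂ) • p ((k : ℤ) - m).toNat := by
  cases k with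
  | zero => simp [p]
  | succ k => rw [p, dd_X]; push_cast; rfl

theorem dd_neg_el (σ : ℂ) (n a : ℕ) :
    dd (-((n : ℤ) + 1)) (el σ a) = σ • ∑ k ∈ range a, p (n + k + 2) * el σ (a - 1 - k) := by
  have h := coeffwise_eser σ (dd (-((n : ℤ) + 1)))
    (PowerSeries.mk fun k => if k = 0 then 0 else p (n + k + 1)) ?_ ?_
  · have h1 := congrArg (PowerSeries.coeff a) h
    rw [coeff_coeffwise, PowerSeries.coeff_smul, coeff_mul_eser σ (by simp)] at h1
    simp only [eser, PowerSeries.coeff_mk] at h1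
    rw [h1]
    simp [add_assoc]
  · ext1 k
    rw [coeff_coeffwise, coeff_theta, pser, PowerSeries.coeff_mk, PowerSeries.coeff_mk, dd_p]
    split_ifs with hk
    · simp [hk]
    · congr 2; omega
  · simp

theorem dd_pos_el (σ : ℂ) (n a : ℕ) :
    dd ((n : ℤ) + 1) (el σ a) = ((a - 1 - n : ℕ) : ℂ) • elI σ a n := by
  have h := coeffwise_eser σ (dd ((n : ℤ) + 1)) (PowerSeries.X ^ (n + 1) * pser) ?_ ?_
  · have h1 := congrArg (PowerSeries.coeff a) h
    rw [mul_assoc, coeff_coeffwise, ← mul_smul_comm, ← theta_eser,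
      PowerSeries.coeff_X_pow_mul'] at h1
    simp only [eser, PowerSeries.coeff_mk, coeff_theta] at h1
    rw [h1, elI]
    by_cases hi : n < a
    · rw [if_pos (by omega), if_pos hi, show a - (n + 1) = a - 1 - n by omega]
    · rw [if_neg (by omega), if_neg hi, smul_zero]
  · ext1 k
    rw [coeff_coeffwise, coeff_theta, pser, PowerSeries.coeff_mk, dd_p,
      PowerSeries.coeff_X_pow_mul']
    congr 1
    split_ifs with hk
    · rw [PowerSeries.coeff_mk]; congr 1; omega
    · rw [show ((k : ℤ) - (n + 1)).toNat = 0 by omega]; rfl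
  · rw [PowerSeries.coeff_X_pow_mul']; simp

/-- The bilinear expression governing the action of second order operators on products of
elementary symmetric functions. -/
def gam (σ : ℂ) (a b : ℕ) : Fk :=
  ∑ n ∈ range a, ∑ k ∈ range b, p (n + k + 2) * el σ (a - 1 - n) * el σ (b - 1 - k)

theorem gam_comm (σ : ℂ) (a b : ℕ) : gam σ a b = gam σ b a := by
  rw [gam, sum_comm, gam]
  refine sum_congr rfl fun n _ => sum_congr rfl fun k _ => ?_
  rw [add_comm k n]; ring

theorem gam_succ (σ : ℂ) (a b : ℕ) : σ • gam σ a (b + 1) = σ • gam σ (a + 1) b +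
    ((a : ℂ) + 1) • (el σ (a + 1) * el σ b) - ((b : ℂ) + 1) • (el σ a * el σ (b + 1)) := by
  have ha := el_newton σ (a + 1)
  have hb := el_newton σ (b + 1)
  push_cast at ha hb
  rw [← smul_mul_assoc, ← mul_smul_comm, ha, hb, gam, gam]
  rw [sum_range_succ' _ a, sum_range_succ' _ a, sum_range_succ' _ b]
  simp only [sum_range_succ' _ b, sum_add_distrib]
  simp only [Nat.add_sub_cancel, Nat.sub_zero, zero_add, add_zero,
    show ∀ n k : ℕ, n + (k + 1) + 2 = n + 1 + k + 2 from fun n k => by omega]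
  simp only [smul_mul_assoc, mul_smul_comm, ← smul_add, ← smul_sub]
  congr 1
  rw [add_mul, mul_add, sum_mul, mul_sum]
  simp only [Nat.sub_sub, add_comm 1]
  have e : ∑ x ∈ range b, p (x + 2) * el σ a * el σ (b - (x + 1)) =
      ∑ x ∈ range b, el σ a * (p (x + 1 + 1) * el σ (b - (x + 1))) :=
    sum_congr rfl fun x _ => by rw [show x + 1 + 1 = x + 2 by omega]; ring
  rw [e]
  ring

/-- Product of the elementary symmetric functions with the indices of a list. -/
def elL (σ : ℂ) (l : List ℕ) : Fk := (l.map (el σ)).prod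

@[simp] theorem elL_nil (σ : ℂ) : elL σ [] = 1 := rfl

@[simp] theorem elL_cons (σ : ℂ) (a : ℕ) (l : List ℕ) : elL σ (a :: l) = el σ a * elL σ l := by
  simp [elL]

/-- The sum of the squares of the entries. -/
def sq (l : List ℕ) : ℕ := (l.map (· ^ 2)).sum

@[simp] theorem sq_nil : sq [] = 0 := rfl

@[simp] theorem sq_cons (a : ℕ) (l : List ℕ) : sq (a :: l) = a ^ 2 + sq l := by simp [sq]

/-- The span of the products of total degree `N` whose sum of squares exceeds `K`. -/
def above (σ : ℂ) (N K : ℕ) : Submodule ℂ Fk :=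
  Submodule.span ℂ {x | ∃ l : List ℕ, l.sum = N ∧ K < sq l ∧ x = elL σ l}

theorem elL_mem_above {σ : ℂ} {N K : ℕ} (l : List ℕ) (h1 : l.sum = N) (h2 : K < sq l) :
    elL σ l ∈ above σ N K := Submodule.subset_span ⟨l, h1, h2, rfl⟩

theorem elL_append (σ : ℂ) (l l' : List ℕ) : elL σ (l ++ l') = elL σ l * elL σ l' := by
  simp [elL]

theorem above_mul {σ : ℂ} {N K : ℕ} {x : Fk} (hx : x ∈ above σ N K) (l : List ℕ) :
    x * elL σ l ∈ above σ (N + l.sum) (K + sq l) := by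
  have : above σ N K ≤ (above σ (N + l.sum) (K + sq l)).comap (LinearMap.mulRight ℂ (elL σ l)) := by
    refine Submodule.span_le.mpr ?_
    rintro _ ⟨l', h1, h2, rfl⟩
    rw [SetLike.mem_coe, Submodule.mem_comap, LinearMap.mulRight_apply, ← elL_append]
    refine elL_mem_above _ (by simp [h1]) ?_
    simp only [sq, List.map_append, List.sum_append]
    simp only [sq] at h2
    omega
  exact this hx

theorem above_mono {σ : ℂ} {N K K' : ℕ} (h : K' ≤ K) : above σ N K ≤ above σ N K' :=
  Submodule.span_mono fun _ ⟨l, h1, h2, h3⟩ => ⟨l, h1, h.trans_lt h2, h3⟩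

theorem gam_mem (σ : ℂ) (a b : ℕ) :
    σ • gam σ a b + ((min a b : ℕ) : ℂ) • (el σ a * el σ b) ∈ above σ (a + b) (a ^ 2 + b ^ 2) := by
  have key : ∀ b a : ℕ, b ≤ a →
      σ • gam σ a b + (b : ℂ) • (el σ a * el σ b) ∈ above σ (a + b) (a ^ 2 + b ^ 2) := by
    intro b
    induction b with
    | zero => intro a _; simp [gam]
    | succ b ih =>
      intro a hab
      have h1 := ih (a + 1) (by omega)
      have h2 : el σ (a + 1) * el σ b ∈ above σ (a + (b + 1)) (a ^ 2 + (b + 1) ^ 2) := by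
        have := elL_mem_above (σ := σ) (N := a + (b + 1)) (K := a ^ 2 + (b + 1) ^ 2) [a + 1, b]
          (by simp; omega) (by simp; nlinarith)
        simpa using this
      have h3 := above_mono (σ := σ) (N := a + 1 + b) (K := (a + 1) ^ 2 + b ^ 2)
        (K' := a ^ 2 + (b + 1) ^ 2) (by nlinarith) h1
      rw [show a + 1 + b = a + (b + 1) by omega] at h3
      rw [gam_succ]
      have h4 := Submodule.add_mem _ h3 (Submodule.smul_mem _ ((a : ℂ) + 1 - b) h2)
      convert h4 using 1
      push_cast
      module
  rcases le_total b a with h | h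
  · have := key b a h
    rwa [min_eq_right h]
  · have := key a b h
    rw [min_eq_left h, gam_comm, mul_comm, add_comm a b, add_comm (a ^ 2)]
    exact this

/-- The sum of `min a b` over the entries `b` of a list. -/
def minSum (a : ℕ) (l : List ℕ) : ℕ := (l.map (min a)).sum

@[simp] theorem minSum_cons (a b : ℕ) (l : List ℕ) :
    minSum a (b :: l) = min a b + minSum a l := by simp [minSum]

/-- The diagonal entries of a second order operator in the basis of products of elementary
symmetric functions. -/
def eig (lam : ℕ → ℂ) (τ : ℂ) : List ℕ → ℂ
  | [] => 0
  | a :: l => lam a + eig lam τ l - τ * minSum a l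

/-- A second order differential operator that acts diagonally on the elementary symmetric
functions, with the bilinear part given by `gam`. Only indices up to `M` matter. -/
structure IsSecondOrder (σ : ℂ) (M : ℕ) (lam : ℕ → ℂ) (τ : ℂ) (Ω : Module.End ℂ Fk) : Prop where
  one_eq : Ω 1 = 0
  el_eq : ∀ a ≤ M, Ω (el σ a) = lam a • el σ a
  mul_eq : ∀ a ≤ M, ∃ G : Derivation ℂ Fk Fk,
    (∀ g, Ω (el σ a * g) = Ω (el σ a) * g + el σ a * Ω g + G g) ∧
      ∀ b, a + b ≤ M → G (el σ b) = (τ * σ) • gam σ a b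

/-- Triangularity: up to products with a larger sum of squares, a second order operator acts
diagonally. -/
theorem IsSecondOrder.triangular {σ τ : ℂ} {M : ℕ} {lam : ℕ → ℂ} {Ω : Module.End ℂ Fk}
    (hΩ : IsSecondOrder σ M lam τ Ω) (l : List ℕ) (hl : l.sum ≤ M) :
    Ω (elL σ l) - eig lam τ l • elL σ l ∈ above σ l.sum (sq l) := by
  induction l with
  | nil => simp [eig, hΩ.one_eq]
  | cons a l ih =>
    simp only [List.sum_cons] at hl
    have ih := ih (by omega)
    obtain ⟨G, hG, hGe⟩ := hΩ.mul_eq a (by omega)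
    have hGl : ∀ l' : List ℕ, a + l'.sum ≤ M →
        G (elL σ l') + (τ * minSum a l') • (el σ a * elL σ l') ∈
          above σ (a + l'.sum) (a ^ 2 + sq l') := by
      intro l'
      induction l' with
      | nil => intro _; simp [minSum]
      | cons b l' ih' =>
        intro hl'
        simp only [List.sum_cons] at hl'
        have h1 := above_mul (ih' (by omega)) [b]
        have h2 := above_mul (Submodule.smul_mem _ τ (gam_mem σ a b)) l'
        simp only [List.sum_cons, List.sum_nil, add_zero, sq_cons, sq_nil, elL_cons, elL_nil,
          mul_one] at h1 h2 ⊢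
        rw [show a + l'.sum + b = a + (b + l'.sum) by omega,
          show a ^ 2 + sq l' + b ^ 2 = a ^ 2 + (b ^ 2 + sq l') by omega] at h1
        rw [add_assoc, add_assoc] at h2
        convert Submodule.add_mem _ h1 h2 using 1
        rw [Derivation.leibniz, hGe b (by omega), minSum_cons]
        push_cast
        simp only [smul_eq_mul, Algebra.smul_def, map_mul, map_add]
        ring
    have h1 := above_mul ih [a]
    have h2 := hGl l hl
    simp only [List.sum_cons, List.sum_nil, add_zero, sq_cons, sq_nil, elL_cons, elL_nil,
      mul_one] at h1 h2 ⊢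
    rw [add_comm l.sum, add_comm (sq l)] at h1
    convert Submodule.add_mem _ h1 h2 using 1
    rw [hG, hΩ.el_eq a (by omega), eig]
    simp only [Algebra.smul_def, map_mul, map_add, map_sub]
    ring

theorem sq_le (l : List ℕ) : sq l ≤ l.sum ^ 2 := by
  induction l with
  | nil => simp
  | cons a l ih => simp only [sq_cons, List.sum_cons]; nlinarith [Nat.zero_le (a * l.sum)]

/-- If the diagonal entries do not vanish, any subspace that contains the image of the products of
degree `N` contains the products themselves. -/
theorem IsSecondOrder.mem_of_image_mem {σ τ : ℂ} {M : ℕ} {lam : ℕ → ℂ} {Ω : Module.End ℂ Fk}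
    (hΩ : IsSecondOrder σ M lam τ Ω) {N : ℕ} (hN : N ≤ M)
    (hne : ∀ l : List ℕ, l.sum = N → eig lam τ l ≠ 0) (W : Submodule ℂ Fk)
    (hW : ∀ l : List ℕ, l.sum = N → Ω (elL σ l) ∈ W) (l : List ℕ) (hl : l.sum = N) :
    elL σ l ∈ W := by
  have key : ∀ d : ℕ, ∀ l : List ℕ, l.sum = N → N ^ 2 ≤ d + sq l → elL σ l ∈ W := by
    intro d
    induction d with
    | zero =>
      intro l hl hd
      have h1 := hΩ.triangular l (by omega)
      have h2 : above σ l.sum (sq l) ≤ W := by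
        refine Submodule.span_le.mpr ?_
        rintro _ ⟨l', h3, h4, rfl⟩
        have := sq_le l'
        rw [h3, hl] at this
        omega
      have h3 := W.sub_mem (hW l hl) (h2 h1)
      rw [sub_sub_cancel] at h3
      exact (W.smul_mem_iff (hne l hl)).mp h3
    | succ d ih =>
      intro l hl hd
      have h1 := hΩ.triangular l (by omega)
      have h2 : above σ l.sum (sq l) ≤ W := by
        refine Submodule.span_le.mpr ?_
        rintro _ ⟨l', h3, h4, rfl⟩
        exact ih l' (by omega) (by omega)
      have h3 := W.sub_mem (hW l hl) (h2 h1)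
      rw [sub_sub_cancel] at h3
      exact (W.smul_mem_iff (hne l hl)).mp h3
  exact key (N ^ 2) l hl (by omega)

end Fock
end SLEVir

namespace SLEVir
namespace Fock
open MvPolynomial Finset

/-! ### Two second order operators built from the Virasoro generators -/

theorem Lop_neg_apply (Q q : ℂ) (i : ℕ) (f : Fk) : Lop Q q (-((i : ℤ) + 1)) f =
    dd (-((i : ℤ) + 1)) f + ((1 / 2 : ℂ) • ∑ k ∈ range i, p (k + 1) * p (i - k) +
      (q + Q * i) • p (i + 1)) * f := by
  have h0 : -((i : ℤ) + 1) ≠ 0 := by omega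
  have h1 : ∑ j ∈ Ioo (-((i : ℤ) + 1)) 0, al q j (al q (-((i : ℤ) + 1) - j) f) =
      ∑ k ∈ range i, p (k + 1) * p (i - k) * f := by
    refine sum_bij' (fun j _ => (-j - 1).toNat) (fun k _ => -((k : ℤ) + 1)) ?_ ?_ ?_ ?_ ?_
    · intro j hj; simp only [mem_Ioo, mem_range] at hj ⊢; omega
    · intro j hj; simp only [mem_Ioo, mem_range] at hj ⊢; omega
    · intro j hj; simp only [mem_Ioo] at hj; omega
    · intro j hj; omega
    · intro j hj
      simp only [mem_Ioo] at hj
      obtain ⟨k, rfl⟩ : ∃ k : ℕ, j = -((k : ℤ) + 1) := ⟨(-j - 1).toNat, by omega⟩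
      have e1 : -((i : ℤ) + 1) - -((k : ℤ) + 1) = -(((i - k - 1 : ℕ) : ℤ) + 1) := by omega
      have e2 : (- -((k : ℤ) + 1) - 1).toNat = k := by omega
      rw [e1, e2, al_neg, al_neg, show i - k = i - k - 1 + 1 by omega, p, p, Nat.add_sub_cancel]
      ring
  simp only [Lop, LinearMap.add_apply, LinearMap.smul_apply, if_neg h0]
  rw [Ioo_eq_empty (a := 0) (b := -((i : ℤ) + 1)) (by omega), sum_empty, LinearMap.zero_apply,
    zero_add, LinearMap.sum_apply]
  simp only [Module.End.mul_apply]
  rw [h1, al_neg, ← sum_mul, Derivation.coeFn_coe, add_assoc]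
  congr 1
  simp only [p, add_mul, smul_mul_assoc]
  congr 2
  push_cast; ring

theorem Lop_pos_apply (Q q : ℂ) (i : ℕ) (f : Fk) : Lop Q q ((i : ℤ) + 1) f =
    dd ((i : ℤ) + 1) f + ((1 / 2 : ℂ) • ∑ j ∈ range i, alD j (alD (i - 1 - j) f) +
      (q - Q * (i + 2)) • alD i f) := by
  have h0 : ((i : ℤ) + 1) ≠ 0 := by omega
  have h1 : ∑ j ∈ Ioo 0 ((i : ℤ) + 1), al q j (al q ((i : ℤ) + 1 - j) f) =
      ∑ j ∈ range i, alD j (alD (i - 1 - j) f) := by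
    refine sum_bij' (fun j _ => (j - 1).toNat) (fun k _ => ((k : ℤ) + 1)) ?_ ?_ ?_ ?_ ?_
    · intro j hj; simp only [mem_Ioo, mem_range] at hj ⊢; omega
    · intro j hj; simp only [mem_Ioo, mem_range] at hj ⊢; omega
    · intro j hj; simp only [mem_Ioo] at hj; omega
    · intro j hj; omega
    · intro j hj
      simp only [mem_Ioo] at hj
      obtain ⟨k, rfl⟩ : ∃ k : ℕ, j = ((k : ℤ) + 1) := ⟨(j - 1).toNat, by omega⟩
      have e1 : ((i : ℤ) + 1) - ((k : ℤ) + 1) = (((i - 1 - k : ℕ) : ℤ) + 1) := by omega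
      have e2 : (((k : ℤ) + 1) - 1).toNat = k := by omega
      rw [e1, e2, al_eq_alD, al_eq_alD]
  simp only [Lop, LinearMap.add_apply, LinearMap.smul_apply, if_neg h0]
  rw [Ioo_eq_empty (b := 0) (a := ((i : ℤ) + 1)) (by omega), sum_empty, LinearMap.zero_apply,
    add_zero, LinearMap.sum_apply]
  simp only [Module.End.mul_apply]
  rw [h1, al_eq_alD, Derivation.coeFn_coe, add_assoc]
  congr 3
  push_cast; ring

/-- The operator `∑_{0 < n ≤ M} L_{-n} α_n`. -/
def lowOp (Q q : ℂ) (M : ℕ) : Module.End ℂ Fk :=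
  ∑ i ∈ range M, Lop Q q (-((i : ℤ) + 1)) * (alD i).toLinearMap

/-- The operator `∑_{0 < n ≤ M} α_{-n} L_n`. -/
def highOp (Q q : ℂ) (M : ℕ) : Module.End ℂ Fk :=
  ∑ i ∈ range M, LinearMap.mulLeft ℂ (p (i + 1)) * Lop Q q ((i : ℤ) + 1)

theorem lowOp_apply (Q q : ℂ) (M : ℕ) (f : Fk) :
    lowOp Q q M f = ∑ i ∈ range M, Lop Q q (-((i : ℤ) + 1)) (alD i f) := by
  simp [lowOp, LinearMap.sum_apply]

theorem highOp_apply (Q q : ℂ) (M : ℕ) (f : Fk) :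
    highOp Q q M f = ∑ i ∈ range M, p (i + 1) * Lop Q q ((i : ℤ) + 1) f := by
  simp [highOp, LinearMap.sum_apply]

theorem derivation_sum_apply (s : Finset ℕ) (D : ℕ → Derivation ℂ Fk Fk) (f : Fk) :
    (∑ i ∈ s, D i) f = ∑ i ∈ s, D i f := by
  induction s using Finset.induction_on with
  | empty => simp
  | insert i s hi ih => rw [sum_insert hi, sum_insert hi, Derivation.add_apply, ih]

theorem sum_triangle (F : ℕ → Fk) (a : ℕ) :
    ∑ i ∈ range a, ∑ k ∈ range (a - 1 - i), F (i + k + 1) = ∑ m ∈ range a, (m : ℂ) • F m := by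
  induction a with
  | zero => simp
  | succ a ih =>
    rw [sum_range_succ, sum_range_succ, ← ih]
    have h : ∀ i ∈ range a, ∑ k ∈ range (a + 1 - 1 - i), F (i + k + 1) =
        ∑ k ∈ range (a - 1 - i), F (i + k + 1) + F a := by
      intro i hi
      rw [mem_range] at hi
      rw [show a + 1 - 1 - i = a - 1 - i + 1 by omega, sum_range_succ]
      congr 2; omega
    rw [sum_congr rfl h, sum_add_distrib]
    simp [Algebra.smul_def]

theorem sum_range_elI (σ : ℂ) {a M : ℕ} (h : a ≤ M) (F : ℕ → Fk → Fk) (hF : ∀ i, F i 0 = 0) :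
    ∑ i ∈ range M, F i (elI σ a i) = ∑ i ∈ range a, F i (el σ (a - 1 - i)) := by
  have h1 : ∀ i ∈ range M, i ∉ range a → F i (elI σ a i) = 0 := by
    intro i _ hi
    rw [mem_range] at hi
    rw [elI, if_neg hi, hF]
  rw [← sum_subset (range_subset_range.mpr h) h1]
  refine sum_congr rfl fun i hi => ?_
  rw [elI, if_pos (mem_range.mp hi)]

theorem sum_quad {σ : ℂ} (hσ : σ ≠ 0) (a : ℕ) :
    ∑ i ∈ range a, (∑ k ∈ range i, p (k + 1) * p (i - k)) * el σ (a - 1 - i) =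
      σ⁻¹ • ((a - 1 : ℂ) • ∑ i ∈ range a, p (i + 1) * el σ (a - 1 - i) -
        ∑ i ∈ range a, (i : ℂ) • (p (i + 1) * el σ (a - 1 - i))) := by
  have h0 : PowerSeries.coeff 0 (pser * pser) = 0 := by
    rw [PowerSeries.coeff_mul]; simp [coeff_zero_pser]
  have h1 := coeff_mul_eser σ h0 a
  have h2 : ∀ i, PowerSeries.coeff (i + 1) (pser * pser) = ∑ k ∈ range i,
  p (k + 1) * p (i - k) := by
    intro i
    rw [PowerSeries.coeff_mul, Nat.sum_antidiagonal_eq_sum_range_succ_mk, sum_range_succ',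
      sum_range_succ]
    simp [pser, p]
  have h3 : pser * pser * eser σ = σ⁻¹ • (pser * theta (eser σ)) := by
    rw [theta_eser, mul_smul_comm, smul_smul, inv_mul_cancel₀ hσ, one_smul, mul_assoc]
  simp only [h2] at h1
  rw [← h1, h3, PowerSeries.coeff_smul, PowerSeries.coeff_mul,
    Nat.sum_antidiagonal_eq_sum_range_succ_mk, sum_range_succ']
  congr 1
  rw [smul_sum, ← sum_sub_distrib]
  simp only [coeff_theta, coeff_zero_pser, zero_mul, add_zero]
  refine sum_congr rfl fun i hi => ?_
  rw [mem_range] at hi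
  have : ((a - (i + 1) : ℕ) : ℂ) = (a - 1 : ℂ) - i := by
    rw [Nat.cast_sub (by omega)]; push_cast; ring
  rw [this, ← sub_smul]
  simp only [pser, eser, PowerSeries.coeff_mk, mul_smul_comm]
  rw [show a - (i + 1) = a - 1 - i by omega]

theorem sum_dd_mul_alD (σ : ℂ) (a : ℕ) {b M : ℕ} (hb : b ≤ M) :
    ∑ i ∈ range M, dd (-((i : ℤ) + 1)) (el σ a) * alD i (el σ b) = (σ * σ) • gam σ a b := by
  have h1 : ∀ i ∈ range M, i ∉ range b →
      dd (-((i : ℤ) + 1)) (el σ a) * alD i (el σ b) = 0 := by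
    intro i _ hi
    rw [mem_range] at hi
    rw [alD_el, elI, if_neg hi, smul_zero, mul_zero]
  rw [← sum_subset (range_subset_range.mpr hb) h1, gam_comm, gam, smul_sum]
  refine sum_congr rfl fun i hi => ?_
  have h2 : (∑ k ∈ range a, p (i + k + 2) * el σ (a - 1 - k)) * el σ (b - 1 - i) =
      ∑ k ∈ range a, p (i + k + 2) * el σ (b - 1 - i) * el σ (a - 1 - k) := by
    rw [sum_mul]
    exact sum_congr rfl fun k _ => mul_right_comm _ _ _
  rw [dd_neg_el, alD_el, elI, if_pos (mem_range.mp hi), smul_mul_assoc, mul_smul_comm, smul_smul,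
    h2]

theorem Lop_neg_alD_mul (Q q : ℂ) (i : ℕ) (f g : Fk) :
    Lop Q q (-((i : ℤ) + 1)) (alD i (f * g)) =
      Lop Q q (-((i : ℤ) + 1)) (alD i f) * g + f * Lop Q q (-((i : ℤ) + 1)) (alD i g) +
      (dd (-((i : ℤ) + 1)) f • alD i + alD i f • dd (-((i : ℤ) + 1))) g := by
  rw [Lop_neg_apply, Lop_neg_apply, Lop_neg_apply]
  generalize ((1 / 2 : ℂ) • ∑ k ∈ range i, p (k + 1) * p (i - k) + (q + Q * i) • p (i + 1)) = w
  simp only [Derivation.leibniz, map_add, smul_eq_mul, Derivation.add_apply,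
    Derivation.smul_apply]
  ring

theorem lowOp_isSecondOrder {Q q σ : ℂ} (hσ : σ ≠ 0) (hQ : Q = 1 / (2 * σ) - σ) (M : ℕ) :
    IsSecondOrder σ M (fun a => a * ((a - 1) / (2 * σ) + q)) (2 * σ) (lowOp Q q M) where
  one_eq := by simp [lowOp_apply]
  el_eq a ha := by
    rw [lowOp_apply]
    simp only [alD_el, map_smul]
    rw [sum_range_elI σ ha (fun i f => σ • Lop Q q (-((i : ℤ) + 1)) f) (by simp)]
    simp only [Lop_neg_apply, dd_neg_el, ← smul_sum, add_mul, sum_add_distrib, smul_mul_assoc]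
    rw [sum_quad hσ]
    have h1 : ∑ i ∈ range a, ∑ k ∈ range (a - 1 - i), p (i + k + 2) * el σ (a - 1 - i - 1 - k) =
        ∑ i ∈ range a, (i : ℂ) • (p (i + 1) * el σ (a - 1 - i)) := by
      rw [← sum_triangle (fun m => p (m + 1) * el σ (a - 1 - m)) a]
      refine sum_congr rfl fun i _ => sum_congr rfl fun k _ => ?_
      congr 2; omega
    rw [h1]
    set S1 := ∑ i ∈ range a, (i : ℂ) • (p (i + 1) * el σ (a - 1 - i)) with hS1
    set S := ∑ i ∈ range a, p (i + 1) * el σ (a - 1 - i) with hS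
    have h2 : ∑ i ∈ range a, (q + Q * i) • (p (i + 1) * el σ (a - 1 - i)) = q • S + Q • S1 := by
      rw [hS, hS1, smul_sum, smul_sum, ← sum_add_distrib]
      refine sum_congr rfl fun i _ => ?_
      module
    rw [h2]
    have h3 : (a : ℂ) • el σ a = σ • S := el_newton σ a
    have h4 : ((a : ℂ) * (((a : ℂ) - 1) / (2 * σ) + q)) • el σ a =
        (((a : ℂ) - 1) / (2 * σ) + q) • σ • S := by
      rw [← h3, smul_smul, mul_comm]
    rw [h4, hQ]
    match_scalars
    · field_simp
      ring
    · field_simp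
  mul_eq a ha := by
    refine ⟨∑ i ∈ range M, ((dd (-((i : ℤ) + 1)) (el σ a)) • alD i +
      (alD i (el σ a)) • dd (-((i : ℤ) + 1))), fun g => ?_, fun b hab => ?_⟩
    · simp only [lowOp_apply, derivation_sum_apply]
      rw [sum_mul, mul_sum, ← sum_add_distrib, ← sum_add_distrib]
      refine sum_congr rfl fun i _ => ?_
      exact Lop_neg_alD_mul Q q i _ _
    · rw [derivation_sum_apply]
      have h1 : ∀ i ∈ range M, (dd (-((i : ℤ) + 1)) (el σ a) • alD i +
          alD i (el σ a) • dd (-((i : ℤ) + 1))) (el σ b) =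
          dd (-((i : ℤ) + 1)) (el σ a) * alD i (el σ b) +
          dd (-((i : ℤ) + 1)) (el σ b) * alD i (el σ a) := by
        intro i _
        rw [Derivation.add_apply, Derivation.smul_apply, Derivation.smul_apply, smul_eq_mul,
          smul_eq_mul, mul_comm (alD i (el σ a))]
      rw [sum_congr rfl h1, sum_add_distrib, sum_dd_mul_alD σ a (show b ≤ M by omega),
        sum_dd_mul_alD σ b ha, gam_comm σ b a]
      module

theorem sum_triangle' (F : ℕ → ℕ → Fk) (M : ℕ) (hF : ∀ n j, M ≤ n + j + 1 → F n j = 0) :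
    ∑ i ∈ range M, ∑ j ∈ range i, F (i - 1 - j) j = ∑ j ∈ range M, ∑ n ∈ range M, F n j := by
  have h1 : ∑ j ∈ range M, ∑ n ∈ range M, F n j =
      ∑ x ∈ (range M ×ˢ range M).filter (fun x : ℕ × ℕ => x.2 + x.1 + 1 < M), F x.2 x.1 := by
    rw [← sum_product', sum_filter_of_ne]
    intro x _ hx
    by_contra hcon
    exact hx (hF _ _ (by omega))
  rw [h1, sum_sigma']
  refine sum_bij' (fun x _ => (x.2, x.1 - 1 - x.2)) (fun x _ => ⟨x.2 + x.1 + 1, x.1⟩)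
    ?_ ?_ ?_ ?_ ?_
  · rintro ⟨i, j⟩ h
    simp only [mem_sigma, mem_range, mem_filter, mem_product] at h ⊢; omega
  · rintro ⟨i, j⟩ h
    simp only [mem_sigma, mem_range, mem_filter, mem_product] at h ⊢; omega
  · rintro ⟨i, j⟩ h
    simp only [mem_sigma, mem_range] at h
    simp only [Sigma.mk.injEq, heq_eq_eq, and_true]; omega
  · rintro ⟨i, j⟩ h
    simp only [mem_filter, mem_product, mem_range] at h
    simp only [Prod.mk.injEq, true_and]; omega
  · rintro ⟨i, j⟩ h
    rfl

theorem highOp_isSecondOrder {Q q σ : ℂ} (hσ : σ ≠ 0) (hQ : Q = σ / 2 - 1 / σ) (M : ℕ) :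
    IsSecondOrder σ M (fun a => a * ((a - 1) / σ + q - 2 * Q)) σ (highOp Q q M) where
  one_eq := by
    rw [highOp_apply]
    exact sum_eq_zero fun i _ => by rw [Lop_pos_one Q q (by omega), mul_zero]
  el_eq a ha := by
    have h1 : ∀ i : ℕ, Lop Q q ((i : ℤ) + 1) (el σ a) =
        ((a : ℂ) - 1 - i + i / 2 * σ ^ 2 + σ * (q - Q * (i + 2))) • elI σ a i := by
      intro i
      rw [Lop_pos_apply, dd_pos_el, alD_el]
      have h2 : ∀ j ∈ range i, alD j (alD (i - 1 - j) (el σ a)) = σ ^ 2 • elI σ a i := by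
        intro j hj
        rw [mem_range] at hj
        rw [alD_el, Derivation.map_smul, elI]
        by_cases hi : i < a
        · rw [if_pos (by omega), alD_el, elI, elI, if_pos (by omega), if_pos hi, smul_smul,
            pow_two, show a - 1 - (i - 1 - j) - 1 - j = a - 1 - i by omega]
        · rw [elI, if_neg hi]
          split_ifs with h
          · rw [alD_el, elI, if_neg (by omega)]; simp
          · simp
      rw [sum_congr rfl h2, sum_const, card_range, ← Nat.cast_smul_eq_nsmul ℂ]
      by_cases hi : i < a
      · have : ((a - 1 - i : ℕ) : ℂ) = (a : ℂ) - 1 - i := by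
          rw [Nat.cast_sub (by omega), Nat.cast_sub (by omega)]; simp
        rw [this]
        module
      · simp [elI, hi]
    rw [highOp_apply]
    simp only [h1]
    rw [sum_range_elI σ ha (fun (i : ℕ) f => p (i + 1) *
      (((a : ℂ) - 1 - i + i / 2 * σ ^ 2 + σ * (q - Q * (i + 2))) • f)) (by simp)]
    set S := ∑ i ∈ range a, p (i + 1) * el σ (a - 1 - i) with hS
    have h3 : (a : ℂ) • el σ a = σ • S := el_newton σ a
    have h4 : ((a : ℂ) * (((a : ℂ) - 1) / σ + q - 2 * Q)) • el σ a =
        (((a : ℂ) - 1) / σ + q - 2 * Q) • σ • S := by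
      rw [← h3, smul_smul, mul_comm]
    rw [h4, hS, smul_smul, smul_sum]
    refine sum_congr rfl fun i _ => ?_
    rw [mul_smul_comm]
    congr 1
    rw [hQ]; field_simp; ring
  mul_eq a ha := by
    refine ⟨∑ i ∈ range M, p (i + 1) • ∑ j ∈ range i, (alD (i - 1 - j) (el σ a)) • alD j,
      fun g => ?_, fun b hab => ?_⟩
    · simp only [highOp_apply, derivation_sum_apply]
      rw [sum_mul, mul_sum, ← sum_add_distrib, ← sum_add_distrib]
      refine sum_congr rfl fun i _ => ?_
      have hr : ∑ j ∈ range i, alD j (el σ a) * alD (i - 1 - j) g =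
          ∑ j ∈ range i, alD (i - 1 - j) (el σ a) * alD j g := by
        rw [← sum_range_reflect]
        refine sum_congr rfl fun j hj => ?_
        rw [mem_range] at hj
        rw [show i - 1 - (i - 1 - j) = j by omega]
      have hq : ∑ j ∈ range i, alD j (alD (i - 1 - j) (el σ a * g)) =
          (∑ j ∈ range i, alD j (alD (i - 1 - j) (el σ a))) * g +
          el σ a * (∑ j ∈ range i, alD j (alD (i - 1 - j) g)) +
          (2 : ℂ) • ∑ j ∈ range i, alD (i - 1 - j) (el σ a) * alD j g := by
        rw [two_smul]
        nth_rw 1 [← hr]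
        rw [sum_mul, mul_sum, ← sum_add_distrib, ← sum_add_distrib, ← sum_add_distrib]
        refine sum_congr rfl fun j _ => ?_
        simp only [Derivation.leibniz, map_add, smul_eq_mul]
        ring
      rw [Lop_pos_apply, Lop_pos_apply, Lop_pos_apply, hq, Derivation.leibniz (dd _),
        Derivation.leibniz (alD i), Derivation.smul_apply, derivation_sum_apply]
      simp only [Derivation.smul_apply, smul_eq_mul, Algebra.smul_def]
      have h2 : algebraMap ℂ Fk (1 / 2) * algebraMap ℂ Fk 2 = 1 := by
        rw [← map_mul]; norm_num
      linear_combination (p (i + 1) * ∑ j ∈ range i, alD (i - 1 - j) (el σ a) * alD j g) * h2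
    · simp only [derivation_sum_apply, Derivation.smul_apply, smul_eq_mul, alD_el, mul_sum]
      have h1 : ∀ i ∈ range M, ∑ j ∈ range i,
      p (i + 1) * (σ • elI σ a (i - 1 - j) * σ • elI σ b j) =
          ∑ j ∈ range i, p (i - 1 - j + j + 2) * (σ • elI σ a (i - 1 - j) * σ • elI σ b j) := by
        intro i _
        refine sum_congr rfl fun j hj => ?_
        rw [mem_range] at hj
        rw [show i - 1 - j + j + 2 = i + 1 by omega]
      rw [sum_congr rfl h1, sum_triangle' (fun n j =>
        p (n + j + 2) * (σ • elI σ a n * σ • elI σ b j))]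
      · rw [gam_comm, gam, smul_sum,
          sum_range_elI σ (show b ≤ M by omega) (fun j f => ∑ n ∈ range M,
            p (n + j + 2) * (σ • elI σ a n * σ • f)) (by simp)]
        refine sum_congr rfl fun j _ => ?_
        rw [sum_range_elI σ ha (fun n f => p (n + j + 2) * (σ • f * σ • el σ (b - 1 - j)))
          (by simp), smul_sum]
        refine sum_congr rfl fun n _ => ?_
        rw [smul_mul_smul_comm, mul_smul_comm, add_comm n j]
        congr 1
        ring
      · intro n j h
        rw [elI, elI]
        split_ifs
        · omega
        all_goals simp

end Fock
end SLEVir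

namespace SLEVir

/-! ### Spanning by ordered words -/

namespace VirasoroRep

variable {c : ℂ} {M N : Type*} [AddCommGroup M] [Module ℂ M] [AddCommGroup N] [Module ℂ N]

/-- The span of the vectors obtained from `v` by words of weight `n`. -/
def wordSpan (R : VirasoroRep c M) (v : M) (n : ℕ) : Submodule ℂ M :=
  Submodule.span ℂ {x | ∃ l, wt l = n ∧ x = R.word l v}

theorem word_mem_wordSpan (R : VirasoroRep c M) (v : M) (l : List ℕ) :
    R.word l v ∈ R.wordSpan v (wt l) := Submodule.subset_span ⟨l, rfl, rfl⟩

theorem L_mem_wordSpan (R : VirasoroRep c M) (v : M) (i : ℕ) {n : ℕ} {x : M}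
    (hx : x ∈ R.wordSpan v n) : R.L (-((i : ℤ) + 1)) x ∈ R.wordSpan v (i + 1 + n) := by
  have : R.wordSpan v n ≤ (R.wordSpan v (i + 1 + n)).comap (R.L (-((i : ℤ) + 1))) := by
    refine Submodule.span_le.mpr ?_
    rintro _ ⟨l, rfl, rfl⟩
    exact Submodule.subset_span ⟨i :: l, by simp, (R.word_cons i l v).symm⟩
  exact this hx

theorem mem_wordSpan_of_mem_gen (R : VirasoroRep c M) {h : ℂ} {v : M} (h0 : R.L 0 v = h • v)
    (hp : ∀ n : ℤ, 0 < n → R.L n v = 0) {x : M} (hx : x ∈ R.cyclic v) {n : ℕ}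
    (hx' : x ∈ R.gen (h + n)) : x ∈ R.wordSpan v n := by
  have hv := R.isLogVacuum_of_hw h0 hp
  rw [hv.cyclic_eq] at hx
  have h1 := R.mem_level_of_mem_gen hv.isVacuum hx hx'
  have h2 : R.level (R.vac h v) n ≤ R.wordSpan v n := by
    refine iSup₂_le fun l hl => ?_
    rw [Submodule.map_le_iff_le_comap, vac, h0, sub_self]
    refine Submodule.span_le.mpr ?_
    rintro _ (rfl | rfl)
    · exact Submodule.subset_span ⟨l, hl, rfl⟩
    · simp
  exact h2 h1

theorem word_perm (R : VirasoroRep c M) (v : M) {l l' : List ℕ} (h : l.Perm l') :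
    R.word l v - R.word l' v ∈
      Submodule.span ℂ {x | ∃ m : List ℕ, wt m = wt l ∧ m.length < l.length ∧ x = R.word m v} := by
  induction h with
  | nil => simp
  | @cons i l l' _ ih =>
    rw [word_cons, word_cons, ← map_sub]
    have : Submodule.span ℂ
        {x | ∃ m : List ℕ, wt m = wt l ∧ m.length < l.length ∧ x = R.word m v} ≤
        (Submodule.span ℂ {x | ∃ m : List ℕ, wt m = wt (i :: l) ∧ m.length < (i :: l).length ∧
          x = R.word m v}).comap (R.L (-((i : ℤ) + 1))) := by
      refine Submodule.span_le.mpr ?_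
      rintro _ ⟨m, h1, h2, rfl⟩
      exact Submodule.subset_span ⟨i :: m, by simp [h1], by simpa using h2,
        (R.word_cons i m v).symm⟩
    exact this ih
  | swap i j l =>
    rw [word_cons, word_cons, word_cons, word_cons, R.comm_apply, if_neg (by omega), add_zero,
      add_sub_cancel_left]
    refine Submodule.smul_mem _ _ (Submodule.subset_span ⟨(i + j + 1) :: l, ?_, by simp, ?_⟩)
    · simp; ring
    · rw [word_cons]; congr 2; push_cast; ring
  | @trans l₁ l₂ l₃ h1 h2 ih1 ih2 =>
    have hw : wt l₁ = wt l₂ := (h1.map _).sum_eq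
    rw [← hw, ← h1.length_eq] at ih2
    rw [← sub_add_sub_cancel]
    exact Submodule.add_mem _ ih1 ih2

/-- Modulo shorter words, the letters of a word may be permuted; hence the words attached to
multisets span. -/
theorem wordSpan_le_of_sorted (R : VirasoroRep c M) (v : M) (n : ℕ) (W : Submodule ℂ M)
    (hW : ∀ s : Multiset ℕ, wt s.sort = n → R.word s.sort v ∈ W) : R.wordSpan v n ≤ W := by
  have key : ∀ k : ℕ, ∀ l : List ℕ, l.length = k → wt l = n → R.word l v ∈ W := by
    intro k
    induction k using Nat.strong_induction_on with
    | _ k ih =>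
      intro l hl hw
      have hp : l.Perm (Multiset.sort (l : Multiset ℕ)) := by
        rw [← Multiset.coe_eq_coe, Multiset.sort_eq]
      have h1 := R.word_perm v hp
      have h2 : Submodule.span ℂ
          {x | ∃ m : List ℕ, wt m = wt l ∧ m.length < l.length ∧ x = R.word m v} ≤ W := by
        refine Submodule.span_le.mpr ?_
        rintro _ ⟨m, h3, h4, rfl⟩
        exact ih _ (hl ▸ h4) m rfl (h3.trans hw)
      have h3 : wt (Multiset.sort (l : Multiset ℕ)) = n := by
        rw [← hw]; exact (hp.symm.map _).sum_eq
      have := W.add_mem (h2 h1) (hW _ h3)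
      rwa [sub_add_cancel] at this
  refine Submodule.span_le.mpr ?_
  rintro _ ⟨l, hl, rfl⟩
  exact key _ l rfl hl

end VirasoroRep

/-! ### Verma modules -/

section Verma

variable (c h : ℂ)

theorem verma_L_mk (n : ℤ) (u : VirU c) :
    (vermaRep c h).L n (Submodule.Quotient.mk u) = Submodule.Quotient.mk (VirU.gen c n * u) := rfl

theorem verma_act_mk (u : VirU c) : ∀ w : VirU c,
    (vermaRep c h).act u (Submodule.Quotient.mk w) = Submodule.Quotient.mk (u * w) := by
  induction u using VirU.induction with
  | h1 r =>
    intro w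
    rw [Algebra.algebraMap_eq_smul_one]
    simp [← Submodule.Quotient.mk_smul]
  | hg n => intro w; simp [verma_L_mk]
  | hm a b ha hb => intro w; simp [ha, hb, mul_assoc]
  | ha a b ha hb => intro w; simp [ha, hb, add_mul]

theorem verma_pos {n : ℤ} (hn : 0 < n) : (vermaRep c h).L n (vermaVec c h) = 0 := by
  rw [vermaVec, verma_L_mk, mul_one, Submodule.Quotient.mk_eq_zero]
  exact Submodule.subset_span (Or.inl ⟨n, hn, rfl⟩)

theorem verma_zero : (vermaRep c h).L 0 (vermaVec c h) = h • vermaVec c h := by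
  have : (Submodule.Quotient.mk (VirU.gen c 0 - algebraMap ℂ (VirU c) h) : Verma c h) = 0 := by
    rw [Submodule.Quotient.mk_eq_zero]
    exact Submodule.subset_span (Or.inr rfl)
  rw [Submodule.Quotient.mk_sub, sub_eq_zero, Algebra.algebraMap_eq_smul_one] at this
  rw [vermaVec, verma_L_mk, mul_one, this]
  rfl

theorem verma_act_vec (u : VirU c) :
    (vermaRep c h).act u (vermaVec c h) = Submodule.Quotient.mk u := by
  rw [vermaVec, verma_act_mk, mul_one]

theorem verma_cyclic : (vermaRep c h).cyclic (vermaVec c h) = ⊤ := by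
  rw [← VirasoroRep.range_orbit, LinearMap.range_eq_top]
  intro x
  obtain ⟨u, rfl⟩ := Submodule.Quotient.mk_surjective _ x
  exact ⟨u, verma_act_vec c h u⟩

/-- The annihilator of a highest weight vector contains `vermaIdeal`. -/
theorem act_eq_zero_of_mem_vermaIdeal {c h : ℂ} {M : Type*} [AddCommGroup M] [Module ℂ M]
    (R : VirasoroRep c M) {v : M} (h0 : R.L 0 v = h • v) (hp : ∀ n : ℤ, 0 < n → R.L n v = 0)
    {u : VirU c} (hu : u ∈ vermaIdeal c h) : R.act u v = 0 := by
  induction hu using Submodule.span_induction with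
  | mem x hx =>
    rcases hx with ⟨n, hn, rfl⟩ | rfl
    · simpa using hp n hn
    · simp [h0, Algebra.algebraMap_eq_smul_one]
  | zero => simp
  | add x y _ _ hx hy => simp [hx, hy]
  | smul a x _ hx => simp [hx]

/-- The universal property of Verma modules. -/
theorem exists_hom_verma {c h : ℂ} {M : Type*} [AddCommGroup M] [Module ℂ M]
    (R : VirasoroRep c M) {v : M} (h0 : R.L 0 v = h • v) (hp : ∀ n : ℤ, 0 < n → R.L n v = 0) :
    ∃ f : Verma c h →ₗ[ℂ] M, (vermaRep c h).IsHom R f ∧ f (vermaVec c h) = v :=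
  VirasoroRep.exists_hom_of_orbit _ _ (verma_cyclic c h) fun u hu => by
    rw [verma_act_vec, Submodule.Quotient.mk_eq_zero] at hu
    exact act_eq_zero_of_mem_vermaIdeal R h0 hp hu

end Verma

end SLEVir

namespace SLEVir
namespace Fock
open MvPolynomial Finset VirasoroRep

/-! ### The grading of the Fock space -/

/-- The homogeneous polynomials of degree `N`, where `p_n` has degree `n`. -/
def homog (N : ℕ) : Submodule ℂ Fk := weightedHomogeneousSubmodule ℂ (fun i : ℕ => i + 1) N

theorem mem_homog {N : ℕ} {f : Fk} :
    f ∈ homog N ↔ IsWeightedHomogeneous (fun i : ℕ => i + 1) f N := Iff.rfl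

theorem weight_toFinsupp (l : List ℕ) :
    Finsupp.weight (fun i : ℕ => i + 1) (Multiset.toFinsupp (l : Multiset ℕ)) = wt l := by
  induction l with
  | nil => simp
  | cons i l ih =>
    rw [← Multiset.cons_coe, ← Multiset.singleton_add, map_add, map_add, ih,
      Multiset.toFinsupp_singleton, Finsupp.weight_single, wt_cons, one_smul]

theorem homog_finiteDimensional (N : ℕ) : FiniteDimensional ℂ (homog N) := by
  have hfin : {d : ℕ →₀ ℕ | Finsupp.weight (fun i : ℕ => i + 1) d = N}.Finite := by
    refine (Set.Finite.image (fun l : List ℕ => Multiset.toFinsupp (l : Multiset ℕ))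
      (VirasoroRep.finite_wt_eq N)).subset ?_
    intro d hd
    refine ⟨(Finsupp.toMultiset d).toList, ?_, ?_⟩
    · rw [Set.mem_ofPred_eq, ← weight_toFinsupp, Multiset.coe_toList, Finsupp.toMultiset_toFinsupp]
      exact hd
    · change Multiset.toFinsupp ((Finsupp.toMultiset d).toList : Multiset ℕ) = d
      rw [Multiset.coe_toList, Finsupp.toMultiset_toFinsupp]
  have h : homog N ≤ Submodule.span ℂ ((fun d => monomial d (1 : ℂ)) ''
      {d : ℕ →₀ ℕ | Finsupp.weight (fun i : ℕ => i + 1) d = N}) := by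
    intro f hf
    rw [f.as_sum]
    refine Submodule.sum_mem _ fun d hd => ?_
    rw [show monomial d (coeff d f) = coeff d f • monomial d (1 : ℂ) by
      rw [smul_monomial, smul_eq_mul, mul_one]]
    exact Submodule.smul_mem _ _ (Submodule.subset_span
      ⟨d, mem_homog.mp hf (mem_support_iff.mp hd), rfl⟩)
  have := FiniteDimensional.span_of_finite ℂ (hfin.image fun d => monomial d (1 : ℂ))
  exact Submodule.finiteDimensional_of_le h

theorem p_mem_homog (n : ℕ) : p n ∈ homog n := by
  cases n with
  | zero => exact Submodule.zero_mem _
  | succ n => exact isWeightedHomogeneous_X ℂ (fun i : ℕ => i + 1) n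

theorem el_mem_homog (σ : ℂ) (n : ℕ) : el σ n ∈ homog n := by
  induction n using Nat.strong_induction_on with
  | _ n ih =>
    cases n with
    | zero => rw [el]; exact isWeightedHomogeneous_one ℂ (fun i : ℕ => i + 1)
    | succ n =>
      rw [el]
      refine Submodule.smul_mem _ _ (Submodule.sum_mem _ fun k _ => ?_)
      have := (mem_homog.mp (p_mem_homog (k + 1))).mul (mem_homog.mp (ih (n - k) (by omega)))
      rwa [show (k : ℕ) + 1 + (n - k) = n + 1 by omega] at this

theorem elL_mem_homog (σ : ℂ) (l : List ℕ) : elL σ l ∈ homog l.sum := by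
  induction l with
  | nil => exact isWeightedHomogeneous_one ℂ (fun i : ℕ => i + 1)
  | cons a l ih =>
    rw [elL_cons, List.sum_cons]
    exact (mem_homog.mp (el_mem_homog σ a)).mul (mem_homog.mp ih)

/-- The span of the products of elementary symmetric functions of total degree `N`. -/
def elSpan (σ : ℂ) (N : ℕ) : Submodule ℂ Fk :=
  Submodule.span ℂ {x | ∃ l : List ℕ, l.sum = N ∧ x = elL σ l}

theorem elL_mem_elSpan (σ : ℂ) (l : List ℕ) : elL σ l ∈ elSpan σ l.sum :=
  Submodule.subset_span ⟨l, rfl, rfl⟩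

theorem mul_mem_elSpan {σ : ℂ} {m n : ℕ} {x y : Fk} (hx : x ∈ elSpan σ m) (hy : y ∈ elSpan σ n) :
    x * y ∈ elSpan σ (m + n) := by
  induction hx using Submodule.span_induction with
  | mem x hx =>
    obtain ⟨l, rfl, rfl⟩ := hx
    induction hy using Submodule.span_induction with
    | mem y hy =>
      obtain ⟨l', rfl, rfl⟩ := hy
      rw [← elL_append]
      exact Submodule.subset_span ⟨_, by simp, rfl⟩
    | zero => simp
    | add y z _ _ h1 h2 => rw [mul_add]; exact Submodule.add_mem _ h1 h2
    | smul r y _ h => rw [mul_smul_comm]; exact Submodule.smul_mem _ _ h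
  | zero => simp
  | add y z _ _ h1 h2 => rw [add_mul]; exact Submodule.add_mem _ h1 h2
  | smul r y _ h => rw [smul_mul_assoc]; exact Submodule.smul_mem _ _ h

theorem el_mem_elSpan (σ : ℂ) (n : ℕ) : el σ n ∈ elSpan σ n :=
  Submodule.subset_span ⟨[n], by simp, by simp⟩

theorem p_mem_elSpan {σ : ℂ} (hσ : σ ≠ 0) (n : ℕ) : p n ∈ elSpan σ n := by
  induction n using Nat.strong_induction_on with
  | _ n ih =>
    cases n with
    | zero => exact Submodule.zero_mem _
    | succ n =>
      have h := el_newton σ (n + 1)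
      rw [sum_range_succ, show n + 1 - 1 - n = 0 by omega, el, mul_one] at h
      have h2 : p (n + 1) = (σ⁻¹ * ((n + 1 : ℕ) : ℂ)) • el σ (n + 1) -
          ∑ k ∈ range n, p (k + 1) * el σ (n + 1 - 1 - k) := by
        rw [mul_smul, h, smul_smul, inv_mul_cancel₀ hσ, one_smul, add_sub_cancel_left]
      rw [h2]
      refine Submodule.sub_mem _ (Submodule.smul_mem _ _ (el_mem_elSpan σ _))
        (Submodule.sum_mem _ fun k hk => ?_)
      rw [mem_range] at hk
      have := mul_mem_elSpan (ih (k + 1) (by omega)) (el_mem_elSpan σ (n - k))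
      rwa [show k + 1 + (n - k) = n + 1 by omega] at this

theorem elSpan_eq_homog {σ : ℂ} (hσ : σ ≠ 0) (N : ℕ) : elSpan σ N = homog N := by
  apply le_antisymm
  · refine Submodule.span_le.mpr ?_
    rintro _ ⟨l, rfl, rfl⟩
    exact elL_mem_homog σ l
  · have key : ∀ l : List ℕ, monomial (Multiset.toFinsupp (l : Multiset ℕ)) (1 : ℂ) ∈
        elSpan σ (wt l) := by
      intro l
      induction l with
      | nil => simpa [el] using el_mem_elSpan σ 0
      | cons i l ih =>
        rw [← Multiset.cons_coe, ← Multiset.singleton_add, map_add, wt_cons,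
          Multiset.toFinsupp_singleton, ← one_mul (1 : ℂ), ← monomial_mul]
        exact mul_mem_elSpan (p_mem_elSpan hσ (i + 1)) ih
    intro f hf
    rw [f.as_sum]
    refine Submodule.sum_mem _ fun d hd => ?_
    rw [show monomial d (coeff d f) = coeff d f • monomial d (1 : ℂ) by
      rw [smul_monomial, smul_eq_mul, mul_one]]
    refine Submodule.smul_mem _ _ ?_
    have h1 := key (Finsupp.toMultiset d).toList
    rw [Multiset.coe_toList, Finsupp.toMultiset_toFinsupp, ← weight_toFinsupp, Multiset.coe_toList,
      Finsupp.toMultiset_toFinsupp] at h1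
    rwa [mem_homog.mp hf (mem_support_iff.mp hd)] at h1

/-! ### Irreducibility of the Fock space at irrational parameter -/

theorem alD_elL (σ : ℂ) (i : ℕ) (l : List ℕ) :
    (∀ N, N + (i + 1) = l.sum → alD i (elL σ l) ∈ elSpan σ N) ∧
      (l.sum < i + 1 → alD i (elL σ l) = 0) := by
  induction l with
  | nil => exact ⟨fun N h => by simp at h, fun _ => by simp⟩
  | cons a l ih =>
    rw [elL_cons, List.sum_cons, Derivation.leibniz, smul_eq_mul, smul_eq_mul, alD_el]
    refine ⟨fun N hN => Submodule.add_mem _ ?_ ?_, fun h => ?_⟩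
    · rcases lt_or_ge l.sum (i + 1) with h | h
      · rw [ih.2 h, mul_zero]; exact Submodule.zero_mem _
      · have := mul_mem_elSpan (el_mem_elSpan σ a) (ih.1 (l.sum - (i + 1)) (by omega))
        rwa [show a + (l.sum - (i + 1)) = N by omega] at this
    · rw [elI, mul_smul_comm]
      refine Submodule.smul_mem _ _ ?_
      split_ifs with h
      · have := mul_mem_elSpan (elL_mem_elSpan σ l) (el_mem_elSpan σ (a - 1 - i))
        rwa [show l.sum + (a - 1 - i) = N by omega] at this
      · simp
    · rw [ih.2 (by omega), elI, if_neg (by omega)]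
      simp

theorem eig_quadratic {lam : ℕ → ℂ} {A B : ℂ} (τ : ℂ)
    (hlam : ∀ a : ℕ, lam a = A * (a : ℂ) ^ 2 + B * a) (l : List ℕ) :
    ∃ m : ℕ, eig lam τ l = A * sq l + B * l.sum - τ * m := by
  induction l with
  | nil => exact ⟨0, by simp [eig]⟩
  | cons a l ih =>
    obtain ⟨m, hm⟩ := ih
    refine ⟨m + minSum a l, ?_⟩
    rw [eig, hm, hlam, sq_cons, List.sum_cons]
    push_cast; ring

theorem sq_pos {l : List ℕ} (h : 0 < l.sum) : 0 < sq l := by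
  induction l with
  | nil => simp at h
  | cons a l ih =>
    rw [sq_cons]
    rcases Nat.eq_zero_or_pos a with rfl | ha
    · have := ih (by simpa using h)
      omega
    · positivity

theorem sub_irrational_ne_zero {κ : ℝ} (hκ : 0 < κ) (hirr : Irrational κ) {s : ℕ} (hs : 0 < s)
    (m : ℕ) : (s : ℂ) - 8 / κ * m ≠ 0 := by
  intro h
  have hκ' : (κ : ℂ) ≠ 0 := by exact_mod_cast hκ.ne'
  have h1 : (κ : ℂ) * s = 8 * m := by
    field_simp at h
    linear_combination h
  have h2 : κ * s = 8 * m := by exact_mod_cast h1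
  refine hirr ⟨8 * m / s, ?_⟩
  push_cast
  rw [← h2]
  field_simp

/-- The parameters for which the Fock space has central charge `c(κ)` and weight `h_{0,1}`. -/
structure IsParam (κ : ℝ) (Q q σ : ℂ) : Prop where
  sq_eq : σ ^ 2 = 2 / κ
  ne_zero : σ ≠ 0
  Q_eq : Q = 1 / (2 * σ) - σ
  q_eq : q = 1 / (2 * σ)

/-- The vacuum generates the Fock space: each level is contained in the image of `∑ L_{-n} α_n`,
and `α_n` lowers the level. -/
theorem homog_le_wordSpan {κ : ℝ} (hκ : 0 < κ) (hirr : Irrational κ) {Q q σ : ℂ}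
    (hP : IsParam κ Q q σ) (N : ℕ) : homog N ≤ (rep Q q).wordSpan 1 N := by
  rw [← elSpan_eq_homog hP.ne_zero]
  induction N using Nat.strong_induction_on with
  | _ N ih =>
    refine Submodule.span_le.mpr ?_
    rintro _ ⟨l, hl, rfl⟩
    rcases Nat.eq_zero_or_pos N with rfl | hN
    · have h0 : ∀ l : List ℕ, l.sum = 0 → elL σ l = 1 := by
        intro l hl
        induction l with
        | nil => rfl
        | cons a l ih =>
          simp only [List.sum_cons, Nat.add_eq_zero_iff] at hl
          rw [elL_cons, hl.1, ih hl.2, el, one_mul]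
      rw [h0 l hl]
      exact Submodule.subset_span ⟨[], rfl, rfl⟩
    · refine (lowOp_isSecondOrder (q := q) hP.ne_zero hP.Q_eq N).mem_of_image_mem le_rfl ?_
        ((rep Q q).wordSpan 1 N) ?_ l hl
      · intro l hl
        obtain ⟨m, hm⟩ := eig_quadratic (A := 1 / (2 * σ)) (B := 0) (2 * σ)
          (lam := fun a => a * ((a - 1) / (2 * σ) + q)) (fun a => by rw [hP.q_eq]; ring) l
        rw [hm]
        have h1 := sub_irrational_ne_zero hκ hirr (sq_pos (hl ▸ hN)) m
        have h2 : (8 : ℂ) / κ = 4 * σ ^ 2 := by rw [hP.sq_eq]; ring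
        have h3 := hP.ne_zero
        rw [h2] at h1
        intro h
        apply h1
        field_simp at h
        linear_combination h
      · intro l hl
        rw [lowOp_apply]
        refine Submodule.sum_mem _ fun i hi => ?_
        rw [mem_range] at hi
        have h1 := ih _ (by omega) ((alD_elL σ i l).1 (N - (i + 1)) (by omega))
        have h2 := (rep Q q).L_mem_wordSpan 1 i h1
        rwa [show i + 1 + (N - (i + 1)) = N by omega] at h2

/-- The operator `∑ p_n L_n` annihilates singular vectors, and it is invertible on each positive
level. -/
theorem homog_no_singular {κ : ℝ} (hκ : 0 < κ) (hirr : Irrational κ) {Q q σ : ℂ}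
    (hP : IsParam κ Q q σ) {N : ℕ} (hN : 0 < N) {f : Fk} (hf : f ∈ homog N)
    (h : ∀ m : ℤ, 0 < m → (rep Q q).L m f = 0) : f = 0 := by
  have hσ := hP.ne_zero
  have hσ' : -2 * σ ≠ 0 := by simpa using hσ
  have hfd := homog_finiteDimensional N
  set Ω := highOp Q q N
  have hQ : Q = (-2 * σ) / 2 - 1 / (-2 * σ) := by rw [hP.Q_eq]; field_simp; ring
  have hsurj : homog N ≤ (homog N).map Ω := by
    have hel := elSpan_eq_homog hσ' N
    rw [← hel]
    refine Submodule.span_le.mpr ?_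
    rintro _ ⟨l, hl, rfl⟩
    rw [hel]
    refine (highOp_isSecondOrder (q := q) hσ' hQ N).mem_of_image_mem le_rfl ?_
      ((homog N).map Ω) (fun l hl => ⟨elL (-2 * σ) l, hl ▸ elL_mem_homog _ l, rfl⟩) l hl
    intro l hl
    obtain ⟨m, hm⟩ := eig_quadratic (A := -(1 / (2 * σ))) (B := 2 * σ) (-2 * σ)
      (lam := fun a => a * ((a - 1) / (-2 * σ) + q - 2 * Q))
      (fun a => by rw [hP.q_eq, hP.Q_eq]; field_simp; ring) l
    rw [hm]
    have h1 := sub_irrational_ne_zero hκ hirr (sq_pos (hl ▸ hN)) (l.sum + m)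
    have h2 : (8 : ℂ) / κ = 4 * σ ^ 2 := by rw [hP.sq_eq]; ring
    rw [h2] at h1
    intro h
    apply h1
    rw [Nat.cast_add]
    field_simp at h
    linear_combination -h
  have hΩ : Ω f = 0 := by
    rw [highOp_apply]
    exact sum_eq_zero fun i _ => by
      rw [show Lop Q q ((i : ℤ) + 1) f = 0 from h _ (by omega), mul_zero]
  -- a linear map onto a space of the same finite dimension has no kernel
  have hrank := (Ω.domRestrict (homog N)).finrank_range_add_finrank_ker
  rw [LinearMap.range_domRestrict] at hrank
  have h1 : Module.finrank ℂ (homog N) ≤ Module.finrank ℂ ((homog N).map Ω) :=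
    Submodule.finrank_mono hsurj
  have h2 : LinearMap.ker (Ω.domRestrict (homog N)) = ⊥ := by
    rw [← Submodule.finrank_eq_zero (R := ℂ)]
    omega
  have h3 : (⟨f, hf⟩ : homog N) ∈ LinearMap.ker (Ω.domRestrict (homog N)) := by
    simpa using hΩ
  rw [h2, Submodule.mem_bot] at h3
  exact congrArg Subtype.val h3

theorem rep_one_zero (Q q : ℂ) : (rep Q q).L 0 1 = hq Q q • (1 : Fk) := by
  change Lop Q q 0 1 = _
  rw [Lop_zero]; simp

/-- The canonical map to the Fock space shows that a Verma module at irrational parameter has no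
singular vectors of positive level. -/
theorem verma_no_singular_of_param {κ : ℝ} (hκ : 0 < κ) (hirr : Irrational κ) {Q q σ : ℂ}
    (hP : IsParam κ Q q σ) {N : ℕ} (hN : 0 < N)
    {y : Verma (1 - 12 * Q ^ 2) (hq Q q)}
    (hy : y ∈ (vermaRep (1 - 12 * Q ^ 2) (hq Q q)).gen (hq Q q + N))
    (h : ∀ m : ℤ, 0 < m → (vermaRep (1 - 12 * Q ^ 2) (hq Q q)).L m y = 0) : y = 0 := by
  set V := vermaRep (1 - 12 * Q ^ 2) (hq Q q)
  set v := vermaVec (1 - 12 * Q ^ 2) (hq Q q) with hv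
  obtain ⟨f, hf, hfv⟩ := exists_hom_verma (rep Q q) (rep_one_zero Q q)
    (fun n hn => Lop_pos_one Q q hn)
  have hword : ∀ l : List ℕ, f (V.word l v) = (rep Q q).word l 1 := by
    intro l
    induction l with
    | nil => simpa using hfv
    | cons i l ih => rw [word_cons, word_cons, ← ih]; exact hf _ _
  -- the linear map from the Fock space that sends a monomial to the corresponding ordered word
  let T : Fk →ₗ[ℂ] Verma (1 - 12 * Q ^ 2) (hq Q q) :=
    (basisMonomials ℕ ℂ).constr ℂ fun d => V.word (Finsupp.toMultiset d).sort v
  have hT : ∀ s : Multiset ℕ, T (monomial (Multiset.toFinsupp s) 1) = V.word s.sort v := by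
    intro s
    have := (basisMonomials ℕ ℂ).constr_basis ℂ
      (fun d => V.word (Finsupp.toMultiset d).sort v) (Multiset.toFinsupp s)
    rw [coe_basisMonomials, Multiset.toFinsupp_toMultiset] at this
    exact this
  have hspan : ∀ n, V.wordSpan v n ≤ (homog n).map T := by
    intro n
    refine V.wordSpan_le_of_sorted v n _ fun s hs => ?_
    rw [← hT]
    refine Submodule.mem_map_of_mem (isWeightedHomogeneous_monomial _ _ _ ?_)
    rw [← hs, ← weight_toFinsupp, Multiset.sort_eq]
  have hfd := homog_finiteDimensional N
  have hcover : homog N ≤ (homog N).map (f ∘ₗ T) := by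
    refine (homog_le_wordSpan hκ hirr hP N).trans (Submodule.span_le.mpr ?_)
    rintro _ ⟨l, hl, rfl⟩
    obtain ⟨g, hg, hgl⟩ := hspan N (hl ▸ V.word_mem_wordSpan v l)
    exact ⟨g, hg, by rw [LinearMap.comp_apply, hgl, hword]⟩
  have hrank := ((f ∘ₗ T).domRestrict (homog N)).finrank_range_add_finrank_ker
  rw [LinearMap.range_domRestrict] at hrank
  have h1 : Module.finrank ℂ (homog N) ≤ Module.finrank ℂ ((homog N).map (f ∘ₗ T)) :=
    Submodule.finrank_mono hcover
  have hker : LinearMap.ker ((f ∘ₗ T).domRestrict (homog N)) = ⊥ := by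
    rw [← Submodule.finrank_eq_zero (R := ℂ)]
    omega
  have hmap : (homog N).map (f ∘ₗ T) = homog N :=
    (Submodule.eq_of_le_of_finrank_eq hcover (by omega)).symm
  have hyw : y ∈ V.wordSpan v N :=
    V.mem_wordSpan_of_mem_gen (verma_zero _ _) (fun n hn => verma_pos _ _ hn)
      (by rw [verma_cyclic]; trivial) hy
  obtain ⟨g, hg, rfl⟩ := hspan N hyw
  have h2 : (f ∘ₗ T) g ∈ homog N := hmap ▸ Submodule.mem_map_of_mem hg
  have h3 : (f ∘ₗ T) g = 0 := homog_no_singular hκ hirr hP hN h2 fun m hm => by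
    rw [LinearMap.comp_apply, ← hf, h m hm, map_zero]
  have h4 : (⟨g, hg⟩ : homog N) ∈ LinearMap.ker ((f ∘ₗ T).domRestrict (homog N)) := by
    simpa using h3
  rw [hker, Submodule.mem_bot] at h4
  rw [show g = 0 from congrArg Subtype.val h4, map_zero]

end Fock

/-- For irrational `κ` the Verma module of weight `h_{0,1}` has no singular vectors of positive
level. -/
theorem verma_no_singular {κ : ℝ} (hκ : 0 < κ) (hirr : Irrational κ) {N : ℕ} (hN : 0 < N)
    {y : Verma (cc κ) (hKac κ 0 1)} (hy : y ∈ (vermaRep (cc κ) (hKac κ 0 1)).gen (hKac κ 0 1 + N))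
    (h : ∀ m : ℤ, 0 < m → (vermaRep (cc κ) (hKac κ 0 1)).L m y = 0) : y = 0 := by
  have hκ' : (κ : ℂ) ≠ 0 := by exact_mod_cast hκ.ne'
  set σ : ℂ := ((Real.sqrt (2 / κ) : ℝ) : ℂ) with hσ
  have h1 : σ ^ 2 = 2 / κ := by
    rw [hσ, ← Complex.ofReal_pow, Real.sq_sqrt (by positivity)]
    push_cast; rfl
  have h0 : σ ≠ 0 := by
    intro h0
    rw [h0] at h1
    field_simp at h1
    norm_num at h1
  have hP : Fock.IsParam κ (1 / (2 * σ) - σ) (1 / (2 * σ)) σ := ⟨h1, h0, rfl, rfl⟩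
  have h2 : (1 / (2 * σ)) ^ 2 = (κ : ℂ) / 8 := by
    rw [div_pow, mul_pow, h1]; field_simp; norm_num
  have h3 : 1 / (2 * σ) * σ = 1 / 2 := by field_simp
  have ec : cc κ = 1 - 12 * (1 / (2 * σ) - σ) ^ 2 := by
    rw [cc, show 1 - 12 * (1 / (2 * σ) - σ) ^ 2 = 1 - 12 * ((1 / (2 * σ)) ^ 2 + σ ^ 2 -
      2 * (1 / (2 * σ) * σ)) by ring, h1, h2, h3]
    ring
  have eh : hKac κ 0 1 = Fock.hq (1 / (2 * σ) - σ) (1 / (2 * σ)) := by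
    rw [Fock.hq, show (1 / (2 * σ)) ^ 2 / 2 - (1 / (2 * σ) - σ) * (1 / (2 * σ)) =
      -(1 / (2 * σ)) ^ 2 / 2 + 1 / (2 * σ) * σ by ring, h2, h3, hKac]
    push_cast; ring
  revert y
  rw [ec, eh]
  exact fun hy h => Fock.verma_no_singular_of_param hκ hirr hP hN hy h

end SLEVir

namespace SLEVir

/-! ### Calculus on the configuration space -/

theorem dirDeriv_fn (v : ℝ × ℝ) (f : Smooth) (p : Conf) :
    (dirDeriv v f).fn p = fderiv ℝ (ext0 f.fn) p v := rfl

theorem Smooth.mul_fn (f g : Smooth) (p : Conf) : (f * g).fn p = f.fn p * g.fn p := rfl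

theorem Smooth.add_fn (f g : Smooth) (p : Conf) : (f + g).fn p = f.fn p + g.fn p := rfl

theorem Smooth.sub_fn (f g : Smooth) (p : Conf) : (f - g).fn p = f.fn p - g.fn p := rfl

theorem Smooth.smul_fn (r : ℂ) (f : Smooth) (p : Conf) : (r • f).fn p = r * f.fn p := rfl

theorem Smooth.algebraMap_fn (r : ℂ) (p : Conf) : (algebraMap ℂ Smooth r).fn p = r := rfl

/-- The derivative of an element of `Smooth` may be computed from any function that agrees with
it near the point. -/
theorem dirDeriv_fn_of_hasFDerivAt {v : ℝ × ℝ} {f : Smooth} {p : Conf} {g : ℝ × ℝ → ℂ}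
    {g' : ℝ × ℝ →L[ℝ] ℂ} (hg : HasFDerivAt g g' p) (h : ∀ q : Conf, f.fn q = g q) :
    (dirDeriv v f).fn p = g' v := by
  have : ext0 f.fn =ᶠ[nhds (p : ℝ × ℝ)] g := by
    filter_upwards [isOpen_Conf.mem_nhds p.2] with q hq
    rw [ext0_apply _ hq, h]
  rw [dirDeriv_fn, this.fderiv_eq, hg.fderiv]

theorem Smooth.hasFDerivAt (f : Smooth) (p : Conf) :
    HasFDerivAt (ext0 f.fn) (fderiv ℝ (ext0 f.fn) p) p := (f.differentiableAt p).hasFDerivAt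

theorem Smooth.ext0_coe (f : Smooth) (p : Conf) : ext0 f.fn p = f.fn p := ext0_apply f.fn p.2

theorem dirDeriv_mul (v : ℝ × ℝ) (f g : Smooth) :
    dirDeriv v (f * g) = f * dirDeriv v g + g * dirDeriv v f := by
  ext p
  rw [dirDeriv_fn_of_hasFDerivAt ((f.hasFDerivAt p).mul (g.hasFDerivAt p))]
  · simp [Smooth.add_fn, Smooth.mul_fn, dirDeriv_fn, Smooth.ext0_coe]
  · intro q; simp [Smooth.mul_fn, Smooth.ext0_coe]

theorem dirDeriv_comm (v w : ℝ × ℝ) (f : Smooth) :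
    dirDeriv v (dirDeriv w f) = dirDeriv w (dirDeriv v f) := by
  ext p
  have hd : ContDiffAt ℝ ∞ (ext0 f.fn) p := f.contDiffOn.contDiffAt (isOpen_Conf.mem_nhds p.2)
  have h2 : DifferentiableAt ℝ (fderiv ℝ (ext0 f.fn)) (p : ℝ × ℝ) :=
    (hd.fderiv_right (m := ∞) (by simp)).differentiableAt (by simp)
  have key : ∀ v w : ℝ × ℝ, (dirDeriv v (dirDeriv w f)).fn p =
      fderiv ℝ (fderiv ℝ (ext0 f.fn)) p v w := by
    intro v w
    rw [dirDeriv_fn_of_hasFDerivAt (h2.hasFDerivAt.clm_apply (hasFDerivAt_const w _))]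
    · simp
    · intro q; rfl
  rw [key, key]
  have hs : IsSymmSndFDerivAt ℝ (ext0 f.fn) (p : ℝ × ℝ) :=
    hd.isSymmSndFDerivAt (by
      rw [minSmoothness_of_isRCLikeNormedField]; exact WithTop.coe_le_coe.mpr le_top)
  exact hs.eq v w

theorem dirDeriv_xS (v : ℝ × ℝ) : dirDeriv v xS = algebraMap ℂ Smooth v.1 := by
  ext p
  have h := (Complex.ofRealCLM.comp (ContinuousLinearMap.fst ℝ ℝ ℝ)).hasFDerivAt (x := (p : ℝ × ℝ))
  rw [dirDeriv_fn_of_hasFDerivAt h (fun q => rfl)]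
  rfl

theorem dirDeriv_yS (v : ℝ × ℝ) : dirDeriv v yS = algebraMap ℂ Smooth v.2 := by
  ext p
  have h := (Complex.ofRealCLM.comp (ContinuousLinearMap.snd ℝ ℝ ℝ)).hasFDerivAt (x := (p : ℝ × ℝ))
  rw [dirDeriv_fn_of_hasFDerivAt h (fun q => rfl)]
  rfl

theorem invS_mul : invS * (yS - xS) = 1 := by
  ext p
  have hp : ((p.1.2 - p.1.1 : ℝ) : ℂ) ≠ 0 := fun h => p.2
    (sub_eq_zero.mp (Complex.ofReal_eq_zero.mp h)).symm
  have h1 : (invS * (yS - xS)).fn p = ((p.1.2 - p.1.1 : ℝ) : ℂ)⁻¹ * ((p.1.2 : ℂ) - p.1.1) := rfl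
  rw [h1, ← Complex.ofReal_sub, inv_mul_cancel₀ hp]
  rfl

theorem exp_logS (p : Conf) : Complex.exp (logS.fn p) = ((p.1.1 - p.1.2 : ℝ) : ℂ) :=
  Complex.exp_log fun h => p.2 (sub_eq_zero.mp (Complex.ofReal_eq_zero.mp h))

theorem dirDeriv_logS (v : ℝ × ℝ) :
    dirDeriv v logS = (((v.2 : ℂ) - v.1)) • invS := by
  have h1 : (xS - yS) * dirDeriv v logS = algebraMap ℂ Smooth (v.1 - v.2) := by
    ext p
    have h := (logS.hasFDerivAt p).cexp
    have h2 : HasFDerivAt (fun q : ℝ × ℝ => ((q.1 - q.2 : ℝ) : ℂ))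
        (Complex.ofRealCLM.comp (ContinuousLinearMap.fst ℝ ℝ ℝ - ContinuousLinearMap.snd ℝ ℝ ℝ))
        (p : ℝ × ℝ) :=
      (Complex.ofRealCLM.comp
        (ContinuousLinearMap.fst ℝ ℝ ℝ - ContinuousLinearMap.snd ℝ ℝ ℝ)).hasFDerivAt
    have h3 : (fun q : ℝ × ℝ => Complex.exp (ext0 logS.fn q)) =ᶠ[nhds (p : ℝ × ℝ)]
        fun q : ℝ × ℝ => ((q.1 - q.2 : ℝ) : ℂ) := by
      filter_upwards [isOpen_Conf.mem_nhds p.2] with q hq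
      rw [ext0_apply _ hq, exp_logS]
    have h4 := (h2.congr_of_eventuallyEq h3).unique h
    have h5 := congrArg (fun L : ℝ × ℝ →L[ℝ] ℂ => L v) h4
    rw [Smooth.ext0_coe, exp_logS] at h5
    simp only [ContinuousLinearMap.comp_apply, smul_apply, smul_eq_mul] at h5
    rw [Smooth.mul_fn, Smooth.algebraMap_fn, dirDeriv_fn]
    have h6 : (xS - yS).fn p = ((p.1.1 - p.1.2 : ℝ) : ℂ) := by
      rw [Smooth.sub_fn, Complex.ofReal_sub]; rfl
    rw [h6, ← h5]
    simp
  have h2 := invS_mul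
  rw [Algebra.smul_def, ← neg_sub, map_neg, ← h1]
  linear_combination -dirDeriv v logS * h2

theorem dirDeriv_powS (v : ℝ × ℝ) (α : ℂ) :
    dirDeriv v (powS α) = α • (powS α * dirDeriv v logS) := by
  ext p
  have hfn : ∀ q : Conf, (powS α).fn q = Complex.exp (logS.fn q * α) := fun q =>
    Complex.cpow_def_of_ne_zero
      (fun h => q.2 (sub_eq_zero.mp (Complex.ofReal_eq_zero.mp h))) α
  have h := ((logS.hasFDerivAt p).mul_const α).cexp
  rw [dirDeriv_fn_of_hasFDerivAt h (fun q => by rw [hfn, Smooth.ext0_coe]), Smooth.smul_fn,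
    Smooth.mul_fn, hfn, Smooth.ext0_coe]
  simp [dirDeriv_fn]
  ring

theorem powS_ne_zero (α : ℂ) (p : Conf) : (powS α).fn p ≠ 0 := by
  have hfn : (powS α).fn p = Complex.exp (logS.fn p * α) :=
    Complex.cpow_def_of_ne_zero
      (fun h => p.2 (sub_eq_zero.mp (Complex.ofReal_eq_zero.mp h))) α
  rw [hfn]
  exact Complex.exp_ne_zero _

/-! ### Derivations of `ℱ` -/

open MvPolynomial

theorem coeff_coeffDeriv (v : ℝ × ℝ) (f : F) (s : Idx →₀ ℕ) :
    coeff s (coeffDeriv v f) = dirDeriv v (coeff s f) := by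
  change coeff s (AddMonoidAlgebra.map (dirDeriv v).toAddMonoidHom f) = _
  simp [coeff]

/-- The directional derivative in the variables `(x, y)`, as a derivation of `ℱ`. -/
def coeffD (v : ℝ × ℝ) : Derivation ℂ F F :=
  Derivation.mk' (coeffDeriv v) fun f g => by
    ext s : 1
    simp only [smul_eq_mul, coeff_add, coeff_coeffDeriv, coeff_mul, map_sum, dirDeriv_mul,
      Finset.sum_add_distrib]
    congr 1
    exact Finset.sum_bij' (fun x _ => (x.2, x.1)) (fun x _ => (x.2, x.1))
      (by simp [add_comm]) (by simp [add_comm]) (by simp) (by simp) (by simp)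

/-- `∑_{l ≥ 2} P_l ∂/∂a_l`, as a derivation of `ℱ`. -/
def aD (P : ℕ → F) : Derivation ℂ F F :=
  (mkDerivation Smooth (fun l : Idx => P l)).restrictScalars ℂ

theorem aD_C (P : ℕ → F) (r : Smooth) : aD P (C r) = 0 :=
  (mkDerivation Smooth (fun l : Idx => P l)).map_algebraMap r

theorem aD_X (P : ℕ → F) (l : Idx) : aD P (X l) = P l :=
  mkDerivation_X (A := F) (R := Smooth) (fun l : Idx => P l) l

theorem aD_a (P : ℕ → F) {l : ℕ} (hl : 2 ≤ l) : aD P (a l) = P l := by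
  rw [a, dif_pos hl, aD_X]

theorem coeffD_C (v : ℝ × ℝ) (r : Smooth) : coeffD v (C r) = C (dirDeriv v r) := by
  change coeffDeriv v (C r) = _
  ext s : 1
  rw [coeff_coeffDeriv, coeff_C, coeff_C]
  split_ifs <;> simp

theorem coeffD_X (v : ℝ × ℝ) (l : Idx) : coeffD v (X l) = 0 := by
  have h1 : dirDeriv v 1 = 0 := by
    have := dirDeriv_mul v 1 1
    simpa using this
  change coeffDeriv v (X l) = 0
  ext s : 1
  rw [coeff_coeffDeriv, coeff_X, coeff_zero]
  split_ifs <;> simp [h1]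

theorem coeffD_a (v : ℝ × ℝ) (l : ℕ) : coeffD v (a l) = 0 := by
  rw [a]; split_ifs
  · exact coeffD_X v _
  · simp

theorem coeffD_xF (v : ℝ × ℝ) : coeffD v xF = algebraMap ℂ F v.1 := by
  rw [xF, coeffD_C, dirDeriv_xS]; rfl

theorem coeffD_yF (v : ℝ × ℝ) : coeffD v yF = algebraMap ℂ F v.2 := by
  rw [yF, coeffD_C, dirDeriv_yS]; rfl

/-- A derivation of `ℱ` is a vector field if it acts on `C^∞` by the chain rule, i.e. if it is of
the form `∑ P_l ∂/∂a_l + f ∂/∂x + g ∂/∂y`. -/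
def IsVectorField (D : Derivation ℂ F F) : Prop :=
  ∀ r : Smooth, D (C r) = D xF * C (dirDeriv (1, 0) r) + D yF * C (dirDeriv (0, 1) r)

namespace IsVectorField

variable {D E : Derivation ℂ F F}

theorem ext (hD : IsVectorField D) (hE : IsVectorField E) (hx : D xF = E xF) (hy : D yF = E yF)
    (ha : ∀ l, 2 ≤ l → D (a l) = E (a l)) : D = E := by
  refine Derivation.ext fun f => ?_
  induction f using MvPolynomial.induction_on with
  | C r => rw [hD, hE, hx, hy]
  | add f g hf hg => rw [map_add, map_add, hf, hg]
  | mul_X f l hf =>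
    have := ha l.1 l.2
    rw [a, dif_pos l.2] at this
    rw [Derivation.leibniz, Derivation.leibniz, hf, this]

theorem add (hD : IsVectorField D) (hE : IsVectorField E) : IsVectorField (D + E) := by
  intro r
  simp only [Derivation.add_apply, hD r, hE r]
  ring

theorem smul (hD : IsVectorField D) (f : F) : IsVectorField (f • D) := by
  intro r
  simp only [Derivation.smul_apply, hD r, smul_eq_mul]
  ring

theorem csmul (hD : IsVectorField D) (z : ℂ) : IsVectorField (z • D) := by
  intro r
  simp only [Derivation.smul_apply, hD r, smul_add, smul_mul_assoc]

theorem zero : IsVectorField 0 := by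
  intro r; simp

theorem lie (hD : IsVectorField D) (hE : IsVectorField E) : IsVectorField ⁅D, E⁆ := by
  intro r
  simp only [Derivation.commutator_apply, hD r, hE r, map_add, Derivation.leibniz, smul_eq_mul]
  rw [hD (dirDeriv (1, 0) r), hD (dirDeriv (0, 1) r), hE (dirDeriv (1, 0) r),
    hE (dirDeriv (0, 1) r), dirDeriv_comm (0, 1) (1, 0)]
  ring

end IsVectorField

theorem isVectorField_aD (P : ℕ → F) : IsVectorField (aD P) := by
  intro r
  rw [aD_C, xF, yF, aD_C, aD_C]
  ring

theorem isVectorField_coeffD_x : IsVectorField (coeffD (1, 0)) := by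
  intro r
  rw [coeffD_C, coeffD_xF, coeffD_yF]
  simp

theorem isVectorField_coeffD_y : IsVectorField (coeffD (0, 1)) := by
  intro r
  rw [coeffD_C, coeffD_xF, coeffD_yF]
  simp

end SLEVir

namespace SLEVir

open MvPolynomial (C)

/-! ### First order operators -/

/-- The first order operator `D + s`. -/
def fo (D : Derivation ℂ F F) (s : F) : Module.End ℂ F := D.toLinearMap + mulOp s

theorem fo_apply (D : Derivation ℂ F F) (s f : F) : fo D s f = D f + s * f := rfl

theorem fo_zero_zero : fo 0 0 = 0 := by
  refine LinearMap.ext fun f => ?_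
  rw [fo_apply]; simp

theorem fo_comm (D E : Derivation ℂ F F) (s r : F) :
    fo D s * fo E r - fo E r * fo D s = fo ⁅D, E⁆ (D r - E s) := by
  refine LinearMap.ext fun f => ?_
  simp only [LinearMap.sub_apply, Module.End.mul_apply, fo_apply, Derivation.commutator_apply,
    map_add, Derivation.leibniz, smul_eq_mul]
  ring

theorem fo_smul (z : ℂ) (D : Derivation ℂ F F) (s : F) : z • fo D s = fo (z • D) (z • s) := by
  refine LinearMap.ext fun f => ?_
  simp [fo_apply]

theorem fo_sub (D E : Derivation ℂ F F) (s r : F) : fo D s - fo E r = fo (D - E) (s - r) := by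
  refine LinearMap.ext fun f => ?_
  simp only [LinearMap.sub_apply, fo_apply, Derivation.sub_apply]
  ring

theorem fo_scalar (D : Derivation ℂ F F) (s : F) (z : ℂ) :
    fo D s + z • (1 : Module.End ℂ F) = fo D (s + z • 1) := by
  refine LinearMap.ext fun f => ?_
  simp only [LinearMap.add_apply, LinearMap.smul_apply, Module.End.one_apply, fo_apply, add_mul,
    smul_mul_assoc, one_mul, add_assoc]

/-- The vector field `∑ P_l ∂/∂a_l + f ∂/∂x + g ∂/∂y`. -/
def vf (P : ℕ → F) (f g : F) : Derivation ℂ F F :=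
  aD P + f • coeffD (1, 0) + g • coeffD (0, 1)

theorem isVectorField_vf (P : ℕ → F) (f g : F) : IsVectorField (vf P f g) :=
  ((isVectorField_aD P).add (isVectorField_coeffD_x.smul f)).add (isVectorField_coeffD_y.smul g)

@[simp] theorem vf_xF (P : ℕ → F) (f g : F) : vf P f g xF = f := by
  have h : aD P xF = 0 := aD_C P xS
  simp [vf, coeffD_xF, h]

@[simp] theorem vf_yF (P : ℕ → F) (f g : F) : vf P f g yF = g := by
  have h : aD P yF = 0 := aD_C P yS
  simp [vf, coeffD_yF, h]

theorem vf_a (P : ℕ → F) (f g : F) {l : ℕ} (hl : 2 ≤ l) : vf P f g (a l) = P l := by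
  simp [vf, coeffD_a, aD_a P hl]

theorem fo_vf (P : ℕ → F) (f g s : F) :
    fo (vf P f g) s = aDeriv P + mulOp f * dx + mulOp g * dy + mulOp s := rfl

/-! ### The generating series of the formal variables -/

open PowerSeries (coeff)

/-- `1 + ∑_{l ≥ 2} a_l t^l`. -/
def gser : PowerSeries F := PowerSeries.mk fun n => if n = 0 then 1 else a n

theorem a_zero : a 0 = 0 := rfl

theorem a_one : a 1 = 0 := rfl

theorem coeff_gser {n : ℕ} (hn : n ≠ 0) : coeff n gser = a n := by
  rw [gser, PowerSeries.coeff_mk, if_neg hn]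

theorem coeff_zero_gser : coeff 0 gser = 1 := by
  rw [gser, PowerSeries.coeff_mk, if_pos rfl]

@[simp] theorem constantCoeff_gser : PowerSeries.constantCoeff gser = 1 := by
  rw [← PowerSeries.coeff_zero_eq_constantCoeff_apply, coeff_zero_gser]

@[simp] theorem constantCoeff_theta (f : PowerSeries F) :
    PowerSeries.constantCoeff (theta f) = 0 := by
  rw [← PowerSeries.coeff_zero_eq_constantCoeff_apply, coeff_theta]; simp

theorem coeff_gser_sub_one (n : ℕ) : coeff n (gser - 1) = a n := by
  cases n with
  | zero => simp [a_zero]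
  | succ n => rw [map_sub, coeff_gser (by omega)]; simp [PowerSeries.coeff_one]

theorem IsVectorField.ext_gser {D E : Derivation ℂ F F} (hD : IsVectorField D)
    (hE : IsVectorField E) (hx : D xF = E xF) (hy : D yF = E yF)
    (ha : coeffwise D gser = coeffwise E gser) : D = E := by
  refine hD.ext hE hx hy fun l hl => ?_
  have := congrArg (coeff l) ha
  rwa [coeff_coeffwise, coeff_coeffwise, coeff_gser (by omega)] at this

theorem coeffwise_gser_eq {D : Derivation ℂ F F} {f : PowerSeries F} (h0 : coeff 0 f = 0)
    (h1 : coeff 1 f = 0) (h : ∀ l, 2 ≤ l → coeff l f = D (a l)) : coeffwise D gser = f := by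
  ext1 l
  rw [coeff_coeffwise]
  match l with
  | 0 => rw [coeff_zero_gser, h0]; simp
  | 1 => rw [coeff_gser one_ne_zero, a_one, h1, map_zero]
  | l + 2 => rw [coeff_gser (by omega), h _ (by omega)]

theorem coeffwise_lie (D E : Derivation ℂ F F) (f : PowerSeries F) :
    coeffwise ⁅D, E⁆ f = coeffwise D (coeffwise E f) - coeffwise E (coeffwise D f) := by
  ext1 n
  simp [Derivation.commutator_apply]

theorem coeffwise_smul (z : ℂ) (D : Derivation ℂ F F) (f : PowerSeries F) :
    coeffwise (z • D) f = z • coeffwise D f := by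
  ext1 n
  simp

theorem aSum_succ (r n : ℕ) :
    aSum (r + 1) n = ∑ x ∈ Finset.HasAntidiagonal.antidiagonal n, a x.1 * aSum r x.2 := by
  simp only [aSum, Finset.mul_sum]
  rw [Finset.sum_sigma']
  refine Finset.sum_bij' (fun m _ => ⟨(m 0, ∑ i : Fin r, m i.succ), fun i => m i.succ⟩)
    (fun x _ => Fin.cons x.1.1 x.2) ?_ ?_ ?_ ?_ ?_
  · intro m hm
    rw [Finset.Nat.mem_antidiagonalTuple, Fin.sum_univ_succ] at hm
    simp [Finset.Nat.mem_antidiagonalTuple, hm]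
  · rintro ⟨⟨i, j⟩, m⟩ h
    simp only [Finset.mem_sigma, Finset.HasAntidiagonal.mem_antidiagonal,
      Finset.Nat.mem_antidiagonalTuple] at h ⊢
    simp [Fin.sum_univ_succ, h]
  · intro m _
    exact Fin.cons_self_tail m
  · rintro ⟨⟨i, j⟩, m⟩ h
    simp only [Finset.mem_sigma, Finset.HasAntidiagonal.mem_antidiagonal,
      Finset.Nat.mem_antidiagonalTuple] at h
    simp [h.2]
  · intro m _
    simp [Fin.prod_univ_succ]

theorem coeff_gser_pow (r n : ℕ) : coeff n ((gser - 1) ^ r) = aSum r n := by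
  induction r generalizing n with
  | zero =>
    rw [pow_zero, PowerSeries.coeff_one, aSum]
    cases n with
    | zero => simp
    | succ n => simp [Finset.Nat.antidiagonalTuple_zero_succ]
  | succ r ih =>
    rw [pow_succ', PowerSeries.coeff_mul, aSum_succ]
    exact Finset.sum_congr rfl fun x _ => by rw [coeff_gser_sub_one, ih]

theorem aSum_eq_zero {r n : ℕ} (h : n < 2 * r) : aSum r n = 0 := by
  induction r generalizing n with
  | zero => omega
  | succ r ih =>
    rw [aSum_succ]
    refine Finset.sum_eq_zero fun x hx => ?_
    rw [Finset.HasAntidiagonal.mem_antidiagonal] at hx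
    rcases lt_or_ge x.1 2 with h1 | h1
    · interval_cases x.1 <;> simp [a_zero, a_one]
    · rw [ih (by omega), mul_zero]

/-! ### The vector fields underlying the operators -/

/-- The vector field underlying `L_n`, `n > 0`. -/
def posD (n : ℕ) : Derivation ℂ F F :=
  vf (fun l => if n ≤ l then ((l : ℂ) - n - 1) • coeff (l - n) gser else 0)
    (if n = 1 then 1 else 0) (if n = 1 then 1 else 0)

/-- The vector field underlying `L_0`. -/
def zeroD : Derivation ℂ F F := vf (fun l => (l : ℂ) • a l) xF yF

/-- The vector field underlying `L_{-1}`. -/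
def negOneD : Derivation ℂ F F :=
  vf (fun l => ((l : ℂ) + 2) • a (l + 1) + aSum 2 (l + 1)) (xF ^ 2 - 3 * a 2) (yF ^ 2 - 3 * a 2)

/-- The vector field underlying `L_{-2}`. -/
def negTwoD : Derivation ℂ F F :=
  vf (fun l => ((l : ℂ) + 4) • a (l + 2) - 4 * a 2 * a l + 3 * aSum 2 (l + 2) + aSum 3 (l + 2))
    (xF ^ 3 - 4 * xF * a 2 - 5 * a 3) (yF ^ 3 - 4 * yF * a 2 - 5 * a 3)

theorem posD_gser {n : ℕ} (hn : 1 ≤ n) : coeffwise (posD n) gser =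
    PowerSeries.X ^ n * (theta gser - gser) + if n = 1 then PowerSeries.X else 0 := by
  refine coeffwise_gser_eq ?_ ?_ fun l hl => ?_
  · rw [map_add, PowerSeries.coeff_X_pow_mul', if_neg (by omega)]
    split_ifs <;> simp
  · rw [map_add, PowerSeries.coeff_X_pow_mul']
    by_cases h : n = 1
    · subst h
      simp
    · rw [if_neg (by omega), if_neg h]; simp
  · rw [posD, vf_a _ _ _ hl, map_add, PowerSeries.coeff_X_pow_mul']
    have h1 : coeff l (if n = 1 then PowerSeries.X else 0 : PowerSeries F) = 0 := by
      split_ifs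
      · rw [PowerSeries.coeff_X, if_neg (by omega)]
      · simp
    rw [h1, add_zero]
    split_ifs with h
    · rw [map_sub, coeff_theta, Nat.cast_sub h, sub_smul _ (1 : ℂ), one_smul]
    · rfl

theorem zeroD_gser : coeffwise zeroD gser = theta gser := by
  refine coeffwise_gser_eq ?_ ?_ fun l hl => ?_
  · simp [coeff_theta]
  · rw [coeff_theta, coeff_gser one_ne_zero, a_one, smul_zero]
  · rw [zeroD, vf_a _ _ _ hl, coeff_theta, coeff_gser (by omega)]

theorem natCast_smul_eq (z : ℂ) (k : ℕ) (f : F) (h : z = k) : z • f = (k : F) * f := by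
  rw [h, Algebra.smul_def, map_natCast]

theorem negOneD_gser : PowerSeries.X * coeffwise negOneD gser =
    theta gser - gser + gser ^ 2 - 3 * PowerSeries.C (a 2) * PowerSeries.X ^ 2 := by
  have h : ∀ n, coeff n (theta gser - gser + gser ^ 2 - 3 * PowerSeries.C (a 2) *
      PowerSeries.X ^ 2) = ((n : ℂ) + 1) • a n + aSum 2 n - if n = 2 then 3 * a 2 else 0 := by
    intro n
    rw [show theta gser - gser + gser ^ 2 - 3 * PowerSeries.C (a 2) * PowerSeries.X ^ 2 =
      theta gser + (gser - 1) + (gser - 1) ^ 2 - PowerSeries.C (3 * a 2) * PowerSeries.X ^ 2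
      by rw [map_mul, map_ofNat]; ring, map_sub, map_add, map_add, coeff_gser_pow,
        coeff_gser_sub_one, coeff_theta,
      PowerSeries.coeff_C_mul, PowerSeries.coeff_X_pow]
    have h1 : (n : ℂ) • coeff n gser = (n : ℂ) • a n := by
      cases n with
      | zero => simp
      | succ n => rw [coeff_gser (by omega)]
    rw [h1, add_smul, one_smul, mul_ite, mul_one, mul_zero]
  ext1 n
  rw [h]
  match n with
  | 0 => simp [a_zero, aSum_eq_zero]
  | 1 =>
    rw [PowerSeries.coeff_succ_X_mul, coeff_coeffwise, coeff_zero_gser]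
    simp [a_one, aSum_eq_zero]
  | 2 =>
    rw [PowerSeries.coeff_succ_X_mul, coeff_coeffwise, coeff_gser one_ne_zero, a_one, if_pos rfl,
      natCast_smul_eq _ 3 _ (by norm_num), aSum_eq_zero (by omega)]
    simp
  | n + 3 =>
    rw [PowerSeries.coeff_succ_X_mul, coeff_coeffwise, coeff_gser (by omega), negOneD,
      vf_a _ _ _ (by omega), if_neg (by omega), sub_zero]
    push_cast
    congr 2
    ring

theorem negTwoD_gser : PowerSeries.X ^ 2 * coeffwise negTwoD gser =
    theta gser - gser + gser ^ 3 - 4 * PowerSeries.C (a 2) * PowerSeries.X ^ 2 * gser -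
      5 * PowerSeries.C (a 3) * PowerSeries.X ^ 3 := by
  have h : ∀ n, coeff n (theta gser - gser + gser ^ 3 -
      4 * PowerSeries.C (a 2) * PowerSeries.X ^ 2 * gser -
      5 * PowerSeries.C (a 3) * PowerSeries.X ^ 3) =
      ((n : ℂ) + 2) • a n + 3 * aSum 2 n + aSum 3 n -
        (if 2 ≤ n then 4 * a 2 * coeff (n - 2) gser else 0) - if n = 3 then 5 * a 3 else 0 := by
    intro n
    rw [show theta gser - gser + gser ^ 3 - 4 * PowerSeries.C (a 2) * PowerSeries.X ^ 2 * gser -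
      5 * PowerSeries.C (a 3) * PowerSeries.X ^ 3 =
      theta gser + (2 : ℂ) • (gser - 1) + PowerSeries.C 3 * (gser - 1) ^ 2 + (gser - 1) ^ 3 -
      PowerSeries.C (4 * a 2) * (PowerSeries.X ^ 2 * gser) -
      PowerSeries.C (5 * a 3) * PowerSeries.X ^ 3
      by rw [two_smul, map_ofNat, map_mul, map_mul, map_ofNat, map_ofNat]; ring]
    simp only [map_sub, map_add, coeff_gser_pow, PowerSeries.coeff_smul, coeff_theta,
      PowerSeries.coeff_C_mul, PowerSeries.coeff_X_pow,
      PowerSeries.coeff_X_pow_mul', mul_ite, mul_one, mul_zero]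
    have h1 : (n : ℂ) • coeff n gser = (n : ℂ) • a n := by
      cases n with
      | zero => simp
      | succ n => rw [coeff_gser (by omega)]
    have h2 : coeff n gser - coeff n 1 = a n := by rw [← map_sub, coeff_gser_sub_one]
    rw [h1, h2, add_smul]
  ext1 n
  rw [h]
  match n with
  | 0 => simp [a_zero, aSum_eq_zero]
  | 1 => simp [PowerSeries.coeff_X_pow_mul', a_one, aSum_eq_zero]
  | 2 =>
    rw [PowerSeries.coeff_X_pow_mul', if_pos le_rfl, coeff_coeffwise, coeff_zero_gser]
    rw [natCast_smul_eq _ 4 _ (by norm_num), aSum_eq_zero (by omega), aSum_eq_zero (by omega)]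
    simp
  | 3 =>
    rw [PowerSeries.coeff_X_pow_mul', if_pos (by omega), coeff_coeffwise,
      show 3 - 2 = 1 from rfl, coeff_gser one_ne_zero, a_one, natCast_smul_eq _ 5 _ (by norm_num),
      aSum_eq_zero (by omega), aSum_eq_zero (by omega)]
    simp
  | n + 4 =>
    rw [PowerSeries.coeff_X_pow_mul', if_pos (show 2 ≤ n + 4 by omega), coeff_coeffwise,
      show n + 4 - 2 = n + 2 by omega, coeff_gser (by omega), negTwoD,
      vf_a _ _ _ (by omega), if_neg (show ¬n + 4 = 3 by omega), if_pos (show 2 ≤ n + 4 by omega),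
      sub_zero]
    push_cast
    rw [show (n : ℂ) + 2 + 4 = n + 4 + 2 by ring]
    ring

end SLEVir

namespace SLEVir

open PowerSeries (coeff)

/-! ### The explicit commutation relations -/

set_option linter.unusedSimpArgs false

theorem aDeriv_congr {P P' : ℕ → F} (h : ∀ l, 2 ≤ l → P l = P' l) : aDeriv P = aDeriv P' := by
  rw [aDeriv, aDeriv, show (fun l : Idx => P l) = fun l : Idx => P' l from
    funext fun l => h l l.2]

theorem opL0_eq (hx hy : ℂ) : opL0 hx hy = fo zeroD ((hx + hy) • 1) := by
  rw [zeroD, fo_vf, opL0]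
  congr 1
  refine LinearMap.ext fun f => ?_
  simp

theorem opL1_eq : opL1 = fo (posD 1) 0 := by
  rw [posD, fo_vf, opL1, if_pos rfl, aDeriv_congr (P' := fun l : ℕ => if 1 ≤ l then
    ((l : ℂ) - (1 : ℕ) - 1) • coeff (l - 1) gser else 0)]
  · refine LinearMap.ext fun f => ?_
    simp
  · intro l hl
    rw [if_pos (by omega), coeff_gser (by omega)]
    congr 1
    push_cast; ring

theorem opL2_eq : opL2 = fo (posD 2) 0 := by
  rw [posD, fo_vf, opL2, if_neg (by omega), aDeriv_congr (P' := fun l : ℕ => if 2 ≤ l then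
    ((l : ℂ) - (2 : ℕ) - 1) • coeff (l - 2) gser else 0)]
  · refine LinearMap.ext fun f => ?_
    simp
  · intro l hl
    rw [if_pos hl]
    split_ifs with h
    · subst h
      rw [coeff_zero_gser]
      push_cast
      rw [show (2 : ℂ) - 2 - 1 = -1 by norm_num, neg_one_smul]
    · rw [coeff_gser (by omega)]
      congr 1
      push_cast; ring

theorem opLm1_eq (hx hy : ℂ) : opLm1 hx hy = fo negOneD ((2 * hx) • xF + (2 * hy) • yF) := rfl

theorem opLm2_eq (c hx hy : ℂ) : opLm2 c hx hy = fo negTwoD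
    (hx • (3 * xF ^ 2 - 4 * a 2) + hy • (3 * yF ^ 2 - 4 * a 2) - (c / 2) • a 2) := rfl

theorem fo_congr {D E : Derivation ℂ F F} {s r : F} (h : D = E) (h' : s = r) :
    fo D s = fo E r := by rw [h, h']

theorem _root_.Derivation.map_ofNat {R A : Type*} [CommRing R] [CommRing A] [Algebra R A]
    (D : Derivation R A A) (n : ℕ) [n.AtLeastTwo] : D (ofNat(n) : A) = 0 := by
  rw [← Nat.cast_ofNat (R := A), D.map_natCast]

theorem ofNat_smul {A : Type*} [CommRing A] [Algebra ℂ A] (n : ℕ) [n.AtLeastTwo] (f : A) :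
    (ofNat(n) : ℂ) • f = ofNat(n) * f := by
  rw [Algebra.smul_def, _root_.map_ofNat]

theorem X_pow_mul_cancel (n : ℕ) {f g : PowerSeries F}
    (h : PowerSeries.X ^ n * f = PowerSeries.X ^ n * g) : f = g := by
  ext1 k
  have := congrArg (coeff (k + n)) h
  rwa [PowerSeries.coeff_X_pow_mul, PowerSeries.coeff_X_pow_mul] at this

section Values

@[simp] theorem posD_xF (n : ℕ) : posD n xF = if n = 1 then 1 else 0 := vf_xF _ _ _

@[simp] theorem posD_yF (n : ℕ) : posD n yF = if n = 1 then 1 else 0 := vf_yF _ _ _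

@[simp] theorem zeroD_xF : zeroD xF = xF := vf_xF _ _ _

@[simp] theorem zeroD_yF : zeroD yF = yF := vf_yF _ _ _

@[simp] theorem negOneD_xF : negOneD xF = xF ^ 2 - 3 * a 2 := vf_xF _ _ _

@[simp] theorem negOneD_yF : negOneD yF = yF ^ 2 - 3 * a 2 := vf_yF _ _ _

@[simp] theorem negTwoD_xF : negTwoD xF = xF ^ 3 - 4 * xF * a 2 - 5 * a 3 := vf_xF _ _ _

@[simp] theorem negTwoD_yF : negTwoD yF = yF ^ 3 - 4 * yF * a 2 - 5 * a 3 := vf_yF _ _ _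

theorem posD_a (n : ℕ) {l : ℕ} (hl : 2 ≤ l) :
    posD n (a l) = if n ≤ l then ((l : ℂ) - n - 1) • coeff (l - n) gser else 0 := vf_a _ _ _ hl

theorem zeroD_a (l : ℕ) : zeroD (a l) = (l : ℂ) • a l := by
  by_cases hl : 2 ≤ l
  · exact vf_a _ _ _ hl
  · rw [a, dif_neg hl]; simp

@[simp] theorem posD_one_a_two : posD 1 (a 2) = 0 := by
  rw [posD_a 1 le_rfl, if_pos (by omega)]
  norm_num

@[simp] theorem posD_one_a_three : posD 1 (a 3) = a 2 := by
  rw [posD_a 1 (by omega), if_pos (by omega), show 3 - 1 = 2 from rfl, coeff_gser (by omega)]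
  norm_num

@[simp] theorem posD_two_a_two : posD 2 (a 2) = -1 := by
  rw [posD_a 2 le_rfl, if_pos (by omega), Nat.sub_self, coeff_zero_gser]
  push_cast
  rw [show (2 : ℂ) - 2 - 1 = -1 by norm_num, neg_one_smul]

@[simp] theorem posD_two_a_three : posD 2 (a 3) = 0 := by
  rw [posD_a 2 (by omega), if_pos (by omega)]
  norm_num

end Values

theorem isVectorField_posD (n : ℕ) : IsVectorField (posD n) := isVectorField_vf _ _ _

theorem isVectorField_zeroD : IsVectorField zeroD := isVectorField_vf _ _ _

theorem isVectorField_negOneD : IsVectorField negOneD := isVectorField_vf _ _ _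

theorem isVectorField_negTwoD : IsVectorField negTwoD := isVectorField_vf _ _ _

theorem lie_posD {m n : ℕ} (hm : 1 ≤ m) (hn : 1 ≤ n) :
    ⁅posD m, posD n⁆ = ((m : ℂ) - n) • posD (m + n) := by
  have h1 : ∀ m n : ℕ, 1 ≤ m → 1 ≤ n → coeffwise (posD m) (coeffwise (posD n) gser) =
      PowerSeries.X ^ (m + n) *
        (theta (theta gser - gser) + ((m : ℂ) - 1) • (theta gser - gser)) := by
    intro m n hm hn
    have hX : theta (PowerSeries.X ^ m : PowerSeries F) = (m : ℂ) • PowerSeries.X ^ m := by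
      ext1 k
      rw [coeff_theta, PowerSeries.coeff_smul, PowerSeries.coeff_X_pow]
      split_ifs with h
      · rw [h]
      · simp
    have hXn : coeffwise (posD m) (PowerSeries.X ^ n) = 0 := by
      rw [Derivation.leibniz_pow]; simp
    have h2 : coeffwise (posD m) (if n = 1 then PowerSeries.X else 0) = 0 := by
      split_ifs <;> simp
    have h3 : theta (if m = 1 then PowerSeries.X else 0 : PowerSeries F) =
        if m = 1 then PowerSeries.X else 0 := by
      split_ifs <;> simp [theta_X]
    rw [posD_gser hn, map_add, h2, add_zero, Derivation.leibniz, hXn, smul_zero, add_zero, map_sub,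
      coeffwise_theta, posD_gser hm, map_add, h3, Derivation.leibniz, hX]
    simp only [smul_eq_mul, Algebra.smul_def, map_sub, map_one, pow_add]
    ring
  refine ((isVectorField_posD m).lie (isVectorField_posD n)).ext_gser
    ((isVectorField_posD _).csmul _) ?_ ?_ ?_
  · rw [Derivation.commutator_apply, Derivation.smul_apply, posD_xF, posD_xF, posD_xF,
      if_neg (show ¬m + n = 1 by omega)]
    split_ifs <;> simp
  · rw [Derivation.commutator_apply, Derivation.smul_apply, posD_yF, posD_yF, posD_yF,
      if_neg (show ¬m + n = 1 by omega)]
    split_ifs <;> simp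
  · rw [coeffwise_lie, h1 m n hm hn, h1 n m hn hm, coeffwise_smul, posD_gser (by omega),
      if_neg (by omega), add_comm n m]
    simp only [Algebra.smul_def, map_sub, map_one]
    ring

theorem coeffwise_X_mul (D : Derivation ℂ F F) (f : PowerSeries F) :
    coeffwise D (PowerSeries.X * f) = PowerSeries.X * coeffwise D f := by
  rw [Derivation.leibniz, coeffwise_X, smul_zero, add_zero, smul_eq_mul]

theorem coeffwise_X_sq_mul (D : Derivation ℂ F F) (f : PowerSeries F) :
    coeffwise D (PowerSeries.X ^ 2 * f) = PowerSeries.X ^ 2 * coeffwise D f := by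
  rw [pow_two, mul_assoc, coeffwise_X_mul, coeffwise_X_mul, mul_assoc]

theorem theta_X_mul (f : PowerSeries F) :
    theta (PowerSeries.X * f) = PowerSeries.X * theta f + PowerSeries.X * f := by
  rw [Derivation.leibniz, theta_X, smul_eq_mul, smul_eq_mul, mul_comm f]

theorem theta_X_sq_mul (f : PowerSeries F) :
    theta (PowerSeries.X ^ 2 * f) = PowerSeries.X ^ 2 * theta f + 2 * PowerSeries.X ^ 2 * f := by
  rw [pow_two, mul_assoc, theta_X_mul, theta_X_mul]; ring

theorem lie_zeroD_posD {n : ℕ} (hn : 1 ≤ n) : ⁅zeroD, posD n⁆ = (-(n : ℂ)) • posD n := by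
  refine (isVectorField_zeroD.lie (isVectorField_posD n)).ext_gser
    ((isVectorField_posD _).csmul _) ?_ ?_ ?_
  · rw [Derivation.commutator_apply, Derivation.smul_apply, zeroD_xF, posD_xF]
    split_ifs with h <;> simp [h]
  · rw [Derivation.commutator_apply, Derivation.smul_apply, zeroD_yF, posD_yF]
    split_ifs with h <;> simp [h]
  · have hX : theta (PowerSeries.X ^ n : PowerSeries F) = (n : ℂ) • PowerSeries.X ^ n := by
      ext1 k
      rw [coeff_theta, PowerSeries.coeff_smul, PowerSeries.coeff_X_pow]
      split_ifs with h
      · rw [h]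
      · simp
    have hXn : coeffwise zeroD (PowerSeries.X ^ n) = 0 := by
      rw [Derivation.leibniz_pow]; simp
    have h2 : coeffwise zeroD (if n = 1 then PowerSeries.X else 0) = 0 := by
      split_ifs <;> simp
    rw [coeffwise_lie, zeroD_gser, coeffwise_theta, coeffwise_smul, posD_gser hn, map_add, h2,
      map_add, Derivation.leibniz, Derivation.leibniz, hXn, hX, map_sub (coeffwise zeroD),
      coeffwise_theta, zeroD_gser]
    simp only [smul_eq_mul, Algebra.smul_def, map_neg, map_sub]
    split_ifs with h
    · subst h
      rw [theta_X]
      simp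
      ring
    · simp
      ring

theorem lie_zeroD_negOneD : ⁅zeroD, negOneD⁆ = negOneD := by
  refine (isVectorField_zeroD.lie isVectorField_negOneD).ext_gser isVectorField_negOneD ?_ ?_ ?_
  · simp only [Derivation.commutator_apply, Derivation.smul_apply, map_sub, map_neg, map_one,
      map_zero,
      Derivation.leibniz, Derivation.leibniz_pow, Derivation.map_ofNat, zeroD_xF, negOneD_xF,
      zeroD_a,
      smul_eq_mul, nsmul_eq_mul, smul_zero, mul_zero, add_zero, Nat.cast_ofNat, ofNat_smul]
    ring
  · simp only [Derivation.commutator_apply, Derivation.smul_apply, map_sub, map_neg, map_one,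
      map_zero,
      Derivation.leibniz, Derivation.leibniz_pow, Derivation.map_ofNat, zeroD_yF, negOneD_yF,
      zeroD_a,
      smul_eq_mul, nsmul_eq_mul, smul_zero, mul_zero, add_zero, Nat.cast_ofNat, ofNat_smul]
    ring
  · refine X_pow_mul_cancel 1 ?_
    have h := negOneD_gser
    have h1 := congrArg (coeffwise zeroD) h
    have h2 := congrArg theta h
    rw [coeffwise_X_mul] at h1
    rw [theta_X_mul] at h2
    simp only [map_sub, map_add, Derivation.leibniz, Derivation.leibniz_pow, Derivation.map_ofNat,
      coeffwise_X, coeffwise_C, theta_X, theta_C, coeffwise_theta, zeroD_a, zeroD_gser,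
      smul_eq_mul, nsmul_eq_mul, smul_zero, mul_zero, add_zero, zero_add, Nat.cast_ofNat,
      ofNat_smul, map_mul, _root_.map_ofNat, map_neg, map_one, map_zero] at h1 h2
    rw [coeffwise_lie, zeroD_gser, coeffwise_theta]
    linear_combination h1 - h2

theorem lie_zeroD_negTwoD : ⁅zeroD, negTwoD⁆ = (2 : ℂ) • negTwoD := by
  refine (isVectorField_zeroD.lie isVectorField_negTwoD).ext_gser
    (isVectorField_negTwoD.csmul _) ?_ ?_ ?_
  · simp only [Derivation.commutator_apply, Derivation.smul_apply, map_sub, map_neg, map_one,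
      map_zero,
      Derivation.leibniz, Derivation.leibniz_pow, Derivation.map_ofNat, zeroD_xF, negTwoD_xF,
      zeroD_a,
      smul_eq_mul, nsmul_eq_mul, smul_zero, mul_zero, add_zero, Nat.cast_ofNat, ofNat_smul]
    ring
  · simp only [Derivation.commutator_apply, Derivation.smul_apply, map_sub, map_neg, map_one,
      map_zero,
      Derivation.leibniz, Derivation.leibniz_pow, Derivation.map_ofNat, zeroD_yF, negTwoD_yF,
      zeroD_a,
      smul_eq_mul, nsmul_eq_mul, smul_zero, mul_zero, add_zero, Nat.cast_ofNat, ofNat_smul]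
    ring
  · refine X_pow_mul_cancel 2 ?_
    have h := negTwoD_gser
    have h1 := congrArg (coeffwise zeroD) h
    have h2 := congrArg theta h
    rw [coeffwise_X_sq_mul] at h1
    rw [theta_X_sq_mul] at h2
    simp only [map_sub, map_add, Derivation.leibniz, Derivation.leibniz_pow, Derivation.map_ofNat,
      coeffwise_X, coeffwise_C, theta_X, theta_C, coeffwise_theta, zeroD_a, zeroD_gser,
      smul_eq_mul, nsmul_eq_mul, smul_zero, mul_zero, add_zero, zero_add, Nat.cast_ofNat,
      ofNat_smul, map_mul, _root_.map_ofNat, map_neg, map_one, map_zero] at h1 h2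
    rw [coeffwise_lie, zeroD_gser, coeffwise_theta, coeffwise_smul, ofNat_smul]
    linear_combination h1 - h2

theorem lie_posD_one_negOneD : ⁅posD 1, negOneD⁆ = (2 : ℂ) • zeroD := by
  refine ((isVectorField_posD 1).lie isVectorField_negOneD).ext_gser
    (isVectorField_zeroD.csmul _) ?_ ?_ ?_
  · simp only [Derivation.commutator_apply, Derivation.smul_apply, map_sub, map_neg, map_one,
      Derivation.map_one_eq_zero, map_zero,
      Derivation.leibniz, Derivation.leibniz_pow, Derivation.map_ofNat, posD_xF, negOneD_xF,
      zeroD_xF, posD_one_a_two, posD_one_a_three, one_ne_zero,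
      OfNat.ofNat_ne_one, if_true, if_false,
      smul_eq_mul, nsmul_eq_mul, smul_zero, mul_zero, add_zero, Nat.cast_ofNat, ofNat_smul]
    ring
  · simp only [Derivation.commutator_apply, Derivation.smul_apply, map_sub, map_neg, map_one,
      Derivation.map_one_eq_zero, map_zero,
      Derivation.leibniz, Derivation.leibniz_pow, Derivation.map_ofNat, posD_yF, negOneD_yF,
      zeroD_yF, posD_one_a_two, posD_one_a_three, one_ne_zero,
      OfNat.ofNat_ne_one, if_true, if_false,
      smul_eq_mul, nsmul_eq_mul, smul_zero, mul_zero, add_zero, Nat.cast_ofNat, ofNat_smul]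
    ring
  · refine X_pow_mul_cancel 1 ?_
    have h := negOneD_gser
    have hp := posD_gser (n := 1) (by omega)
    have h1 := congrArg (coeffwise (posD 1)) h
    have h2 := congrArg theta h
    have h3 := congrArg (coeffwise negOneD) hp
    have h4 := congrArg theta hp
    rw [coeffwise_X_mul] at h1
    rw [theta_X_mul] at h2
    simp only [OfNat.ofNat_ne_one, if_true, if_false] at hp h3 h4
    simp only [map_sub, map_add, Derivation.leibniz, Derivation.leibniz_pow, Derivation.map_ofNat,
      coeffwise_X, coeffwise_C, theta_X, theta_C, coeffwise_theta, posD_one_a_two, posD_one_a_three,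
      smul_eq_mul, nsmul_eq_mul, smul_zero, mul_zero, add_zero, zero_add, Nat.cast_ofNat,
      ofNat_smul, map_mul, _root_.map_ofNat, map_neg, map_one, Derivation.map_one_eq_zero, pow_one,
      Nat.cast_one, one_smul, map_zero] at hp h1 h2 h3 h4
    rw [coeffwise_lie, h3, coeffwise_smul, zeroD_gser, ofNat_smul]
    linear_combination h1 + h4 + (2 * gser - 1) * hp - PowerSeries.X * h2 + 2 * PowerSeries.X * h

theorem lie_posD_two_negOneD : ⁅posD 2, negOneD⁆ = (3 : ℂ) • posD 1 := by
  refine ((isVectorField_posD 2).lie isVectorField_negOneD).ext_gser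
    ((isVectorField_posD 1).csmul _) ?_ ?_ ?_
  · simp only [Derivation.commutator_apply, Derivation.smul_apply, map_sub, map_neg, map_one,
      Derivation.map_one_eq_zero, map_zero,
      Derivation.leibniz, Derivation.leibniz_pow, Derivation.map_ofNat, posD_xF, negOneD_xF,
      posD_two_a_two, posD_two_a_three, one_ne_zero,
      OfNat.ofNat_ne_one, if_true, if_false,
      smul_eq_mul, nsmul_eq_mul, smul_zero, mul_zero, add_zero, Nat.cast_ofNat, ofNat_smul]
    ring
  · simp only [Derivation.commutator_apply, Derivation.smul_apply, map_sub, map_neg, map_one,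
      Derivation.map_one_eq_zero, map_zero,
      Derivation.leibniz, Derivation.leibniz_pow, Derivation.map_ofNat, posD_yF, negOneD_yF,
      posD_two_a_two, posD_two_a_three, one_ne_zero,
      OfNat.ofNat_ne_one, if_true, if_false,
      smul_eq_mul, nsmul_eq_mul, smul_zero, mul_zero, add_zero, Nat.cast_ofNat, ofNat_smul]
    ring
  · refine X_pow_mul_cancel 1 ?_
    have h := negOneD_gser
    have hp := posD_gser (n := 2) (by omega)
    have h1 := congrArg (coeffwise (posD 2)) h
    have h2 := congrArg theta h
    have h3 := congrArg (coeffwise negOneD) hp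
    have h4 := congrArg theta hp
    rw [coeffwise_X_mul] at h1
    rw [theta_X_mul] at h2
    simp only [OfNat.ofNat_ne_one, if_true, if_false] at hp h3 h4
    simp only [map_sub, map_add, Derivation.leibniz, Derivation.leibniz_pow, Derivation.map_ofNat,
      coeffwise_X, coeffwise_C, theta_X, theta_C, coeffwise_theta, posD_two_a_two, posD_two_a_three,
      smul_eq_mul, nsmul_eq_mul, smul_zero, mul_zero, add_zero, zero_add, Nat.cast_ofNat,
      ofNat_smul, map_mul, _root_.map_ofNat, map_neg, map_one, Derivation.map_one_eq_zero, pow_one,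
      Nat.cast_one, one_smul, map_zero] at hp h1 h2 h3 h4
    rw [coeffwise_lie, h3, coeffwise_smul, posD_gser le_rfl, if_pos rfl, ofNat_smul]
    linear_combination h1 + h4 + (2 * gser - 1) * hp - PowerSeries.X ^ 2 * h2 +
      2 * PowerSeries.X ^ 2 * h

theorem lie_posD_one_negTwoD : ⁅posD 1, negTwoD⁆ = (3 : ℂ) • negOneD := by
  refine ((isVectorField_posD 1).lie isVectorField_negTwoD).ext_gser
    (isVectorField_negOneD.csmul _) ?_ ?_ ?_
  · simp only [Derivation.commutator_apply, Derivation.smul_apply, map_sub, map_neg, map_one,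
      Derivation.map_one_eq_zero, map_zero,
      Derivation.leibniz, Derivation.leibniz_pow, Derivation.map_ofNat, posD_xF, negTwoD_xF,
      negOneD_xF, posD_one_a_two, posD_one_a_three, one_ne_zero,
      OfNat.ofNat_ne_one, if_true, if_false,
      smul_eq_mul, nsmul_eq_mul, smul_zero, mul_zero, add_zero, Nat.cast_ofNat, ofNat_smul]
    ring
  · simp only [Derivation.commutator_apply, Derivation.smul_apply, map_sub, map_neg, map_one,
      Derivation.map_one_eq_zero, map_zero,
      Derivation.leibniz, Derivation.leibniz_pow, Derivation.map_ofNat, posD_yF, negTwoD_yF,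
      negOneD_yF, posD_one_a_two, posD_one_a_three, one_ne_zero,
      OfNat.ofNat_ne_one, if_true, if_false,
      smul_eq_mul, nsmul_eq_mul, smul_zero, mul_zero, add_zero, Nat.cast_ofNat, ofNat_smul]
    ring
  · refine X_pow_mul_cancel 2 ?_
    have h := negTwoD_gser
    have hp := posD_gser (n := 1) (by omega)
    have h1 := congrArg (coeffwise (posD 1)) h
    have h2 := congrArg theta h
    have h3 := congrArg (coeffwise negTwoD) hp
    have h4 := congrArg theta hp
    rw [coeffwise_X_sq_mul] at h1
    rw [theta_X_sq_mul] at h2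
    simp only [OfNat.ofNat_ne_one, if_true, if_false] at hp h3 h4
    simp only [map_sub, map_add, Derivation.leibniz, Derivation.leibniz_pow, Derivation.map_ofNat,
      coeffwise_X, coeffwise_C, theta_X, theta_C, coeffwise_theta, posD_one_a_two, posD_one_a_three,
      smul_eq_mul, nsmul_eq_mul, smul_zero, mul_zero, add_zero, zero_add, Nat.cast_ofNat,
      ofNat_smul, map_mul, _root_.map_ofNat, map_neg, map_one, Derivation.map_one_eq_zero, pow_one,
      Nat.cast_one, one_smul, map_zero] at hp h1 h2 h3 h4
    have h5 := negOneD_gser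
    rw [coeffwise_lie, h3, coeffwise_smul, ofNat_smul]
    linear_combination h1 + h4 +
      (3 * gser ^ 2 - 1 - 4 * PowerSeries.C (a 2) * PowerSeries.X ^ 2) * hp -
      PowerSeries.X * h2 + 3 * PowerSeries.X * h - 3 * PowerSeries.X * h5

theorem lie_posD_two_negTwoD : ⁅posD 2, negTwoD⁆ = (4 : ℂ) • zeroD := by
  refine ((isVectorField_posD 2).lie isVectorField_negTwoD).ext_gser
    (isVectorField_zeroD.csmul _) ?_ ?_ ?_
  · simp only [Derivation.commutator_apply, Derivation.smul_apply, map_sub, map_neg, map_one,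
      Derivation.map_one_eq_zero, map_zero,
      Derivation.leibniz, Derivation.leibniz_pow, Derivation.map_ofNat, posD_xF, negTwoD_xF,
      zeroD_xF, posD_two_a_two, posD_two_a_three, one_ne_zero,
      OfNat.ofNat_ne_one, if_true, if_false,
      smul_eq_mul, nsmul_eq_mul, smul_zero, mul_zero, add_zero, Nat.cast_ofNat, ofNat_smul]
    ring
  · simp only [Derivation.commutator_apply, Derivation.smul_apply, map_sub, map_neg, map_one,
      Derivation.map_one_eq_zero, map_zero,
      Derivation.leibniz, Derivation.leibniz_pow, Derivation.map_ofNat, posD_yF, negTwoD_yF,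
      zeroD_yF, posD_two_a_two, posD_two_a_three, one_ne_zero,
      OfNat.ofNat_ne_one, if_true, if_false,
      smul_eq_mul, nsmul_eq_mul, smul_zero, mul_zero, add_zero, Nat.cast_ofNat, ofNat_smul]
    ring
  · refine X_pow_mul_cancel 2 ?_
    have h := negTwoD_gser
    have hp := posD_gser (n := 2) (by omega)
    have h1 := congrArg (coeffwise (posD 2)) h
    have h2 := congrArg theta h
    have h3 := congrArg (coeffwise negTwoD) hp
    have h4 := congrArg theta hp
    rw [coeffwise_X_sq_mul] at h1
    rw [theta_X_sq_mul] at h2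
    simp only [OfNat.ofNat_ne_one, if_true, if_false] at hp h3 h4
    simp only [map_sub, map_add, Derivation.leibniz, Derivation.leibniz_pow, Derivation.map_ofNat,
      coeffwise_X, coeffwise_C, theta_X, theta_C, coeffwise_theta, posD_two_a_two, posD_two_a_three,
      smul_eq_mul, nsmul_eq_mul, smul_zero, mul_zero, add_zero, zero_add, Nat.cast_ofNat,
      ofNat_smul, map_mul, _root_.map_ofNat, map_neg, map_one, Derivation.map_one_eq_zero, pow_one,
      Nat.cast_one, one_smul, map_zero] at hp h1 h2 h3 h4
    rw [coeffwise_lie, h3, coeffwise_smul, zeroD_gser, ofNat_smul]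
    linear_combination h1 + h4 +
      (3 * gser ^ 2 - 1 - 4 * PowerSeries.C (a 2) * PowerSeries.X ^ 2) * hp -
      PowerSeries.X ^ 2 * h2 + 3 * PowerSeries.X ^ 2 * h

end SLEVir

namespace SLEVir

/-! ### The Virasoro relations follow from finitely many of them -/

section Relations

variable {E : Type*} [Ring E] [Algebra ℂ E]

/-- The central term in the Virasoro relation. -/
def central (c : ℂ) (m n : ℤ) : ℂ := if m + n = 0 then ((m : ℂ) ^ 3 - m) / 12 * c else 0

/-- The Virasoro relation between `T m` and `T n`. -/
def Rel (T : ℤ → E) (c : ℂ) (m n : ℤ) : Prop :=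
  T m * T n - T n * T m = ((m : ℂ) - n) • T (m + n) + central c m n • 1

theorem central_of_ne (c : ℂ) {m n : ℤ} (h : m + n ≠ 0) : central c m n = 0 := if_neg h

theorem central_symm (c : ℂ) (m n : ℤ) : central c n m = -central c m n := by
  rw [central, central, add_comm n m]
  split_ifs with h
  · rw [show m = -n by omega]; push_cast; ring
  · simp

variable {T : ℤ → E} {c : ℂ}

theorem Rel.symm {m n : ℤ} (h : Rel T c m n) : Rel T c n m := by
  unfold Rel at h ⊢
  rw [← neg_sub, h, central_symm, add_comm n m]
  module

theorem Rel.refl (m : ℤ) : Rel T c m m := by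
  unfold Rel
  have : central c m m = 0 := by
    rw [central]
    split_ifs with h
    · rw [show m = 0 by omega]; simp
    · rfl
  rw [this]; simp

/-- Jacobi's identity for `T p`, `T q`, `T r`, with the inner brackets replaced by their values. -/
theorem Rel.jacobi_aux {p q r : ℤ} (hpq : Rel T c p q) (hpr : Rel T c p r)
    (h1 : Rel T c (p + q) r) (h2 : Rel T c q (p + r)) :
    T p * (T q * T r - T r * T q) - (T q * T r - T r * T q) * T p =
      (((p : ℂ) - q) * (p + q - r) + ((p : ℂ) - r) * (q - p - r)) • T (p + q + r) +
      (((p : ℂ) - q) * central c (p + q) r + ((p : ℂ) - r) * central c q (p + r)) • 1 := by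
  have h : T p * (T q * T r - T r * T q) - (T q * T r - T r * T q) * T p =
      (T p * T q - T q * T p) * T r - T r * (T p * T q - T q * T p) +
      (T q * (T p * T r - T r * T p) - (T p * T r - T r * T p) * T q) := by noncomm_ring
  unfold Rel at hpq hpr h1 h2
  have e1 : (T p * T q - T q * T p) * T r - T r * (T p * T q - T q * T p) =
      ((p : ℂ) - q) • (T (p + q) * T r - T r * T (p + q)) := by
    rw [hpq]
    simp only [add_mul, mul_add, smul_mul_assoc, mul_smul_comm, one_mul, mul_one, smul_sub]
    abel
  have e2 : T q * (T p * T r - T r * T p) - (T p * T r - T r * T p) * T q =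
      ((p : ℂ) - r) • (T q * T (p + r) - T (p + r) * T q) := by
    rw [hpr]
    simp only [add_mul, mul_add, smul_mul_assoc, mul_smul_comm, one_mul, mul_one, smul_sub]
    abel
  rw [h, e1, e2, h1, h2, show q + (p + r) = p + q + r by ring]
  push_cast
  module

theorem Rel.jacobi {p q r : ℤ} (hne : q ≠ r) (hqr0 : q + r ≠ 0) (hqr : Rel T c q r)
    (hpq : Rel T c p q) (hpr : Rel T c p r) (h1 : Rel T c (p + q) r) (h2 : Rel T c q (p + r)) :
    Rel T c p (q + r) := by
  have h := Rel.jacobi_aux hpq hpr h1 h2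
  have hne' : (q : ℂ) - r ≠ 0 := by
    rw [sub_ne_zero]; exact_mod_cast hne
  have e : T q * T r - T r * T q = ((q : ℂ) - r) • T (q + r) := by
    rw [hqr, central_of_ne c hqr0, zero_smul, add_zero]
  rw [e, mul_smul_comm, smul_mul_assoc, ← smul_sub] at h
  have hc : ((p : ℂ) - q) * central c (p + q) r + ((p : ℂ) - r) * central c q (p + r) =
      ((q : ℂ) - r) * central c p (q + r) := by
    simp only [central]
    by_cases h0 : p + q + r = 0
    · rw [if_pos h0, if_pos (show q + (p + r) = 0 by omega), if_pos (show p + (q + r) = 0 by omega),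
        show p = -q - r by omega]
      push_cast; ring
    · rw [if_neg h0, if_neg (show ¬q + (p + r) = 0 by omega),
        if_neg (show ¬p + (q + r) = 0 by omega)]
      ring
  unfold Rel
  apply smul_right_injective E hne'
  change ((q : ℂ) - r) • _ = ((q : ℂ) - r) • _
  rw [h, hc, ← add_assoc]
  push_cast
  module

theorem Rel.defect_commute {p q r : ℤ} (hne : p + q + r ≠ 0) (hpq : Rel T c p q)
    (hpr : Rel T c p r) (h1 : Rel T c (p + q) r) (h2 : Rel T c q (p + r))
    (h3 : Rel T c p (q + r)) :
    Commute (T p) (T q * T r - T r * T q - ((q : ℂ) - r) • T (q + r)) := by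
  have h := Rel.jacobi_aux hpq hpr h1 h2
  unfold Rel at h3
  rw [central_of_ne c (show p + (q + r) ≠ 0 by omega)] at h3
  rw [central_of_ne c hne, central_of_ne c (show q + (p + r) ≠ 0 by omega)] at h
  rw [commute_iff_eq, ← sub_eq_zero]
  have e : T p * (T q * T r - T r * T q - ((q : ℂ) - r) • T (q + r)) -
      (T q * T r - T r * T q - ((q : ℂ) - r) • T (q + r)) * T p =
      (T p * (T q * T r - T r * T q) - (T q * T r - T r * T q) * T p) -
      ((q : ℂ) - r) • (T p * T (q + r) - T (q + r) * T p) := by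
    simp only [mul_sub, sub_mul, mul_smul_comm, smul_mul_assoc, smul_sub]
    abel
  rw [e, h, h3, ← add_assoc]
  push_cast
  module

theorem Rel.zero_defect {q r : ℤ} (hq : Rel T c 0 q) (hr : Rel T c 0 r)
    (hqr : Rel T c 0 (q + r)) (hq0 : q ≠ 0) (hr0 : r ≠ 0) (h0 : q + r ≠ 0) :
    T 0 * (T q * T r - T r * T q - ((q : ℂ) - r) • T (q + r)) -
      (T q * T r - T r * T q - ((q : ℂ) - r) • T (q + r)) * T 0 =
      (-((q : ℂ) + r)) • (T q * T r - T r * T q - ((q : ℂ) - r) • T (q + r)) := by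
  unfold Rel at hq hr hqr
  rw [central_of_ne c (by simpa using hq0), zero_smul, add_zero, zero_add] at hq
  rw [central_of_ne c (by simpa using hr0), zero_smul, add_zero, zero_add] at hr
  rw [central_of_ne c (by simpa using h0), zero_smul, add_zero, zero_add] at hqr
  have e : T 0 * (T q * T r - T r * T q - ((q : ℂ) - r) • T (q + r)) -
      (T q * T r - T r * T q - ((q : ℂ) - r) • T (q + r)) * T 0 =
      (T 0 * T q - T q * T 0) * T r + T q * (T 0 * T r - T r * T 0) -
      (T 0 * T r - T r * T 0) * T q - T r * (T 0 * T q - T q * T 0) -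
      ((q : ℂ) - r) • (T 0 * T (q + r) - T (q + r) * T 0) := by
    simp only [mul_sub, sub_mul, mul_smul_comm, smul_mul_assoc, smul_sub, mul_assoc]
    abel
  rw [e, hq, hr, hqr]
  simp only [smul_mul_assoc, mul_smul_comm]
  push_cast
  module

/-- All Virasoro relations follow from those between `T n` with `n ≥ 0`, the four relations
between `T 1`, `T 2` and `T (-1)`, `T (-2)`, and the recursion for `T (-n)`, provided that the
defect of a relation between `T (-m)` and `T (-n)`, `m, n ≥ 2`, vanishes as soon as it commutes with
`T 1` and `T 2` and is homogeneous of degree `m + n`. -/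
theorem Rel.of_generators (hpos : ∀ m n : ℤ, 0 < m → 0 < n → Rel T c m n)
    (hzpos : ∀ n : ℤ, 0 < n → Rel T c 0 n) (hz1 : Rel T c 0 (-1)) (hz2 : Rel T c 0 (-2))
    (h11 : Rel T c 1 (-1)) (h21 : Rel T c 2 (-1)) (h12 : Rel T c 1 (-2)) (h22 : Rel T c 2 (-2))
    (hneg : ∀ n : ℤ, 2 ≤ n → Rel T c (-1) (-n))
    (huniq : ∀ m n : ℤ, 2 ≤ m → 2 ≤ n → ∀ Y : E,
      Y = T (-m) * T (-n) - T (-n) * T (-m) - ((-m : ℂ) - -n) • T (-m + -n) →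
      Commute (T 1) Y → Commute (T 2) Y → T 0 * Y - Y * T 0 = ((m : ℂ) + n) • Y → Y = 0)
    (m n : ℤ) : Rel T c m n := by
  have hzneg : ∀ k : ℕ, Rel T c 0 (-((k : ℤ) + 2)) := by
    intro k
    induction k with
    | zero => exact hz2
    | succ k ih =>
      have := Rel.jacobi (p := 0) (q := -1) (r := -((k : ℤ) + 2)) (by omega) (by omega)
        (hneg ((k : ℤ) + 2) (by omega)) hz1 ih (by simpa using hneg ((k : ℤ) + 2) (by omega))
        (by simpa using hneg ((k : ℤ) + 2) (by omega))
      rwa [show -1 + -((k : ℤ) + 2) = -(((k + 1 : ℕ) : ℤ) + 2) by push_cast; ring] at this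
  have hz : ∀ n : ℤ, Rel T c 0 n := by
    intro n
    rcases lt_trichotomy n 0 with h | rfl | h
    · by_cases h1 : n = -1
      · exact h1 ▸ hz1
      · obtain ⟨k, rfl⟩ : ∃ k : ℕ, n = -((k : ℤ) + 2) := ⟨(-n - 2).toNat, by omega⟩
        exact hzneg k
    · exact Rel.refl 0
    · exact hzpos n h
  have hm1' : ∀ k : ℕ, Rel T c (-1) ((k : ℤ) + 2) := by
    intro k
    induction k with
    | zero => exact h21.symm
    | succ k ih =>
      have := Rel.jacobi (p := -1) (q := (k : ℤ) + 2) (r := 1) (by omega) (by omega)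
        (hpos _ _ (by omega) (by omega)) ih h11.symm (hpos _ _ (by omega) (by omega))
        (by simpa using (hz _).symm)
      rwa [show (k : ℤ) + 2 + 1 = ((k + 1 : ℕ) : ℤ) + 2 by push_cast; ring] at this
  have hm1 : ∀ m : ℤ, Rel T c (-1) m := by
    intro m
    rcases lt_trichotomy m 0 with h | rfl | h
    · by_cases h1 : m = -1
      · exact h1 ▸ Rel.refl _
      · have := hneg (-m) (by omega)
        rwa [neg_neg] at this
    · exact (hz _).symm
    · by_cases h1 : m = 1
      · exact h1 ▸ h11.symm
      · obtain ⟨k, rfl⟩ : ∃ k : ℕ, m = (k : ℤ) + 2 := ⟨(m - 2).toNat, by omega⟩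
        exact hm1' k
  have hm2 : ∀ k : ℕ, Rel T c (-2) ((k : ℤ) + 2) := by
    intro k
    induction k with
    | zero => exact h22.symm
    | succ k ih =>
      have h0 : Rel T c (-2 + ((k : ℤ) + 2)) 1 := by
        rcases Nat.eq_zero_or_pos k with rfl | hk
        · simpa using hz 1
        · exact hpos _ _ (by omega) (by omega)
      have := Rel.jacobi (p := -2) (q := (k : ℤ) + 2) (r := 1) (by omega) (by omega)
        (hpos _ _ (by omega) (by omega)) ih h12.symm h0 (by simpa using (hm1 _).symm)
      rwa [show (k : ℤ) + 2 + 1 = ((k + 1 : ℕ) : ℤ) + 2 by push_cast; ring] at this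
  have hmixed' : ∀ k : ℕ, ∀ m : ℤ, 0 ≤ m → Rel T c m (-((k : ℤ) + 2)) := by
    intro k
    induction k with
    | zero =>
      intro m hm
      by_cases h0 : m = 0
      · exact h0 ▸ hz _
      by_cases h1 : m = 1
      · exact h1 ▸ h12
      · obtain ⟨k, rfl⟩ : ∃ k : ℕ, m = (k : ℤ) + 2 := ⟨(m - 2).toNat, by omega⟩
        simpa using (hm2 k).symm
    | succ k ih =>
      intro m hm
      by_cases h0 : m = 0
      · exact h0 ▸ hz _
      have := Rel.jacobi (p := m) (q := -1) (r := -((k : ℤ) + 2)) (by omega) (by omega)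
        (hm1 _) (hm1 _).symm (ih m hm) (ih _ (by omega)) (hm1 _)
      rwa [show -1 + -((k : ℤ) + 2) = -(((k + 1 : ℕ) : ℤ) + 2) by push_cast; ring] at this
  have hmixed : ∀ m n : ℤ, 0 ≤ m → n ≤ 0 → Rel T c m n := by
    intro m n hm hn
    by_cases h0 : n = 0
    · exact h0 ▸ (hz _).symm
    by_cases h1 : n = -1
    · exact h1 ▸ (hm1 _).symm
    · obtain ⟨k, rfl⟩ : ∃ k : ℕ, n = -((k : ℤ) + 2) := ⟨(-n - 2).toNat, by omega⟩
      exact hmixed' k m hm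
  have hnn : ∀ N : ℕ, ∀ m n : ℤ, m ≤ 0 → n ≤ 0 → -m + -n = N → Rel T c m n := by
    intro N
    induction N using Nat.strong_induction_on with
    | _ N ih =>
      intro m n hm hn hN
      by_cases hm0 : m = 0
      · exact hm0 ▸ hz _
      by_cases hn0 : n = 0
      · exact hn0 ▸ (hz _).symm
      by_cases hm1'' : m = -1
      · exact hm1'' ▸ hm1 _
      by_cases hn1 : n = -1
      · exact hn1 ▸ (hm1 _).symm
      have hcomm : ∀ i : ℤ, 1 ≤ i → i ≤ 2 →
          Commute (T i) (T m * T n - T n * T m - ((m : ℂ) - n) • T (m + n)) := by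
        intro i h1 h2
        refine Rel.defect_commute (by omega) (hmixed _ _ (by omega) hm) (hmixed _ _ (by omega) hn)
          (ih (N - i.toNat) (by omega) _ _ (by omega) hn (by omega))
          (ih (N - i.toNat) (by omega) _ _ hm (by omega) (by omega))
          (hmixed _ _ (by omega) (by omega))
      have hz0 := Rel.zero_defect (hz m) (hz n) (hz (m + n)) hm0 hn0 (by omega)
      have := huniq (-m) (-n) (by omega) (by omega)
        (T m * T n - T n * T m - ((m : ℂ) - n) • T (m + n)) (by push_cast; simp only [neg_neg])
        (hcomm 1 (by omega) (by omega)) (hcomm 2 (by omega) (by omega))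
        (by rw [hz0]; push_cast; congr 1; ring)
      unfold Rel
      rw [central_of_ne c (by omega), zero_smul, add_zero]
      exact sub_eq_zero.mp this
  rcases le_or_gt m 0 with hm | hm <;> rcases le_or_gt n 0 with hn | hn
  · exact hnn (-m + -n).toNat m n hm hn (by omega)
  · exact (hmixed n m hn.le hm).symm
  · exact hmixed m n hm.le hn
  · exact hpos m n hm hn

end Relations

end SLEVir

namespace SLEVir

open MvPolynomial (C)

/-! ### Uniqueness of first order operators commuting with `L_1` and `L_2` -/

theorem coeff_eq_zero_of_pderiv {ι A : Type*} [CommRing A] [Algebra ℂ A] {f : MvPolynomial ι A}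
    {i : ι} (h : MvPolynomial.pderiv i f = 0) {d : ι →₀ ℕ} (hi : d i ≠ 0) :
    MvPolynomial.coeff d f = 0 := by
  have h1 := congrArg (MvPolynomial.coeff (d - Finsupp.single i 1)) h
  rw [MvPolynomial.coeff_pderiv, MvPolynomial.coeff_zero] at h1
  have hle : Finsupp.single i 1 ≤ d := by
    rw [Finsupp.single_le_iff]; omega
  rw [tsub_add_cancel_of_le hle] at h1
  have h2 : ((((d - Finsupp.single i 1 : ι →₀ ℕ) i + 1 : ℕ) : ℂ)) • MvPolynomial.coeff d f = 0 := by
    rw [Algebra.smul_def, mul_comm]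
    simpa using h1
  exact (smul_eq_zero.mp h2).resolve_left (Nat.cast_ne_zero.mpr (Nat.succ_ne_zero _))

theorem eq_C_of_pderiv_eq_zero {ι A : Type*} [CommRing A] [Algebra ℂ A] {f : MvPolynomial ι A}
    (h : ∀ i, MvPolynomial.pderiv i f = 0) : f = C (MvPolynomial.coeff 0 f) := by
  classical
  refine MvPolynomial.ext _ _ fun d => ?_
  rw [MvPolynomial.coeff_C]
  split_ifs with hd
  · rw [hd]
  · obtain ⟨i, hi⟩ : ∃ i, d i ≠ 0 := by
      by_contra hcon
      push Not at hcon
      exact hd (Finsupp.ext fun i => by simp [hcon i])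
    exact coeff_eq_zero_of_pderiv (h i) hi

/-- `L_M` acts as `-∂/∂a_M` on polynomials that involve only the variables up to `a_M`. -/
theorem posD_eq_neg_pderiv {M : ℕ} (hM : 2 ≤ M) {u : F}
    (hu : ∀ i : Idx, M < i → MvPolynomial.pderiv i u = 0) :
    posD M u = -MvPolynomial.pderiv ⟨M, hM⟩ u := by
  have hvars : ∀ i ∈ u.vars, (i : ℕ) ≤ M := by
    intro i hi
    by_contra hcon
    obtain ⟨d, hd, hid⟩ := MvPolynomial.mem_vars_iff_mem_support i |>.mp hi
    exact MvPolynomial.mem_support_iff.mp hd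
      (coeff_eq_zero_of_pderiv (hu i (by omega)) (Finsupp.mem_support_iff.mp hid))
  have h1 : posD M u = MvPolynomial.mkDerivation Smooth (fun l : Idx => if M ≤ (l : ℕ) then
      (((l : ℕ) : ℂ) - M - 1) • PowerSeries.coeff (l - M) gser else 0) u := by
    rw [posD, if_neg (by omega), vf, zero_smul, zero_smul, add_zero, add_zero]
    rfl
  rw [h1, ← Derivation.neg_apply]
  refine MvPolynomial.derivation_eq_of_forall_mem_vars fun i hi => ?_
  rw [MvPolynomial.mkDerivation_X, Derivation.neg_apply]
  by_cases h : (i : ℕ) = M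
  · subst h
    rw [if_pos le_rfl, Nat.sub_self, coeff_zero_gser, MvPolynomial.pderiv_X_self, sub_self,
      zero_sub, neg_one_smul]
  · have h2 := hvars i hi
    rw [if_neg (by omega), MvPolynomial.pderiv_X_of_ne (fun h' => h (congrArg Subtype.val h')),
      neg_zero]

/-- A polynomial annihilated by all `L_n`, `n > 0`, does not involve the variables `a_l`. -/
theorem eq_C_of_posD_eq_zero {u : F} (hu : ∀ n, 2 ≤ n → posD n u = 0) :
    u = C (MvPolynomial.coeff 0 u) := by
  refine eq_C_of_pderiv_eq_zero ?_
  by_contra hcon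
  push Not at hcon
  have hfin : {i : Idx | MvPolynomial.pderiv i u ≠ 0}.Finite :=
    (Finset.finite_toSet u.vars).subset fun i hi => by
      by_contra h
      exact hi (MvPolynomial.pderiv_eq_zero_of_notMem_vars h)
  obtain ⟨M, hM, hmax⟩ := hfin.exists_maximal hcon
  refine hM ?_
  have h1 := posD_eq_neg_pderiv M.2 (u := u) fun i hi => by
    by_contra h
    exact absurd (hmax h (le_of_lt hi)) (not_le_of_gt hi)
  rw [hu _ M.2] at h1
  simpa using h1.symm

theorem coeffD_comm (v w : ℝ × ℝ) (u : F) : coeffD v (coeffD w u) = coeffD w (coeffD v u) := by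
  refine MvPolynomial.ext _ _ fun d => ?_
  change MvPolynomial.coeff d (coeffDeriv _ (coeffDeriv _ u)) =
    MvPolynomial.coeff d (coeffDeriv _ (coeffDeriv _ u))
  rw [coeff_coeffDeriv, coeff_coeffDeriv, coeff_coeffDeriv, coeff_coeffDeriv, dirDeriv_comm]

theorem C_csmul (z : ℂ) (r : Smooth) : (C (z • r) : F) = z • C r := by
  refine MvPolynomial.ext _ _ fun d => ?_
  rw [MvPolynomial.coeff_smul, MvPolynomial.coeff_C, MvPolynomial.coeff_C]
  split_ifs <;> simp

/-- A function of `(x, y)` alone that is annihilated by `L_1`, homogeneous of degree `N ≠ 0, 1`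
and annihilated by `∂²/∂x∂y` vanishes. -/
theorem eq_zero_of_posD_eq_zero {u : F} {N : ℂ} (hu : ∀ n, 1 ≤ n → posD n u = 0)
    (h0 : zeroD u = N • u) (hN0 : N ≠ 0) (hN1 : N ≠ 1)
    (hxy : coeffD (1, 0) (coeffD (0, 1) u) = 0) : u = 0 := by
  have hC := eq_C_of_posD_eq_zero fun n hn => hu n (by omega)
  set r := MvPolynomial.coeff 0 u
  rw [hC] at h0 hxy ⊢
  have h1 := hu 1 le_rfl
  have hinj := MvPolynomial.C_injective Idx Smooth
  rw [hC, isVectorField_posD, posD_xF, posD_yF, if_pos rfl, one_mul, one_mul, ← map_add] at h1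
  rw [isVectorField_zeroD, zeroD_xF, zeroD_yF, xF, yF, ← map_mul, ← map_mul, ← map_add] at h0
  rw [coeffD_C, coeffD_C] at hxy
  have e1 : dirDeriv (0, 1) r = -dirDeriv (1, 0) r :=
    eq_neg_of_add_eq_zero_right (hinj (by rw [h1, map_zero]))
  have e2 : dirDeriv (1, 0) (dirDeriv (1, 0) r) = 0 := by
    have : dirDeriv (1, 0) (dirDeriv (0, 1) r) = 0 := hinj (by rw [hxy, map_zero])
    rwa [e1, map_neg, neg_eq_zero] at this
  have e3 : (xS - yS) * dirDeriv (1, 0) r = N • r := by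
    have : xS * dirDeriv (1, 0) r + yS * dirDeriv (0, 1) r = N • r :=
      hinj (h0.trans (C_csmul N r).symm)
    rw [← this, e1]; ring
  have e4 := congrArg (dirDeriv (1, 0)) e3
  rw [dirDeriv_mul, e2, map_sub, dirDeriv_xS, dirDeriv_yS, map_smul] at e4
  have e5 : (N - 1) • dirDeriv (1, 0) r = 0 := by
    rw [sub_smul, ← e4]; simp
  have e6 := (smul_eq_zero.mp e5).resolve_left (sub_ne_zero.mpr hN1)
  rw [e6, mul_zero] at e3
  rw [(smul_eq_zero.mp e3.symm).resolve_left hN0, map_zero]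

/-- A first order operator `D + s` whose vector field preserves the functions that do not depend
on `y` and those that do not depend on `x`, and whose zeroth order part is the sum of two such
functions. -/
structure IsSplit (D : Derivation ℂ F F) (s : F) : Prop where
  isVectorField : IsVectorField D
  mapX : ∀ u, coeffD (0, 1) u = 0 → coeffD (0, 1) (D u) = 0
  mapY : ∀ u, coeffD (1, 0) u = 0 → coeffD (1, 0) (D u) = 0
  mem : ∃ v w, s = v + w ∧ coeffD (0, 1) v = 0 ∧ coeffD (1, 0) w = 0

namespace IsSplit

variable {D E : Derivation ℂ F F} {s r : F}

theorem lie (hD : IsSplit D s) (hE : IsSplit E r) : IsSplit ⁅D, E⁆ (D r - E s) where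
  isVectorField := hD.isVectorField.lie hE.isVectorField
  mapX u hu := by
    rw [Derivation.commutator_apply, map_sub, hD.mapX _ (hE.mapX u hu), hE.mapX _ (hD.mapX u hu),
      sub_zero]
  mapY u hu := by
    rw [Derivation.commutator_apply, map_sub, hD.mapY _ (hE.mapY u hu), hE.mapY _ (hD.mapY u hu),
      sub_zero]
  mem := by
    obtain ⟨v, w, rfl, hv, hw⟩ := hD.mem
    obtain ⟨v', w', rfl, hv', hw'⟩ := hE.mem
    refine ⟨D v' - E v, D w' - E w, ?_, ?_, ?_⟩
    · rw [map_add, map_add]; ring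
    · rw [map_sub, hD.mapX _ hv', hE.mapX _ hv, sub_zero]
    · rw [map_sub, hD.mapY _ hw', hE.mapY _ hw, sub_zero]

theorem smul (hD : IsSplit D s) (z : ℂ) : IsSplit (z • D) (z • s) where
  isVectorField := hD.isVectorField.csmul z
  mapX u hu := by rw [Derivation.smul_apply, Derivation.map_smul, hD.mapX u hu, smul_zero]
  mapY u hu := by rw [Derivation.smul_apply, Derivation.map_smul, hD.mapY u hu, smul_zero]
  mem := by
    obtain ⟨v, w, rfl, hv, hw⟩ := hD.mem
    exact ⟨z • v, z • w, smul_add _ _ _, by rw [Derivation.map_smul, hv, smul_zero],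
      by rw [Derivation.map_smul, hw, smul_zero]⟩

theorem add (hD : IsSplit D s) (hE : IsSplit E r) : IsSplit (D + E) (s + r) where
  isVectorField := hD.isVectorField.add hE.isVectorField
  mapX u hu := by rw [Derivation.add_apply, map_add, hD.mapX u hu, hE.mapX u hu, add_zero]
  mapY u hu := by rw [Derivation.add_apply, map_add, hD.mapY u hu, hE.mapY u hu, add_zero]
  mem := by
    obtain ⟨v, w, rfl, hv, hw⟩ := hD.mem
    obtain ⟨v', w', rfl, hv', hw'⟩ := hE.mem
    exact ⟨v + v', w + w', by ring, by rw [map_add, hv, hv', add_zero],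
      by rw [map_add, hw, hw', add_zero]⟩

theorem sub (hD : IsSplit D s) (hE : IsSplit E r) : IsSplit (D - E) (s - r) := by
  have := hD.add (hE.smul (-1))
  rwa [show D + (-1 : ℂ) • E = D - E from Derivation.ext fun u => by simp [sub_eq_add_neg],
    neg_one_smul, ← sub_eq_add_neg] at this

/-- A split first order operator of degree at least two that commutes with all `L_n`, `n > 0`,
vanishes. -/
theorem eq_zero (hD : IsSplit D s) {N : ℕ} (hN : 2 ≤ N) {z : ℂ}
    (hcomm : ∀ n, 1 ≤ n → Commute (fo (posD n) 0) (fo D s))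
    (h0 : fo zeroD (z • 1) * fo D s - fo D s * fo zeroD (z • 1) = (N : ℂ) • fo D s) :
    fo D s = 0 := by
  have hs : ∀ n, 1 ≤ n → posD n s = 0 := by
    intro n hn
    have := LinearMap.congr_fun (hcomm n hn).eq 1
    simpa [Module.End.mul_apply, fo_apply] using this
  have hDu : ∀ n, 1 ≤ n → ∀ u, posD n (D u) = D (posD n u) := by
    intro n hn u
    have := LinearMap.congr_fun (hcomm n hn).eq u
    simp only [Module.End.mul_apply, fo_apply, zero_mul, add_zero, map_add, Derivation.leibniz,
      smul_eq_mul, hs n hn, mul_zero] at this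
    exact add_right_cancel this
  have h0u : ∀ u, zeroD (D u) + u * zeroD s = D (zeroD u) + (N : ℂ) • (D u + s * u) := by
    intro u
    have := LinearMap.congr_fun h0 u
    simp only [LinearMap.sub_apply, LinearMap.smul_apply, Module.End.mul_apply, fo_apply, map_add,
      Derivation.leibniz, smul_eq_mul, smul_mul_assoc, one_mul, map_smul] at this
    rw [← this, smul_add]
    ring
  have h0s : zeroD s = (N : ℂ) • s := by
    have := h0u 1
    simpa using this
  have h0D : ∀ u, zeroD (D u) = D (zeroD u) + (N : ℂ) • D u := by
    intro u
    have := h0u u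
    rw [h0s, smul_add, mul_smul_comm, mul_comm u s, ← add_assoc] at this
    exact add_right_cancel this
  have hcast : ∀ k : ℕ, 2 ≤ k → (k : ℂ) ≠ 0 ∧ (k : ℂ) ≠ 1 := fun k hk =>
    ⟨by exact_mod_cast (show k ≠ 0 by omega), by exact_mod_cast (show k ≠ 1 by omega)⟩
  have hs0 : s = 0 := by
    obtain ⟨v, w, rfl, hv, hw⟩ := hD.mem
    refine eq_zero_of_posD_eq_zero hs h0s (hcast N hN).1 (hcast N hN).2 ?_
    rw [map_add, hv, zero_add, coeffD_comm, hw, map_zero]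
  have hx : D xF = 0 := by
    refine eq_zero_of_posD_eq_zero (N := ((N + 1 : ℕ) : ℂ)) (fun n hn => ?_) ?_
      (hcast (N + 1) (by omega)).1 (hcast (N + 1) (by omega)).2 ?_
    · rw [hDu n hn, posD_xF]; split_ifs <;> simp
    · rw [h0D, zeroD_xF]; push_cast; module
    · rw [hD.mapX xF (by rw [coeffD_xF]; simp), map_zero]
  have hy : D yF = 0 := by
    refine eq_zero_of_posD_eq_zero (N := ((N + 1 : ℕ) : ℂ)) (fun n hn => ?_) ?_
      (hcast (N + 1) (by omega)).1 (hcast (N + 1) (by omega)).2 ?_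
    · rw [hDu n hn, posD_yF]; split_ifs <;> simp
    · rw [h0D, zeroD_yF]; push_cast; module
    · rw [coeffD_comm, hD.mapY yF (by rw [coeffD_yF]; simp), map_zero]
  have ha : ∀ l, D (a l) = 0 := by
    intro l
    induction l using Nat.strong_induction_on with
    | _ l ih =>
      by_cases hl : 2 ≤ l
      · refine eq_zero_of_posD_eq_zero (N := ((l + N : ℕ) : ℂ)) (fun n hn => ?_) ?_
          (hcast (l + N) (by omega)).1 (hcast (l + N) (by omega)).2 ?_
        · rw [hDu n hn, posD_a n hl]
          split_ifs with h
          · rw [Derivation.map_smul]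
            rcases Nat.eq_zero_or_pos (l - n) with h1 | h1
            · rw [h1, coeff_zero_gser]; simp
            · rw [coeff_gser (by omega), ih _ (by omega), smul_zero]
          · simp
        · rw [h0D, zeroD_a, Derivation.map_smul]; push_cast; module
        · rw [hD.mapX _ (coeffD_a _ _), map_zero]
      · rw [a, dif_neg hl, map_zero]
  have hD0 : D = 0 := hD.isVectorField.ext IsVectorField.zero (by simpa using hx)
    (by simpa using hy) fun l _ => by simpa using ha l
  rw [hD0, hs0, fo_zero_zero]

end IsSplit

end SLEVir

namespace SLEVir

/-! ### The Virasoro representation on `ℱ` -/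

set_option linter.unusedSimpArgs false

theorem lie_coeffD_x_vf {P : ℕ → F} {f g : F} (hP : ∀ v l, 2 ≤ l → coeffD v (P l) = 0)
    (hg : coeffD (1, 0) g = 0) :
    ⁅coeffD (1, 0), vf P f g⁆ = coeffD (1, 0) f • coeffD (1, 0) := by
  refine (isVectorField_coeffD_x.lie (isVectorField_vf _ _ _)).ext
    (isVectorField_coeffD_x.smul _) ?_ ?_ fun l hl => ?_
  · simp [Derivation.commutator_apply, coeffD_xF]
  · simp [Derivation.commutator_apply, coeffD_yF, hg]
  · rw [Derivation.commutator_apply, vf_a _ _ _ hl, hP _ l hl, coeffD_a]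
    simp [coeffD_a]

theorem lie_coeffD_y_vf {P : ℕ → F} {f g : F} (hP : ∀ v l, 2 ≤ l → coeffD v (P l) = 0)
    (hf : coeffD (0, 1) f = 0) :
    ⁅coeffD (0, 1), vf P f g⁆ = coeffD (0, 1) g • coeffD (0, 1) := by
  refine (isVectorField_coeffD_y.lie (isVectorField_vf _ _ _)).ext
    (isVectorField_coeffD_y.smul _) ?_ ?_ fun l hl => ?_
  · simp [Derivation.commutator_apply, coeffD_xF, hf]
  · simp [Derivation.commutator_apply, coeffD_yF]
  · rw [Derivation.commutator_apply, vf_a _ _ _ hl, hP _ l hl, coeffD_a]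
    simp [coeffD_a]

theorem isSplit_vf {P : ℕ → F} {f g s : F} (hP : ∀ v l, 2 ≤ l → coeffD v (P l) = 0)
    (hf : coeffD (0, 1) f = 0) (hg : coeffD (1, 0) g = 0)
    (hs : ∃ v w, s = v + w ∧ coeffD (0, 1) v = 0 ∧ coeffD (1, 0) w = 0) :
    IsSplit (vf P f g) s where
  isVectorField := isVectorField_vf _ _ _
  mem := hs
  mapX u hu := by
    have h1 := congrArg (fun D : Derivation ℂ F F => D u) (lie_coeffD_y_vf (g := g) hP hf)
    simpa [Derivation.commutator_apply, hu] using h1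
  mapY u hu := by
    have h1 := congrArg (fun D : Derivation ℂ F F => D u) (lie_coeffD_x_vf (f := f) hP hg)
    simpa [Derivation.commutator_apply, hu] using h1

theorem coeffD_aSum (v : ℝ × ℝ) (r n : ℕ) : coeffD v (aSum r n) = 0 := by
  induction r generalizing n with
  | zero =>
    cases n with
    | zero => simp [aSum]
    | succ n => simp [aSum, Finset.Nat.antidiagonalTuple_zero_succ]
  | succ r ih =>
    rw [aSum_succ, map_sum]
    refine Finset.sum_eq_zero fun x _ => ?_
    rw [Derivation.leibniz, coeffD_a, ih]
    simp

theorem isSplit_negOneD (hx hy : ℂ) : IsSplit negOneD ((2 * hx) • xF + (2 * hy) • yF) := by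
  refine isSplit_vf (fun v l _ => ?_) ?_ ?_ ⟨_, _, rfl, ?_, ?_⟩
  · rw [map_add, Derivation.map_smul, coeffD_a, coeffD_aSum]; simp
  · simp [Derivation.leibniz, Derivation.leibniz_pow, Derivation.map_ofNat, coeffD_xF, coeffD_a]
  · simp [Derivation.leibniz, Derivation.leibniz_pow, Derivation.map_ofNat, coeffD_yF, coeffD_a]
  · simp [Derivation.map_smul, coeffD_xF]
  · simp [Derivation.map_smul, coeffD_yF]

theorem isSplit_negTwoD (c hx hy : ℂ) : IsSplit negTwoD
    (hx • (3 * xF ^ 2 - 4 * a 2) + hy • (3 * yF ^ 2 - 4 * a 2) - (c / 2) • a 2) := by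
  refine isSplit_vf (fun v l _ => ?_) ?_ ?_
    ⟨hx • (3 * xF ^ 2 - 4 * a 2) - (c / 2) • a 2, hy • (3 * yF ^ 2 - 4 * a 2), by ring, ?_, ?_⟩
  · simp [Derivation.leibniz, Derivation.map_ofNat, coeffD_a, coeffD_aSum]
  · simp [Derivation.leibniz, Derivation.leibniz_pow, Derivation.map_ofNat, coeffD_xF, coeffD_a]
  · simp [Derivation.leibniz, Derivation.leibniz_pow, Derivation.map_ofNat, coeffD_yF, coeffD_a]
  · simp [Derivation.leibniz, Derivation.leibniz_pow, Derivation.map_ofNat, coeffD_xF, coeffD_a]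
  · simp [Derivation.leibniz, Derivation.leibniz_pow, Derivation.map_ofNat, coeffD_yF, coeffD_a]

theorem algebraMap_ofNat (n : ℕ) [n.AtLeastTwo] :
    algebraMap ℂ F ofNat(n) = ofNat(n) := by
  rw [Algebra.algebraMap_eq_smul_one, ofNat_smul, mul_one]

theorem smul_comm_left (z : ℂ) (S T : Module.End ℂ F) :
    (z • S) * T - T * (z • S) = z • (S * T - T * S) :=
  LinearMap.ext fun f => by simp [smul_sub]

theorem smul_comm_right (z : ℂ) (S T : Module.End ℂ F) :
    S * (z • T) - (z • T) * S = z • (S * T - T * S) :=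
  LinearMap.ext fun f => by simp [smul_sub]

section Operators

variable (c hx hy : ℂ)

theorem bracketPos_eq (k : ℕ) : bracketPos k = (k ! : ℂ) • fo (posD (k + 2)) 0 := by
  induction k with
  | zero => rw [bracketPos, opL2_eq]; simp
  | succ k ih =>
    rw [bracketPos, ih, opL1_eq, smul_comm_left, fo_comm,
      lie_posD (by omega) le_rfl, map_zero, map_zero, sub_zero]
    have h : fo ((((k + 2 : ℕ) : ℂ) - (1 : ℕ)) • posD (k + 2 + 1)) 0 =
        ((k : ℂ) + 1) • fo (posD (k + 1 + 2)) 0 := by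
      rw [fo_smul, smul_zero]
      congr 2
      push_cast; ring
    rw [h, smul_smul, Nat.factorial_succ]
    congr 1
    push_cast; ring

theorem opL_pos {n : ℕ} (hn : 1 ≤ n) : opL c hx hy n = fo (posD n) 0 := by
  match n with
  | 1 => exact opL1_eq
  | k + 2 =>
    change ((k ! : ℂ)⁻¹) • bracketPos k = _
    rw [bracketPos_eq, smul_smul, inv_mul_cancel₀ (by exact_mod_cast Nat.factorial_ne_zero k),
      one_smul]

theorem opL_pos' {n : ℤ} (hn : 0 < n) : opL c hx hy n = fo (posD n.toNat) 0 := by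
  rw [← opL_pos c hx hy (n := n.toNat) (by omega), Int.toNat_of_nonneg hn.le]

theorem opL_zero : opL c hx hy 0 = fo zeroD ((hx + hy) • 1) := opL0_eq hx hy

theorem opL_neg_one : opL c hx hy (-1) = fo negOneD ((2 * hx) • xF + (2 * hy) • yF) :=
  opLm1_eq hx hy

theorem opL_neg (k : ℕ) : opL c hx hy (-((k : ℤ) + 2)) = ((k ! : ℂ)⁻¹) • bracketNeg c hx hy k := by
  have : -((k : ℤ) + 2) = Int.negSucc (k + 1) := by omega
  rw [this]; rfl

theorem opL_neg_two : opL c hx hy (-2) = fo negTwoD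
    (hx • (3 * xF ^ 2 - 4 * a 2) + hy • (3 * yF ^ 2 - 4 * a 2) - (c / 2) • a 2) := by
  have := opL_neg c hx hy 0
  simpa [bracketNeg, opLm2_eq] using this

theorem bracketNeg_isSplit (k : ℕ) : ∃ D s, bracketNeg c hx hy k = fo D s ∧ IsSplit D s := by
  induction k with
  | zero => exact ⟨negTwoD, _, by rw [bracketNeg, opLm2_eq], isSplit_negTwoD c hx hy⟩
  | succ k ih =>
    obtain ⟨D, s, h, hD⟩ := ih
    rw [bracketNeg, h, opLm1_eq, fo_comm]
    exact ⟨_, _, rfl, (isSplit_negOneD hx hy).lie hD⟩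

theorem opL_neg_isSplit {n : ℤ} (hn : 2 ≤ n) :
    ∃ D s, opL c hx hy (-n) = fo D s ∧ IsSplit D s := by
  obtain ⟨k, rfl⟩ : ∃ k : ℕ, n = (k : ℤ) + 2 := ⟨(n - 2).toNat, by omega⟩
  obtain ⟨D, s, h, hD⟩ := bracketNeg_isSplit c hx hy k
  rw [opL_neg, h, fo_smul]
  exact ⟨_, _, rfl, hD.smul _⟩

/-- The Virasoro relations on `ℱ`, for arbitrary central charge and weights. -/
theorem opL_rel (m n : ℤ) : Rel (opL c hx hy) c m n := by
  have hcast : ∀ {n : ℤ}, 0 < n → ((n.toNat : ℕ) : ℂ) = n := fun {n} hn => by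
    rw [← Int.cast_natCast, Int.toNat_of_nonneg hn.le]
  have hpos : ∀ m n : ℤ, 0 < m → 0 < n → Rel (opL c hx hy) c m n := by
    intro m n hm hn
    unfold Rel
    rw [opL_pos' c hx hy hm, opL_pos' c hx hy hn, opL_pos' c hx hy (add_pos hm hn), fo_comm,
      lie_posD (by omega) (by omega), central_of_ne c (by omega), hcast hm, hcast hn, map_zero,
      map_zero, sub_zero, fo_smul, smul_zero, zero_smul, add_zero, ← Int.toNat_add hm.le hn.le]
  refine Rel.of_generators hpos ?_ ?_ ?_ ?_ ?_ ?_ ?_ ?_ ?_ m n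
  · intro n hn
    unfold Rel
    rw [opL_pos' c hx hy hn, opL_zero, fo_comm, lie_zeroD_posD (by omega),
      central_of_ne c (by omega), hcast hn, zero_add, opL_pos' c hx hy hn, fo_smul]
    simp
  · unfold Rel
    rw [opL_zero, opL_neg_one, fo_comm, lie_zeroD_negOneD, central_of_ne c (by omega), zero_add,
      opL_neg_one]
    simp
  · unfold Rel
    rw [opL_zero, opL_neg_two, fo_comm, lie_zeroD_negTwoD, central_of_ne c (by omega), zero_add,
      opL_neg_two, zero_smul, add_zero, fo_smul]
    refine fo_congr (by norm_num) ?_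
    have hk : ((0 : ℤ) : ℂ) - (-2 : ℤ) = 2 := by norm_num
    simp only [map_add, map_sub, Derivation.map_smul, Derivation.leibniz, Derivation.leibniz_pow,
      Derivation.map_ofNat, Derivation.map_one_eq_zero, smul_eq_mul, nsmul_eq_mul, map_zero,
      sub_zero, zeroD_xF, zeroD_yF, zeroD_a]
    simp only [hk, ofNat_smul, Algebra.smul_def, map_mul, map_add, map_ofNat, algebraMap_ofNat,
      Nat.cast_ofNat]
    ring
  · unfold Rel
    rw [show (1 : ℤ) = ((1 : ℕ) : ℤ) by simp, opL_pos c hx hy le_rfl]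
    rw [show -((1 : ℕ) : ℤ) = -1 by simp, show ((1 : ℕ) : ℤ) + -1 = 0 by simp, opL_zero,
      opL_neg_one, fo_comm, lie_posD_one_negOneD]
    rw [show central c ((1 : ℕ) : ℤ) (-1) = 0 by simp [central], zero_smul, add_zero, fo_smul]
    refine fo_congr (by norm_num) ?_
    have hk : (((1 : ℕ) : ℤ) : ℂ) - (-1 : ℤ) = 2 := by norm_num
    simp only [map_add, map_sub, Derivation.map_smul, Derivation.leibniz, Derivation.leibniz_pow,
      Derivation.map_ofNat, Derivation.map_one_eq_zero, smul_eq_mul, nsmul_eq_mul, map_zero,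
      sub_zero, posD_xF, posD_yF, if_true, zero_add, mul_one, smul_add, smul_smul]
    simp only [hk, ofNat_smul, Algebra.smul_def, map_mul, map_add, map_ofNat, algebraMap_ofNat,
      Nat.cast_ofNat]
    ring
  · unfold Rel
    rw [show (2 : ℤ) = ((2 : ℕ) : ℤ) by simp, opL_pos c hx hy (by omega),
      show ((2 : ℕ) : ℤ) + -1 = ((1 : ℕ) : ℤ) by simp, opL_pos c hx hy le_rfl,
      opL_neg_one, fo_comm, lie_posD_two_negOneD]
    rw [show central c ((2 : ℕ) : ℤ) (-1) = 0 by simp [central], zero_smul, add_zero, fo_smul]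
    refine fo_congr (by norm_num) ?_
    simp
  · unfold Rel
    rw [show (1 : ℤ) = ((1 : ℕ) : ℤ) by simp, opL_pos c hx hy le_rfl,
      show ((1 : ℕ) : ℤ) + -2 = -1 by simp, opL_neg_one, opL_neg_two, fo_comm,
      lie_posD_one_negTwoD]
    rw [show central c ((1 : ℕ) : ℤ) (-2) = 0 by simp [central], zero_smul, add_zero, fo_smul]
    refine fo_congr (by norm_num) ?_
    have hk : (((1 : ℕ) : ℤ) : ℂ) - (-2 : ℤ) = 3 := by norm_num
    simp only [map_add, map_sub, Derivation.map_smul, Derivation.leibniz, Derivation.leibniz_pow,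
      Derivation.map_ofNat, Derivation.map_one_eq_zero, smul_eq_mul, nsmul_eq_mul, map_zero,
      sub_zero, posD_xF, posD_yF, posD_one_a_two, if_true]
    simp only [hk, ofNat_smul, Algebra.smul_def, map_mul, map_add, map_ofNat, algebraMap_ofNat,
      Nat.cast_ofNat]
    ring
  · unfold Rel
    rw [show (2 : ℤ) = ((2 : ℕ) : ℤ) by simp, opL_pos c hx hy (by omega)]
    rw [show -((2 : ℕ) : ℤ) = -2 by simp, show ((2 : ℕ) : ℤ) + -2 = 0 by simp, opL_zero,
      opL_neg_two, fo_comm, lie_posD_two_negTwoD]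
    rw [show central c ((2 : ℕ) : ℤ) (-2) = c / 2 by simp [central]; ring, fo_smul, fo_scalar]
    refine fo_congr (by norm_num) ?_
    have hk : ((2 : ℤ) : ℂ) - (-2 : ℤ) = 4 := by norm_num
    simp only [map_add, map_sub, Derivation.map_smul, Derivation.leibniz, Derivation.leibniz_pow,
      Derivation.map_ofNat, Derivation.map_one_eq_zero, smul_eq_mul, nsmul_eq_mul, map_zero,
      sub_zero, posD_xF, posD_yF, posD_two_a_two, OfNat.ofNat_ne_one, if_false]
    simp only [hk, ofNat_smul, Algebra.smul_def, map_mul, map_add, map_ofNat, algebraMap_ofNat,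
      Nat.cast_ofNat]
    ring
  · intro n hn
    obtain ⟨k, rfl⟩ : ∃ k : ℕ, n = (k : ℤ) + 2 := ⟨(n - 2).toNat, by omega⟩
    unfold Rel
    rw [show -1 + -((k : ℤ) + 2) = -(((k + 1 : ℕ) : ℤ) + 2) by push_cast; ring, opL_neg, opL_neg,
      central_of_ne c (by omega), zero_smul, add_zero, smul_comm_right,
      bracketNeg, smul_smul, Nat.factorial_succ]
    have hk : (k ! : ℂ) ≠ 0 := by exact_mod_cast Nat.factorial_ne_zero k
    have hk1 : (k : ℂ) + 1 ≠ 0 := by exact_mod_cast Nat.succ_ne_zero k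
    congr 1
    push_cast
    field_simp
    ring
  · intro m n hm hn Y hY h1 h2 h0
    obtain ⟨D, s, hDs, hD⟩ := opL_neg_isSplit c hx hy hm
    obtain ⟨E, r, hEr, hE⟩ := opL_neg_isSplit c hx hy hn
    obtain ⟨G, u, hGu, hG⟩ := opL_neg_isSplit c hx hy (show 2 ≤ m + n by omega)
    rw [hDs, hEr, show -m + -n = -(m + n) by ring, hGu, fo_comm, fo_smul, fo_sub] at hY
    have hsplit := (hD.lie hE).sub (hG.smul ((-m : ℂ) - -n))
    have hc : ∀ k : ℕ, Commute (fo (posD (k + 1)) 0) Y ∧ Commute (fo (posD (k + 2)) 0) Y := by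
      intro k
      induction k with
      | zero =>
        rw [← opL_pos c hx hy (by omega), ← opL_pos c hx hy (by omega)]
        exact ⟨h1, h2⟩
      | succ k ih =>
        refine ⟨ih.2, ?_⟩
        have hb := ((ih.2.mul_left (opL_pos c hx hy le_rfl ▸ h1)).sub_left
          ((opL_pos c hx hy le_rfl ▸ h1 : Commute (fo (posD 1) 0) Y).mul_left ih.2))
        rw [fo_comm, lie_posD (by omega) le_rfl, map_zero, map_zero, sub_zero] at hb
        have hk : ((k + 2 : ℕ) : ℂ) - (1 : ℕ) ≠ 0 := by
          push_cast
          rw [show (k : ℂ) + 2 - 1 = ((k + 1 : ℕ) : ℂ) by push_cast; ring]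
          exact_mod_cast Nat.succ_ne_zero k
        rw [show fo ((((k + 2 : ℕ) : ℂ) - (1 : ℕ)) • posD (k + 2 + 1)) 0 =
          (((k + 2 : ℕ) : ℂ) - (1 : ℕ)) • fo (posD (k + 2 + 1)) 0 by rw [fo_smul, smul_zero]] at hb
        have := hb.smul_left ((((k + 2 : ℕ) : ℂ) - (1 : ℕ))⁻¹)
        rwa [smul_smul, inv_mul_cancel₀ hk, one_smul] at this
    rw [hY]
    rw [hY, opL_zero] at h0
    refine hsplit.eq_zero (N := (m + n).toNat) (by omega) (z := hx + hy) (fun k hk => ?_) ?_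
    · rw [← hY]
      obtain ⟨j, rfl⟩ : ∃ j, k = j + 1 := ⟨k - 1, by omega⟩
      exact (hc j).1
    · rw [h0, hcast (by omega)]
      push_cast; rfl

/-- The Virasoro representation on `ℱ`. -/
def opRep : VirasoroRep c F where
  L := opL c hx hy
  comm m n := by
    rw [opL_rel c hx hy m n, central]
    split_ifs <;> simp

end Operators

end SLEVir

namespace SLEVir

open PowerSeries (coeff)
open MvPolynomial (C)

/-! ### The drift operator as a second order operator -/

/-- `1/(y - x)` as an element of `ℱ`. -/
def wF : F := C invS

theorem wF_mul : wF * (yF - xF) = 1 := by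
  rw [wF, yF, xF, ← map_sub, ← map_mul, invS_mul, map_one]

theorem derivation_wF (D : Derivation ℂ F F) : D wF = -wF ^ 2 * (D yF - D xF) := by
  have h := congrArg D wF_mul
  rw [Derivation.leibniz, Derivation.map_one_eq_zero, map_sub, smul_eq_mul, smul_eq_mul] at h
  linear_combination wF * h - D wF * wF_mul

/-- The vector field underlying the drift operator: the terms with one derivative. -/
def driftD : Derivation ℂ F F := vf driftCoeff 0 (2 * wF)

/-- The zeroth order part `-ρ(ρ + 4 - κ)/(2κ) · (y - x)⁻²` of the drift operator. -/
def driftS (κ ρ : ℝ) : F := -(((ρ : ℂ) * (ρ + 4 - κ) / (2 * κ)) • wF ^ 2)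

theorem opA_apply (κ ρ : ℝ) (u : F) : opA κ ρ u =
    ((κ : ℂ) / 2) • coeffD (1, 0) (coeffD (1, 0) u) + fo driftD (driftS κ ρ) u := by
  rw [driftD, fo_vf, opA, driftS]
  change ((κ : ℂ) / 2) • coeffD (1, 0) (coeffD (1, 0) u) + (2 : ℂ) • (wF * dy u) -
    ((ρ : ℂ) * (ρ + 4 - κ) / (2 * κ)) • (wF ^ 2 * u) + aDeriv driftCoeff u =
    ((κ : ℂ) / 2) • coeffD (1, 0) (coeffD (1, 0) u) + (aDeriv driftCoeff u + 0 * dx u +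
      2 * wF * dy u + -(((ρ : ℂ) * (ρ + 4 - κ) / (2 * κ)) • wF ^ 2) * u)
  rw [ofNat_smul, neg_mul, smul_mul_assoc]
  ring

/-- The commutator of the drift operator with a first order operator `D + s`, when `D` preserves
functions of `x`: the second order part is `2 f' A`, where `f = D x`, and what remains is a first
order operator. -/
theorem opA_fo {κ ρ : ℝ} {D : Derivation ℂ F F} {s f₁ : F}
    (hD : ⁅coeffD (1, 0), D⁆ = f₁ • coeffD (1, 0))
    (hE : ((κ : ℂ) / 2) • (coeffD (1, 0) f₁ + 2 * coeffD (1, 0) s) • coeffD (1, 0) +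
      ⁅driftD, D⁆ = (2 * f₁) • driftD)
    (he : ((κ : ℂ) / 2) • coeffD (1, 0) (coeffD (1, 0) s) + driftD s - D (driftS κ ρ) =
      2 * f₁ * driftS κ ρ) (u : F) :
    opA κ ρ (fo D s u) = fo D s (opA κ ρ u) + 2 * f₁ * opA κ ρ u := by
  have hD' : ∀ v, coeffD (1, 0) (D v) = D (coeffD (1, 0) v) + f₁ * coeffD (1, 0) v := fun v => by
    have h := congrArg (fun D : Derivation ℂ F F => D v) hD
    simp only [Derivation.commutator_apply, Derivation.smul_apply, smul_eq_mul] at h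
    rw [← h]; ring
  have hE' := congrArg (fun D : Derivation ℂ F F => D u) hE
  simp only [Derivation.add_apply, Derivation.commutator_apply, Derivation.smul_apply,
    smul_eq_mul] at hE'
  rw [opA_apply, opA_apply]
  simp only [fo_apply, map_add, hD', Derivation.leibniz, smul_eq_mul, Derivation.map_smul]
  rw [Algebra.smul_def] at hE' he
  simp only [Algebra.smul_def]
  linear_combination hE' + u * he

/-! ### The generating series of the drift -/

/-- The inverse of `1 - x t + ∑_{l ≥ 2} a_l t^l`. -/
def drift : PowerSeries F := PowerSeries.invOfUnit (gser - PowerSeries.C xF * PowerSeries.X) 1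

theorem drift_mul : (gser - PowerSeries.C xF * PowerSeries.X) * drift = 1 :=
  PowerSeries.mul_invOfUnit _ _ (by simp)

/-- The coefficients of `(1 - x t + ∑ a_l t^l)⁻¹` are those of the drift operator. The sum over `r`
stops at half the degree because a product of `r` variables `a_l` has degree at least `2 r`. -/
theorem coeff_drift (n : ℕ) : coeff n drift = ∑ m ∈ Finset.range (n + 1),
    ∑ r ∈ Finset.range ((n - m) / 2 + 1),
      ((-1) ^ r * (((m + r)! : ℂ) / (m ! * r !))) • (xF ^ m * aSum r (n - m)) := by
  -- Expand `1/(1 - z)` as a geometric series in `z = x t - ∑ a_l t^l`.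
  set z : PowerSeries F := PowerSeries.C xF * PowerSeries.X - (gser - 1) with hz
  have hX : PowerSeries.X ∣ z := by
    rw [PowerSeries.X_dvd_iff]; simp [hz]
  obtain ⟨q, hq⟩ := hX
  have h1 : drift = ∑ j ∈ Finset.range (n + 1), z ^ j + PowerSeries.X ^ (n + 1) *
      (q ^ (n + 1) * drift) := by
    have h2 := geom_sum_mul_neg z (n + 1)
    have h3 := drift_mul
    rw [← mul_assoc, ← mul_pow, ← hq]
    linear_combination (norm := (rw [hz]; ring)) -(drift * h2) + (∑ j ∈ Finset.range (n + 1),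
      z ^ j) * h3
  have h4 : ∀ m r : ℕ, coeff n ((PowerSeries.C xF * PowerSeries.X) ^ m * (-(gser - 1)) ^ r *
      (((m + r).choose m : ℕ) : PowerSeries F)) = if m ≤ n then
        ((-1) ^ r * (((m + r)! : ℂ) / (m ! * r !))) • (xF ^ m * aSum r (n - m)) else 0 := by
    intro m r
    rw [show (PowerSeries.C xF * PowerSeries.X) ^ m * (-(gser - 1)) ^ r *
      (((m + r).choose m : ℕ) : PowerSeries F) = PowerSeries.C ((-1) ^ r *
        ((m + r).choose m : F) * xF ^ m) * (PowerSeries.X ^ m * (gser - 1) ^ r) by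
      rw [neg_pow (gser - 1), mul_pow]; simp only [map_mul, map_pow, map_neg, map_one,
        map_natCast]; ring]
    rw [PowerSeries.coeff_C_mul, PowerSeries.coeff_X_pow_mul', mul_ite, mul_zero, coeff_gser_pow]
    congr 1
    rw [← Nat.cast_add_choose, Algebra.smul_def, map_mul, map_pow, map_neg, map_one, map_natCast]
    ring
  rw [h1, map_add, PowerSeries.coeff_X_pow_mul', if_neg (by omega), add_zero, map_sum]
  have h5 : ∀ j, coeff n (z ^ j) = ∑ m ∈ Finset.range (j + 1), coeff n
      ((PowerSeries.C xF * PowerSeries.X) ^ m * (-(gser - 1)) ^ (j - m) *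
        (((m + (j - m)).choose m : ℕ) : PowerSeries F)) := by
    intro j
    rw [hz, sub_eq_add_neg, add_pow, map_sum]
    refine Finset.sum_congr rfl fun m hm => ?_
    rw [Finset.mem_range] at hm
    rw [Nat.add_sub_cancel' (by omega)]
  simp only [h5]
  rw [Finset.sum_range_diag_flip (n + 1) fun m r => coeff n
      ((PowerSeries.C xF * PowerSeries.X) ^ m * (-(gser - 1)) ^ r *
        (((m + r).choose m : ℕ) : PowerSeries F))]
  refine Finset.sum_congr rfl fun m hm => ?_
  rw [Finset.mem_range] at hm
  refine (Finset.sum_subset (s₁ := Finset.range ((n - m) / 2 + 1))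
    (Finset.range_mono (by omega)) fun r _ hr => ?_).symm.trans ?_
  · rw [Finset.mem_range] at hr
    rw [h4, if_pos (by omega), aSum_eq_zero (by omega), mul_zero, smul_zero]
  · exact Finset.sum_congr rfl fun r _ => by rw [h4, if_pos (by omega)]

theorem driftCoeff_eq {l : ℕ} (hl : 2 ≤ l) : driftCoeff l = 2 * coeff (l - 2) drift := by
  rw [driftCoeff, coeff_drift, show l - 1 = l - 2 + 1 by omega]
  simp only [Nat.sub_right_comm l _ 2]

theorem driftD_gser : coeffwise driftD gser = PowerSeries.X ^ 2 * (drift + drift) := by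
  refine coeffwise_gser_eq ?_ ?_ fun l hl => ?_
  · rw [PowerSeries.coeff_X_pow_mul', if_neg (by omega)]
  · rw [PowerSeries.coeff_X_pow_mul', if_neg (by omega)]
  · rw [PowerSeries.coeff_X_pow_mul', if_pos hl, driftD, vf_a _ _ _ hl, driftCoeff_eq hl, map_add,
      two_mul]

theorem coeffwise_drift (D : Derivation ℂ F F) : coeffwise D drift =
    -drift ^ 2 * (coeffwise D gser - PowerSeries.C (D xF) * PowerSeries.X) := by
  have h := congrArg (coeffwise D) drift_mul
  simp only [Derivation.leibniz, map_sub, Derivation.map_one_eq_zero, coeffwise_C, coeffwise_X,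
    smul_eq_mul] at h
  linear_combination drift * h - coeffwise D drift * drift_mul

theorem theta_drift : theta drift =
    -drift ^ 2 * (theta gser - PowerSeries.C xF * PowerSeries.X) := by
  have h := congrArg theta drift_mul
  simp only [Derivation.leibniz, map_sub, Derivation.map_one_eq_zero, theta_C, theta_X,
    smul_eq_mul] at h
  linear_combination drift * h - theta drift * drift_mul

theorem driftD_xF : driftD xF = 0 := vf_xF _ _ _

theorem driftD_yF : driftD yF = 2 * wF := vf_yF _ _ _

theorem driftD_a_two : driftD (a 2) = 2 := by
  rw [driftD, vf_a _ _ _ le_rfl, driftCoeff_eq le_rfl, coeff_drift]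
  simp [aSum]

theorem driftD_a_three : driftD (a 3) = 2 * xF := by
  rw [driftD, vf_a _ _ _ (by omega), driftCoeff_eq (by omega), coeff_drift]
  simp [Finset.sum_range_succ, aSum]

end SLEVir

namespace SLEVir

open PowerSeries (coeff)
open MvPolynomial (C)

/-! ### Commutation of the drift operator with the generators -/

set_option linter.unusedSimpArgs false

theorem coeffwise_fsmul (f : F) (D : Derivation ℂ F F) (g : PowerSeries F) :
    coeffwise (f • D) g = PowerSeries.C f * coeffwise D g := by
  ext1 n
  rw [PowerSeries.coeff_C_mul, coeff_coeffwise, coeff_coeffwise, Derivation.smul_apply, smul_eq_mul]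

theorem coeffwise_add (D E : Derivation ℂ F F) (g : PowerSeries F) :
    coeffwise (D + E) g = coeffwise D g + coeffwise E g := by
  ext1 n
  rw [map_add, coeff_coeffwise, coeff_coeffwise, coeff_coeffwise, Derivation.add_apply]

theorem coeffwise_coeffD_gser (v : ℝ × ℝ) : coeffwise (coeffD v) gser = 0 := by
  ext1 n
  cases n with
  | zero => rw [coeff_coeffwise, coeff_zero_gser]; simp
  | succ n => rw [coeff_coeffwise, coeff_gser (by omega), coeffD_a]; simp

theorem isVectorField_driftD : IsVectorField driftD := isVectorField_vf _ _ _

/-- The commutator of the drift operator with a first order operator, reduced to identities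
between the values of vector fields on `x`, `y` and the generating series of the `a_l`. -/
theorem opA_fo_of_values {κ ρ : ℝ} {D : Derivation ℂ F F} {s f₁ f₂ s₁ s₂ : F}
    (hv : IsVectorField D) (hD : ⁅coeffD (1, 0), D⁆ = f₁ • coeffD (1, 0))
    (hf : coeffD (1, 0) f₁ = f₂) (hs : coeffD (1, 0) s = s₁) (hs' : coeffD (1, 0) s₁ = s₂)
    (hx : ((κ : ℂ) / 2) • (f₂ + 2 * s₁) + driftD (D xF) = 0)
    (hy : driftD (D yF) + 2 * wF ^ 2 * (D yF - D xF) = 4 * f₁ * wF)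
    (hG : coeffwise driftD (coeffwise D gser) =
      coeffwise D (coeffwise driftD gser) + 2 * PowerSeries.C f₁ * coeffwise driftD gser)
    (he : ((κ : ℂ) / 2) • s₂ + driftD s - D (driftS κ ρ) = 2 * f₁ * driftS κ ρ) (u : F) :
    opA κ ρ (fo D s u) = fo D s (opA κ ρ u) + 2 * f₁ * opA κ ρ u := by
  refine opA_fo hD ?_ (by rwa [hs, hs']) u
  rw [hf, hs]
  refine (((isVectorField_coeffD_x.smul _).csmul _).add (isVectorField_driftD.lie hv)).ext_gser
    (isVectorField_driftD.smul _) ?_ ?_ ?_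
  · simp only [Derivation.add_apply, Derivation.smul_apply, Derivation.commutator_apply,
      coeffD_xF, driftD_xF, smul_eq_mul, map_zero, sub_zero, mul_zero, Complex.ofReal_one, map_one,
      mul_one]
    exact hx
  · simp only [Derivation.add_apply, Derivation.smul_apply, Derivation.commutator_apply,
      coeffD_yF, driftD_yF, smul_eq_mul, map_zero, mul_zero, smul_zero, Complex.ofReal_zero,
      Derivation.leibniz, Derivation.map_ofNat, derivation_wF, add_zero]
    linear_combination hy
  · rw [coeffwise_add, coeffwise_lie, coeffwise_smul, coeffwise_fsmul, coeffwise_fsmul,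
      coeffwise_coeffD_gser, hG, map_mul, map_ofNat]
    simp

theorem derivation_driftS (κ ρ : ℝ) (D : Derivation ℂ F F) : D (driftS κ ρ) =
    ((ρ : ℂ) * (ρ + 4 - κ) / (2 * κ)) • (2 * wF ^ 3 * (D yF - D xF)) := by
  rw [driftS, map_neg, Derivation.map_smul, Derivation.leibniz_pow, derivation_wF, ← smul_neg]
  congr 1
  simp only [smul_eq_mul, nsmul_eq_mul]
  push_cast
  ring

theorem derivation_driftD_gser (D : Derivation ℂ F F) : coeffwise D (coeffwise driftD gser) =
    -2 * PowerSeries.X ^ 2 * drift ^ 2 *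
      (coeffwise D gser - PowerSeries.C (D xF) * PowerSeries.X) := by
  rw [driftD_gser, Derivation.leibniz, map_add, coeffwise_drift, Derivation.leibniz_pow,
    coeffwise_X]
  simp only [smul_eq_mul, smul_zero, mul_zero, add_zero]
  ring

theorem theta_driftD_gser : theta (coeffwise driftD gser) = PowerSeries.X ^ 2 *
    (4 * drift - 2 * drift ^ 2 * (theta gser - PowerSeries.C xF * PowerSeries.X)) := by
  rw [driftD_gser, Derivation.leibniz, map_add, theta_drift, Derivation.leibniz_pow, theta_X]
  simp only [smul_eq_mul, nsmul_eq_mul]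
  push_cast
  ring

theorem lie_coeffD_x_posD (n : ℕ) : ⁅coeffD (1, 0), posD n⁆ = (0 : F) • coeffD (1, 0) := by
  have h := lie_coeffD_x_vf (P := fun l : ℕ => if n ≤ l then ((l : ℂ) - n - 1) • coeff (l - n) gser
    else 0) (f := if n = 1 then 1 else 0) (g := if n = 1 then 1 else 0) ?_ ?_
  · rw [posD, h]
    congr 1
    split_ifs <;> simp
  · intro v l _
    have h := congrArg (coeff (l - n)) (coeffwise_coeffD_gser v)
    rw [coeff_coeffwise, map_zero] at h
    split_ifs
    · rw [Derivation.map_smul, h, smul_zero]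
    · rw [map_zero]
  · split_ifs <;> simp

/-- `[A, L_1] = [A, L_2] = 0`. -/
theorem opA_posD (κ ρ : ℝ) {n : ℕ} (hn : n = 1 ∨ n = 2) (u : F) :
    opA κ ρ (fo (posD n) 0 u) = fo (posD n) 0 (opA κ ρ u) := by
  have h := opA_fo_of_values (κ := κ) (ρ := ρ) (s := 0) (f₁ := 0) (f₂ := 0) (s₁ := 0) (s₂ := 0)
    (isVectorField_posD n) (lie_coeffD_x_posD n) (map_zero _) (map_zero _) (map_zero _)
    ?_ ?_ ?_ ?_ u
  · rw [h]; ring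
  · rw [posD_xF]; split_ifs <;> simp
  · rw [posD_yF, posD_xF]; split_ifs <;> simp
  · have h1 := drift_mul
    have h2 := theta_driftD_gser
    rw [derivation_driftD_gser, posD_xF, posD_gser (by omega)]
    rw [driftD_gser] at h2 ⊢
    rcases hn with rfl | rfl
    · simp only [if_true, map_add, map_sub, Derivation.leibniz, smul_eq_mul, coeffwise_theta,
        coeffwise_X, driftD_gser, Derivation.leibniz_pow, h2, map_zero, map_one, mul_zero,
        smul_zero, zero_mul, add_zero]
      linear_combination (-2 * PowerSeries.X ^ 3 * drift) * h1
    · simp only [map_add, map_sub, Derivation.leibniz, smul_eq_mul, coeffwise_theta,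
        coeffwise_X, driftD_gser, Derivation.leibniz_pow, h2, map_zero, map_one, mul_zero,
        smul_zero, zero_mul, add_zero, OfNat.ofNat_ne_one, if_false]
      linear_combination (-2 * PowerSeries.X ^ 4 * drift) * h1
  · rw [derivation_driftS, posD_xF, posD_yF]
    simp

theorem lie_coeffD_x_negOneD : ⁅coeffD (1, 0), negOneD⁆ = (2 * xF) • coeffD (1, 0) := by
  rw [negOneD, lie_coeffD_x_vf]
  · congr 1
    simp [Derivation.leibniz, Derivation.leibniz_pow, Derivation.map_ofNat, coeffD_xF, coeffD_a]
  · intro v l _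
    rw [map_add, Derivation.map_smul, coeffD_a, coeffD_aSum]; simp
  · simp [Derivation.leibniz, Derivation.leibniz_pow, Derivation.map_ofNat, coeffD_yF, coeffD_a]

theorem lie_coeffD_x_negTwoD :
    ⁅coeffD (1, 0), negTwoD⁆ = (3 * xF ^ 2 - 4 * a 2) • coeffD (1, 0) := by
  rw [negTwoD, lie_coeffD_x_vf]
  · congr 1
    simp [Derivation.leibniz, Derivation.leibniz_pow, Derivation.map_ofNat, coeffD_xF, coeffD_a]
    ring
  · intro v l _
    simp [Derivation.leibniz, Derivation.map_ofNat, coeffD_a, coeffD_aSum]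
  · simp [Derivation.leibniz, Derivation.leibniz_pow, Derivation.map_ofNat, coeffD_yF, coeffD_a]

/-- `[A, L_{-1}] = 4 x A`, for the weights that belong to the drift operator. -/
theorem opA_negOne {κ ρ : ℝ} {hx hy : ℂ} (h1 : (κ : ℂ) / 2 * (2 + 4 * hx) = 6)
    (h2 : (ρ : ℂ) * (ρ + 4 - κ) / (2 * κ) = 2 * hy) (u : F) :
    opA κ ρ (fo negOneD ((2 * hx) • xF + (2 * hy) • yF) u) =
      fo negOneD ((2 * hx) • xF + (2 * hy) • yF) (opA κ ρ u) + 4 * xF * opA κ ρ u := by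
  have hw := wF_mul
  have h := opA_fo_of_values (κ := κ) (ρ := ρ) (s := (2 * hx) • xF + (2 * hy) • yF) (f₁ := 2 * xF)
    (f₂ := 2) (s₁ := algebraMap ℂ F (2 * hx)) (s₂ := 0) isVectorField_negOneD
    lie_coeffD_x_negOneD ?_ ?_ ?_ ?_ ?_ ?_ ?_ u
  · rw [h]; ring
  · simp [Derivation.leibniz, Derivation.map_ofNat, coeffD_xF]
  · rw [map_add, Derivation.map_smul, Derivation.map_smul, coeffD_xF, coeffD_yF, Complex.ofReal_one,
      Complex.ofReal_zero, map_one, map_zero, smul_zero, add_zero, Algebra.algebraMap_eq_smul_one]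
  · exact Derivation.map_algebraMap _ _
  · rw [negOneD_xF]
    simp only [map_sub, Derivation.leibniz, Derivation.leibniz_pow, Derivation.map_ofNat, driftD_xF,
      driftD_a_two, smul_eq_mul, nsmul_eq_mul, mul_zero, add_zero]
    have h3 := congrArg (algebraMap ℂ F) h1
    simp only [map_mul, map_add, algebraMap_ofNat] at h3
    rw [Algebra.smul_def, map_mul, algebraMap_ofNat]
    linear_combination h3
  · rw [negOneD_xF, negOneD_yF]
    simp only [map_sub, Derivation.leibniz, Derivation.leibniz_pow, Derivation.map_ofNat, driftD_yF,
      driftD_a_two, smul_eq_mul, nsmul_eq_mul, mul_zero, add_zero, Nat.cast_ofNat]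
    linear_combination (6 + 2 * wF * (xF + yF)) * hw
  · refine X_pow_mul_cancel 1 ?_
    have hd := drift_mul
    have hn := negOneD_gser
    have ht := theta_driftD_gser
    have hn' := congrArg (coeffwise driftD) hn
    rw [derivation_driftD_gser, negOneD_xF]
    rw [coeffwise_X_mul] at hn'
    simp only [map_add, map_sub, Derivation.leibniz, Derivation.leibniz_pow, smul_eq_mul,
      nsmul_eq_mul, Derivation.map_ofNat, coeffwise_C, driftD_a_two, coeffwise_X, coeffwise_theta,
      ht, map_mul, _root_.map_ofNat, mul_zero, smul_zero, add_zero, Nat.cast_ofNat] at hn'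
    rw [driftD_gser] at hn' ⊢
    simp only [map_mul, map_sub, map_pow, _root_.map_ofNat]
    linear_combination hn' + 2 * PowerSeries.X ^ 2 * drift ^ 2 * hn +
      PowerSeries.X ^ 2 * (6 + 2 * drift * (gser + PowerSeries.C xF * PowerSeries.X - 1)) * hd
  · rw [derivation_driftS, h2, negOneD_xF, negOneD_yF, driftS, h2, smul_zero, map_add,
      Derivation.map_smul, Derivation.map_smul, driftD_xF, driftD_yF]
    simp only [Algebra.smul_def, mul_zero, zero_add]
    linear_combination algebraMap ℂ F (2 * hy) * (-2 * wF - 2 * wF ^ 2 * (xF + yF)) * hw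

/-- `[A, L_{-2}] = (6 x² - 8 a_2) A`, for the weights and the central charge that belong to the
drift operator. -/
theorem opA_negTwo {κ ρ : ℝ} {c hx hy : ℂ} (h1 : (κ : ℂ) / 2 * (2 + 4 * hx) = 6)
    (h2 : (ρ : ℂ) * (ρ + 4 - κ) / (2 * κ) = 2 * hy) (h3 : c = (3 * κ - 8) * hx) (u : F) :
    opA κ ρ (fo negTwoD
        (hx • (3 * xF ^ 2 - 4 * a 2) + hy • (3 * yF ^ 2 - 4 * a 2) - (c / 2) • a 2) u) =
      fo negTwoD (hx • (3 * xF ^ 2 - 4 * a 2) + hy • (3 * yF ^ 2 - 4 * a 2) - (c / 2) • a 2)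
        (opA κ ρ u) + (6 * xF ^ 2 - 8 * a 2) * opA κ ρ u := by
  have hw := wF_mul
  have h := opA_fo_of_values (κ := κ) (ρ := ρ)
    (s := hx • (3 * xF ^ 2 - 4 * a 2) + hy • (3 * yF ^ 2 - 4 * a 2) - (c / 2) • a 2)
    (f₁ := 3 * xF ^ 2 - 4 * a 2) (f₂ := 6 * xF) (s₁ := hx • (6 * xF))
    (s₂ := hx • 6) isVectorField_negTwoD lie_coeffD_x_negTwoD ?_ ?_ ?_ ?_ ?_ ?_ ?_ u
  · rw [h]; ring
  · simp only [map_sub, Derivation.leibniz, Derivation.leibniz_pow, Derivation.map_ofNat, coeffD_xF,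
      coeffD_a, Complex.ofReal_one, map_one, smul_eq_mul, nsmul_eq_mul, Nat.cast_ofNat]
    ring
  · simp only [map_add, map_sub, Derivation.map_smul, Derivation.leibniz, Derivation.leibniz_pow,
      Derivation.map_ofNat, coeffD_xF, coeffD_yF, coeffD_a, Complex.ofReal_one, Complex.ofReal_zero,
      map_one, map_zero, smul_eq_mul, nsmul_eq_mul, Nat.cast_ofNat, mul_zero, add_zero, smul_zero,
      sub_zero]
    congr 1
    ring
  · rw [Derivation.map_smul, Derivation.leibniz, coeffD_xF, Derivation.map_ofNat]
    simp
  · rw [negTwoD_xF]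
    simp only [map_sub, Derivation.leibniz, Derivation.leibniz_pow, Derivation.map_ofNat, driftD_xF,
      driftD_a_two, driftD_a_three, smul_eq_mul, nsmul_eq_mul, mul_zero, add_zero]
    have h4 := congrArg (algebraMap ℂ F) h1
    simp only [map_mul, map_add, algebraMap_ofNat] at h4
    simp only [Algebra.smul_def]
    linear_combination 3 * xF * h4
  · rw [negTwoD_xF, negTwoD_yF]
    simp only [map_sub, Derivation.leibniz, Derivation.leibniz_pow, Derivation.map_ofNat, driftD_yF,
      driftD_xF, driftD_a_two, driftD_a_three, smul_eq_mul, nsmul_eq_mul, mul_zero, add_zero,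
      Nat.cast_ofNat]
    linear_combination (8 * yF + 10 * xF + 2 * wF * (xF ^ 2 + xF * yF + yF ^ 2 - 4 * a 2)) * hw
  · refine X_pow_mul_cancel 2 ?_
    have hd := drift_mul
    have hn := negTwoD_gser
    have ht := theta_driftD_gser
    have hn' := congrArg (coeffwise driftD) hn
    rw [derivation_driftD_gser, negTwoD_xF]
    rw [coeffwise_X_sq_mul] at hn'
    simp only [map_add, map_sub, Derivation.leibniz, Derivation.leibniz_pow, smul_eq_mul,
      nsmul_eq_mul, Derivation.map_ofNat, coeffwise_C, driftD_a_two, driftD_a_three, coeffwise_X,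
      coeffwise_theta,
      ht, map_mul, _root_.map_ofNat, mul_zero, smul_zero, add_zero, Nat.cast_ofNat] at hn'
    rw [driftD_gser] at hn' ⊢
    simp only [map_mul, map_sub, map_pow, _root_.map_ofNat]
    set Y := PowerSeries.C xF * PowerSeries.X with hY
    linear_combination hn' + 2 * PowerSeries.X ^ 2 * drift ^ 2 * hn +
      PowerSeries.X ^ 2 * (2 * drift * (gser ^ 2 + gser * Y + Y ^ 2 - 1
        - 4 * PowerSeries.C (a 2) * PowerSeries.X ^ 2) + 8 * gser + 10 * Y) * hd
  · rw [derivation_driftS, h2, negTwoD_xF, negTwoD_yF, driftS, h2]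
    simp only [map_add, map_sub, Derivation.map_smul, Derivation.leibniz, Derivation.leibniz_pow,
      Derivation.map_ofNat, driftD_xF, driftD_yF, driftD_a_two, smul_eq_mul, nsmul_eq_mul,
      Nat.cast_ofNat, mul_zero, add_zero]
    have h4 := congrArg (algebraMap ℂ F) h3
    have h5 : algebraMap ℂ F (c / 2) * 2 = algebraMap ℂ F c := by
      rw [← algebraMap_ofNat, ← map_mul]; congr 1; ring
    have h6 : algebraMap ℂ F (κ / 2) * 2 = algebraMap ℂ F κ := by
      rw [← algebraMap_ofNat, ← map_mul]; congr 1; ring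
    simp only [map_mul, map_sub, algebraMap_ofNat] at h4
    simp only [Algebra.smul_def, map_mul, algebraMap_ofNat]
    linear_combination (-1) * h5 - h4 + 3 * algebraMap ℂ F hx * h6 + algebraMap ℂ F hy *
      (8 - 4 * wF * (yF + 2 * xF) - 4 * wF ^ 2 * (xF ^ 2 + xF * yF + yF ^ 2 - 4 * a 2)) * hw

end SLEVir

namespace SLEVir

open MvPolynomial (C)

/-! ### Local martingales -/

/-- The Virasoro representation on `ℱ` with the parameters of `SLE_κ(ρ)`. -/
def sleRep (κ ρ : ℝ) : VirasoroRep (cc κ) F :=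
  opRep (cc κ) (hKac κ 1 2) ((ρ : ℂ) * (ρ + 4 - κ) / (4 * κ))

theorem sleRep_L (κ ρ : ℝ) : (sleRep κ ρ).L = sleL κ ρ := rfl

/-- For the four generating modes `T` one has `A T = (T + f) A` with a function `f`, so that they
preserve the kernel of `A`; the other modes are iterated commutators of these. -/
theorem kerA_stable {κ : ℝ} (ρ : ℝ) (hκ : 0 < κ) : (sleRep κ ρ).Stable (kerA κ ρ) := by
  have hκ' : (κ : ℂ) ≠ 0 := by exact_mod_cast hκ.ne'
  have h1 : (κ : ℂ) / 2 * (2 + 4 * hKac κ 1 2) = 6 := by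
    rw [hKac]; push_cast; field_simp; ring
  have h2 : (ρ : ℂ) * (ρ + 4 - κ) / (2 * κ) = 2 * ((ρ : ℂ) * (ρ + 4 - κ) / (4 * κ)) := by
    field_simp; ring
  have h3 : cc κ = (3 * κ - 8) * hKac κ 1 2 := by
    rw [hKac, cc]; push_cast; field_simp; ring
  have hpos1 : ∀ u ∈ kerA κ ρ, opL1 u ∈ kerA κ ρ := fun u hu => by
    rw [kerA, LinearMap.mem_ker] at hu ⊢
    rw [opL1_eq, opA_posD κ ρ (Or.inl rfl), hu, map_zero]
  have hpos2 : ∀ u ∈ kerA κ ρ, opL2 u ∈ kerA κ ρ := fun u hu => by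
    rw [kerA, LinearMap.mem_ker] at hu ⊢
    rw [opL2_eq, opA_posD κ ρ (Or.inr rfl), hu, map_zero]
  have hneg1 : ∀ u ∈ kerA κ ρ, opLm1 (hKac κ 1 2) ((ρ : ℂ) * (ρ + 4 - κ) / (4 * κ)) u ∈ kerA κ ρ :=
    fun u hu => by
      rw [kerA, LinearMap.mem_ker] at hu ⊢
      rw [opLm1_eq, opA_negOne h1 h2, hu, map_zero, mul_zero, add_zero]
  have hneg2 : ∀ u ∈ kerA κ ρ,
      opLm2 (cc κ) (hKac κ 1 2) ((ρ : ℂ) * (ρ + 4 - κ) / (4 * κ)) u ∈ kerA κ ρ :=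
    fun u hu => by
      rw [kerA, LinearMap.mem_ker] at hu ⊢
      rw [opLm2_eq, opA_negTwo h1 h2 h3, hu, map_zero, mul_zero, add_zero]
  have hbpos : ∀ k, ∀ u ∈ kerA κ ρ, bracketPos k u ∈ kerA κ ρ := fun k => by
    induction k with
    | zero => exact hpos2
    | succ k ih => exact fun u hu => sub_mem (ih _ (hpos1 u hu)) (hpos1 _ (ih u hu))
  have hbneg : ∀ k, ∀ u ∈ kerA κ ρ,
      bracketNeg (cc κ) (hKac κ 1 2) ((ρ : ℂ) * (ρ + 4 - κ) / (4 * κ)) k u ∈ kerA κ ρ := fun k => by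
    induction k with
    | zero => exact hneg2
    | succ k ih => exact fun u hu => sub_mem (hneg1 _ (ih u hu)) (ih _ (hneg1 u hu))
  -- `2 L_0` is the commutator of `L_1` and `L_{-1}`.
  have hzero : ∀ u ∈ kerA κ ρ, (sleRep κ ρ).L 0 u ∈ kerA κ ρ := fun u hu => by
    have h := (sleRep κ ρ).comm_apply 1 (-1) u
    have h0 : (2 : ℂ) • (sleRep κ ρ).L 0 u =
        (sleRep κ ρ).L 1 ((sleRep κ ρ).L (-1) u) - (sleRep κ ρ).L (-1) ((sleRep κ ρ).L 1 u) := by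
      rw [h]
      norm_num
    have h4 := (kerA κ ρ).smul_mem (2⁻¹ : ℂ) (h0 ▸
      sub_mem (hpos1 _ (hneg1 u hu)) (hneg1 _ (hpos1 u hu)) : (2 : ℂ) • _ ∈ kerA κ ρ)
    rwa [smul_smul, inv_mul_cancel₀ two_ne_zero, one_smul] at h4
  intro n u hu
  match n with
  | Int.ofNat 0 => exact hzero u hu
  | Int.ofNat 1 => exact hpos1 u hu
  | Int.ofNat (k + 2) => exact (kerA κ ρ).smul_mem _ (hbpos k u hu)
  | Int.negSucc 0 => exact hneg1 u hu
  | Int.negSucc (k + 1) => exact (kerA κ ρ).smul_mem _ (hbneg k u hu)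

/-! ### Local martingales that are functions of `(x, y)` -/

theorem posD_C {r : Smooth} (hr : dirDeriv (1, 0) r + dirDeriv (0, 1) r = 0) (n : ℕ) :
    posD n (C r) = 0 := by
  rw [isVectorField_posD n r, posD_xF, posD_yF]
  split_ifs
  · rw [one_mul, one_mul, ← map_add, hr, map_zero]
  · simp

theorem sleL_pos_C (κ ρ : ℝ) {r : Smooth} (hr : dirDeriv (1, 0) r + dirDeriv (0, 1) r = 0) {n : ℤ}
    (hn : 0 < n) : (sleRep κ ρ).L n (C r) = 0 := by
  change opL _ _ _ n (C r) = 0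
  rw [opL_pos' _ _ _ hn, fo_apply, posD_C hr]
  simp

/-- On functions of `x - y` the operator `L_0` is `(x - y) ∂_x + h_x + h_y`. -/
theorem sleL_zero_C (κ ρ : ℝ) {r : Smooth} (hr : dirDeriv (1, 0) r + dirDeriv (0, 1) r = 0) :
    (sleRep κ ρ).L 0 (C r) = C ((xS - yS) * dirDeriv (1, 0) r +
      (hKac κ 1 2 + (ρ : ℂ) * (ρ + 4 - κ) / (4 * κ)) • r) := by
  change opL (cc κ) _ _ 0 (C r) = _
  rw [opL_zero, fo_apply, isVectorField_zeroD r, zeroD_xF, zeroD_yF, map_add, C_csmul, map_mul,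
    map_sub, eq_neg_of_add_eq_zero_right hr, map_neg, smul_mul_assoc, one_mul, xF, yF]
  ring

theorem sub_mul_dirDeriv {r : Smooth} (hr : dirDeriv (1, 0) r + dirDeriv (0, 1) r = 0) :
    dirDeriv (1, 0) ((xS - yS) * dirDeriv (1, 0) r) +
      dirDeriv (0, 1) ((xS - yS) * dirDeriv (1, 0) r) = 0 := by
  have h := congrArg (dirDeriv (1, 0)) hr
  rw [map_add, dirDeriv_comm (1, 0) (0, 1), map_zero] at h
  rw [dirDeriv_mul, dirDeriv_mul, map_sub, map_sub, dirDeriv_xS, dirDeriv_yS, dirDeriv_xS,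
    dirDeriv_yS]
  simp only [Complex.ofReal_one, Complex.ofReal_zero, map_one, map_zero]
  linear_combination (xS - yS) * h

theorem opA_C (κ ρ : ℝ) (r : Smooth) : opA κ ρ (C r) =
    C (((κ : ℂ) / 2) • dirDeriv (1, 0) (dirDeriv (1, 0) r) + 2 * invS * dirDeriv (0, 1) r -
      ((ρ : ℂ) * (ρ + 4 - κ) / (2 * κ)) • (invS ^ 2 * r)) := by
  rw [opA_apply, coeffD_C, coeffD_C, fo_apply, isVectorField_driftD r, driftD_xF, driftD_yF,
    driftS, map_sub, map_add, C_csmul, C_csmul, map_mul, map_mul, map_mul, map_pow, wF, map_ofNat]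
  rw [neg_mul, smul_mul_assoc]
  ring

/-- On functions of `x - y` the drift operator is, up to a factor, the square of `L_0 - h_{0,1}`. -/
theorem sq_mul_opA_C {κ ρ : ℝ} (hκ : 0 < κ) (hρ : ρ = (κ - 4) / 2) {r : Smooth}
    (hr : dirDeriv (1, 0) r + dirDeriv (0, 1) r = 0) :
    (yF - xF) ^ 2 * opA κ ρ (C r) = ((κ : ℂ) / 2) •
      ((sleRep κ ρ).L 0 - hKac κ 0 1 • 1) (((sleRep κ ρ).L 0 - hKac κ 0 1 • 1) (C r)) := by
  have hκ' : (κ : ℂ) ≠ 0 := by exact_mod_cast hκ.ne'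
  have hsub : ∀ {r : Smooth}, dirDeriv (1, 0) r + dirDeriv (0, 1) r = 0 →
      ((sleRep κ ρ).L 0 - hKac κ 0 1 • 1) (C r) =
        C ((xS - yS) * dirDeriv (1, 0) r + ((4 - (κ : ℂ)) / (2 * κ)) • r) := fun {r} hr => by
    rw [LinearMap.sub_apply, sleL_zero_C _ _ hr, LinearMap.smul_apply, Module.End.one_apply,
      ← C_csmul, ← map_sub, add_sub_assoc, ← sub_smul]
    congr 3
    rw [hρ, hKac, hKac]; push_cast; field_simp; ring
  have hr' : dirDeriv (1, 0) ((xS - yS) * dirDeriv (1, 0) r + ((4 - (κ : ℂ)) / (2 * κ)) • r) +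
      dirDeriv (0, 1) ((xS - yS) * dirDeriv (1, 0) r + ((4 - (κ : ℂ)) / (2 * κ)) • r) = 0 := by
    have h := sub_mul_dirDeriv hr
    have h2 : ((4 - (κ : ℂ)) / (2 * κ)) • dirDeriv (1, 0) r +
        ((4 - (κ : ℂ)) / (2 * κ)) • dirDeriv (0, 1) r = 0 := by rw [← smul_add, hr, smul_zero]
    rw [map_add, map_add, map_smul, map_smul]
    linear_combination h + h2
  rw [hsub hr, hsub hr', opA_C, ← C_csmul, yF, xF, ← map_sub, ← map_pow, ← map_mul]
  congr 1
  rw [eq_neg_of_add_eq_zero_right hr, map_add, map_smul, dirDeriv_mul, map_sub, dirDeriv_xS,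
    dirDeriv_yS]
  simp only [Complex.ofReal_one, Complex.ofReal_zero, map_one, map_zero, sub_zero]
  have hw := invS_mul
  have e1 : (ρ : ℂ) * (ρ + 4 - κ) / (2 * κ) =
      -((κ : ℂ) / 2 * (((4 - (κ : ℂ)) / (2 * κ)) * ((4 - (κ : ℂ)) / (2 * κ)))) := by
    rw [hρ]; push_cast; field_simp; ring
  have e2 : algebraMap ℂ Smooth (κ / 2) * (1 + 2 * algebraMap ℂ Smooth ((4 - (κ : ℂ)) / (2 * κ))) =
      2 := by
    rw [← map_ofNat (algebraMap ℂ Smooth) 2, ← map_one (algebraMap ℂ Smooth), ← map_mul, ← map_add,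
      ← map_mul]
    congr 1
    field_simp; ring
  rw [e1]
  simp only [Algebra.smul_def, map_neg, map_mul]
  set μ := algebraMap ℂ Smooth ((4 - (κ : ℂ)) / (2 * κ))
  set k := algebraMap ℂ Smooth (κ / 2)
  linear_combination (-2 * (yS - xS) * dirDeriv (1, 0) r +
    k * μ ^ 2 * r * (invS * (yS - xS) + 1)) * hw + (yS - xS) * dirDeriv (1, 0) r * e2

theorem mul_sub_cancel_F {u : F} (h : (yF - xF) ^ 2 * u = 0) : u = 0 := by
  linear_combination wF ^ 2 * h - (wF * (yF - xF) + 1) * u * wF_mul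

theorem dirDeriv_logS_add : dirDeriv (1, 0) logS + dirDeriv (0, 1) logS = 0 := by
  rw [dirDeriv_logS, dirDeriv_logS]
  simp

theorem dirDeriv_powS_add (α : ℂ) :
    dirDeriv (1, 0) (powS α) + dirDeriv (0, 1) (powS α) = 0 := by
  rw [dirDeriv_powS, dirDeriv_powS, ← smul_add, ← mul_add, dirDeriv_logS_add, mul_zero, smul_zero]

theorem dirDeriv_powS_mul_logS_add (α : ℂ) :
    dirDeriv (1, 0) (powS α * logS) + dirDeriv (0, 1) (powS α * logS) = 0 := by
  rw [dirDeriv_mul, dirDeriv_mul]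
  linear_combination powS α * dirDeriv_logS_add + logS * dirDeriv_powS_add α

theorem euler_logS : (xS - yS) * dirDeriv (1, 0) logS = 1 := by
  rw [dirDeriv_logS]
  simp only [Complex.ofReal_one, Complex.ofReal_zero, zero_sub, neg_smul, one_smul]
  linear_combination invS_mul

theorem rho_div {κ ρ : ℝ} (hκ : 0 < κ) (hρ : ρ = (κ - 4) / 2) :
    (ρ : ℂ) / κ = ((κ : ℂ) - 4) / (2 * κ) := by
  have hκ' : (κ : ℂ) ≠ 0 := by exact_mod_cast hκ.ne'
  rw [hρ]; push_cast; field_simp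

theorem weight_add {κ ρ : ℝ} (hκ : 0 < κ) (hρ : ρ = (κ - 4) / 2) :
    hKac κ 1 2 + (ρ : ℂ) * (ρ + 4 - κ) / (4 * κ) =
      hKac κ 0 1 - ((κ : ℂ) - 4) / (2 * κ) := by
  have hκ' : (κ : ℂ) ≠ 0 := by exact_mod_cast hκ.ne'
  rw [hρ, hKac, hKac]; push_cast; field_simp; ring

theorem Zpart_ne_zero (κ ρ : ℝ) : Zpart κ ρ ≠ 0 := by
  intro h
  have h1 : powS ((ρ : ℂ) / κ) = 0 := MvPolynomial.C_injective _ _ (h.trans (map_zero _).symm)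
  have h2 : (powS ((ρ : ℂ) / κ)).fn ⟨(1, 0), one_ne_zero⟩ = 0 := by rw [h1]; rfl
  exact powS_ne_zero _ _ h2

theorem L_zero_Zpart {κ ρ : ℝ} (hκ : 0 < κ) (hρ : ρ = (κ - 4) / 2) :
    (sleRep κ ρ).L 0 (Zpart κ ρ) = hKac κ 0 1 • Zpart κ ρ := by
  rw [Zpart, rho_div hκ hρ, sleL_zero_C _ _ (dirDeriv_powS_add _), weight_add hκ hρ, ← C_csmul,
    dirDeriv_powS, sub_smul]
  congr 1
  simp only [Algebra.smul_def]
  linear_combination algebraMap ℂ Smooth (((κ : ℂ) - 4) / (2 * κ)) *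
    powS (((κ : ℂ) - 4) / (2 * κ)) * euler_logS

theorem L_zero_logPartner {κ ρ : ℝ} (hκ : 0 < κ) (hρ : ρ = (κ - 4) / 2) :
    ((sleRep κ ρ).L 0 - hKac κ 0 1 • (1 : Module.End ℂ F)) (logPartner κ) = Zpart κ ρ := by
  rw [LinearMap.sub_apply, LinearMap.smul_apply, Module.End.one_apply, logPartner, Zpart,
    rho_div hκ hρ, sleL_zero_C _ _ (dirDeriv_powS_mul_logS_add _), weight_add hκ hρ, ← C_csmul,
    dirDeriv_mul, dirDeriv_powS, sub_smul, ← map_sub]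
  congr 1
  simp only [Algebra.smul_def]
  linear_combination (algebraMap ℂ Smooth (((κ : ℂ) - 4) / (2 * κ)) *
    powS (((κ : ℂ) - 4) / (2 * κ)) * logS + powS (((κ : ℂ) - 4) / (2 * κ))) * euler_logS

theorem Zpart_mem_kerA {κ ρ : ℝ} (hκ : 0 < κ) (hρ : ρ = (κ - 4) / 2) : Zpart κ ρ ∈ kerA κ ρ := by
  rw [kerA, LinearMap.mem_ker]
  refine mul_sub_cancel_F ?_
  have h := sq_mul_opA_C hκ hρ (dirDeriv_powS_add ((ρ : ℂ) / κ))
  rw [Zpart, h, ← Zpart, LinearMap.sub_apply _ _ (Zpart κ ρ), L_zero_Zpart hκ hρ]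
  simp

theorem logPartner_mem_kerA {κ ρ : ℝ} (hκ : 0 < κ) (hρ : ρ = (κ - 4) / 2) :
    logPartner κ ∈ kerA κ ρ := by
  rw [kerA, LinearMap.mem_ker]
  refine mul_sub_cancel_F ?_
  have h := sq_mul_opA_C hκ hρ (dirDeriv_powS_mul_logS_add (((κ : ℂ) - 4) / (2 * κ)))
  rw [logPartner, h, ← logPartner, L_zero_logPartner hκ hρ, LinearMap.sub_apply,
    L_zero_Zpart hκ hρ]
  simp

/-- A local martingale annihilated by all `L_n`, `n > 0`, is a generalized eigenvector of `L_0` of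
eigenvalue `h_{0,1}`: it is a function `r` of `x - y`, and `(L_0 - h_{0,1})² r` is a multiple of
`A r = 0`. So there are none of other weights. -/
theorem kerA_no_singular {κ ρ : ℝ} (hκ : 0 < κ) (hρ : ρ = (κ - 4) / 2)
    {N : ℂ} (hN : N ≠ 0) {u : F}
    (hu : u ∈ kerA κ ρ)
    (hg : u ∈ (sleRep κ ρ).gen (hKac κ 0 1 + N)) (hs : ∀ n > 0, (sleRep κ ρ).L n u = 0) :
    u = 0 := by
  have hpos : ∀ n : ℕ, 1 ≤ n → posD n u = 0 := fun n hn => by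
    have h := hs n (by omega)
    change opL _ _ _ (n : ℤ) u = 0 at h
    rwa [opL_pos _ _ _ hn, fo_apply, zero_mul, add_zero] at h
  obtain ⟨r, rfl⟩ : ∃ r, u = C r :=
    ⟨_, eq_C_of_posD_eq_zero fun n hn => hpos n (by omega)⟩
  have hr : dirDeriv (1, 0) r + dirDeriv (0, 1) r = 0 := by
    have h := hpos 1 le_rfl
    rw [isVectorField_posD 1 r, posD_xF, posD_yF, if_pos rfl, one_mul, one_mul, ← map_add] at h
    exact MvPolynomial.C_injective _ _ (h.trans (map_zero _).symm)
  have h := sq_mul_opA_C hκ hρ hr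
  rw [LinearMap.mem_ker.mp hu, mul_zero] at h
  have hk : (κ : ℂ) / 2 ≠ 0 := by
    have : (κ : ℂ) ≠ 0 := by exact_mod_cast hκ.ne'
    simpa
  have h2 := (smul_eq_zero.mp h.symm).resolve_left hk
  refine (sleRep κ ρ).gen_disjoint (η := hKac κ 0 1) (θ := hKac κ 0 1 + N) (by simpa using hN)
    ?_ hg
  rw [VirasoroRep.gen, Module.End.mem_maxGenEigenspace]
  exact ⟨2, by rw [pow_two]; exact h2⟩

end SLEVir

namespace SLEVir

/-! ### Modules generated by a logarithmic vacuum -/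

namespace VirasoroRep

variable {c : ℂ} {M : Type*} [AddCommGroup M] [Module ℂ M]

/-- `zero_smul` for complex vector spaces, in a form that applies to Verma modules, whose scalar
multiplication by `ℂ` is inherited from the quotient of `𝒰`. -/
theorem zero_csmul (x : M) : (0 : ℂ) • x = 0 := zero_smul ℂ x

theorem zero_combination (x y : M) : (0 : ℂ) • x + (0 : ℂ) • y = 0 := by simp

namespace IsLogVacuum

variable {R : VirasoroRep c M} {h : ℂ} {ξ : M}

theorem pos_partner (hξ : R.IsLogVacuum h ξ) {n : ℤ} (hn : 0 < n) :
    R.L n (R.L 0 ξ - h • ξ) = 0 :=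
  hξ.isVacuum.pos n hn _ (Submodule.subset_span (by simp))

/-- A vacuum and its partner are linearly independent as soon as the partner is non-zero. -/
theorem eq_zero_of_combination (hξ : R.IsLogVacuum h ξ) (h0 : R.L 0 ξ - h • ξ ≠ 0) (a b : ℂ)
    (hab : a • ξ + b • (R.L 0 ξ - h • ξ) = 0) : a = 0 ∧ b = 0 := by
  have h1 : a • (R.L 0 ξ - h • ξ) = 0 := by
    have h2 := congrArg (fun x => R.L 0 x - h • x) hab
    simp only [map_add, map_smul, hξ.log, map_zero, smul_zero, sub_zero] at h2
    rw [← h2]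
    module
  have ha := (smul_eq_zero.mp h1).resolve_right h0
  rw [ha, zero_smul, zero_add] at hab
  exact ⟨ha, (smul_eq_zero.mp hab).resolve_right h0⟩

/-- The vector `ξ` is not in the submodule generated by `(L_0 - h) ξ`, whose lowest space is a
line; hence the quotient by that submodule is non-zero. -/
theorem notMem_cyclic_partner (hξ : R.IsLogVacuum h ξ) (h0 : R.L 0 ξ - h • ξ ≠ 0) :
    ξ ∉ R.cyclic (R.L 0 ξ - h • ξ) := by
  intro hmem
  have hg : ξ ∈ R.gen h := hξ.isVacuum.le_gen (Submodule.subset_span (by simp))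
  have h1 := (R.isLogVacuum_of_hw hξ.log fun n hn => hξ.pos_partner hn).mem_vac hmem hg
  obtain ⟨a, b, hab⟩ := Submodule.mem_span_pair.mp h1
  rw [hξ.log, sub_self, smul_zero, add_zero] at hab
  have h2 := hξ.eq_zero_of_combination h0 1 (-a) (by
    rw [neg_smul, hab, one_smul, add_neg_cancel])
  exact one_ne_zero h2.1

theorem isStaggered (hξ : R.IsLogVacuum h ξ) (ht : R.cyclic ξ = ⊤) (h0 : R.L 0 ξ - h • ξ ≠ 0) :
    R.IsStaggered (R.cyclic (R.L 0 ξ - h • ξ)) h h := by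
  refine ⟨R.cyclic_stable _, ⟨⟨_, R.mem_cyclic _⟩, ?_, ?_, ?_, R.sub_cyclic_self _⟩,
    ⟨Submodule.Quotient.mk ξ, ?_, ?_, ?_, ?_⟩, ?_⟩
  · simpa using h0
  · exact Subtype.ext hξ.log
  · exact fun n hn => Subtype.ext (hξ.pos_partner hn)
  · rw [Ne, Submodule.Quotient.mk_eq_zero]
    exact hξ.notMem_cyclic_partner h0
  · change Submodule.Quotient.mk (R.L 0 ξ) = _
    rw [← Submodule.Quotient.mk_smul, Submodule.Quotient.eq]
    exact R.mem_cyclic _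
  · intro n hn
    change Submodule.Quotient.mk (R.L n ξ) = _
    rw [hξ.pos n hn, Submodule.Quotient.mk_zero]
  · set Q := R.quot _ (R.cyclic_stable (R.L 0 ξ - h • ξ))
    have h1 : R.cyclic ξ ≤ (Q.cyclic (Submodule.Quotient.mk ξ)).comap
        (R.cyclic (R.L 0 ξ - h • ξ)).mkQ :=
      R.cyclic_le (fun n v hv => Q.cyclic_stable _ n _ hv) (Q.mem_cyclic _)
    rw [ht, top_le_iff] at h1
    rw [eq_top_iff]
    rintro x -
    obtain ⟨v, rfl⟩ := Submodule.Quotient.mk_surjective _ x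
    have : v ∈ (⊤ : Submodule ℂ M) := trivial
    rwa [← h1] at this
  · intro hd
    -- The component of `ξ` in the eigenspace of `h` is `ξ` itself.
    have hmem : ξ ∈ ⨆ μ : ℂ, Module.End.eigenspace (R.L 0) μ := by rw [hd]; trivial
    rw [iSup_split_single _ h] at hmem
    obtain ⟨e, he, r, hr, rfl⟩ := Submodule.mem_sup.mp hmem
    have hle : ∀ μ, Module.End.eigenspace (R.L 0) μ ≤ R.gen μ := fun μ x hx =>
      R.mem_gen_of_eigen (Module.End.mem_eigenspace_iff.mp hx)
    have hr' : r ∈ ⨆ μ, ⨆ _ : μ ≠ h, R.gen μ := iSup₂_mono (fun μ _ => hle μ) hr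
    have hg : r ∈ R.gen h := by
      have h1 : e + r ∈ R.gen h := hξ.isVacuum.le_gen (Submodule.subset_span (by simp))
      simpa using sub_mem h1 (hle h he)
    have hz : r = 0 := Submodule.disjoint_def.mp
      ((Module.End.independent_maxGenEigenspace (R.L 0)) h) r hg hr'
    apply h0
    rw [hz, add_zero, Module.End.mem_eigenspace_iff.mp he, sub_self]

/-- The components of `ξ` in a decomposition lie in the lowest space, which is spanned by `ξ` and
`(L_0 - h) ξ`, and one of them generates the whole module. -/
theorem indecomposable (hξ : R.IsLogVacuum h ξ) (ht : R.cyclic ξ = ⊤)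
    (h0 : R.L 0 ξ - h • ξ ≠ 0) : R.Indecomposable := by
  -- A summand that contains a vector `a ξ + b (L_0 - h) ξ` with `a ≠ 0` is the whole module.
  have key : ∀ W : Submodule ℂ M, R.Stable W → ∀ a b : ℂ, a ≠ 0 →
      a • ξ + b • (R.L 0 ξ - h • ξ) ∈ W → W = ⊤ := by
    intro W hW a b ha hmem
    have h1 : R.L 0 ξ - h • ξ ∈ W := by
      have h2 := sub_mem (hW 0 _ hmem) (W.smul_mem h hmem)
      rw [map_add, map_smul, map_smul, hξ.log] at h2
      rw [← inv_smul_smul₀ ha (R.L 0 ξ - h • ξ)]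
      refine W.smul_mem _ ?_
      convert h2 using 1
      module
    have h2 : ξ ∈ W := by
      rw [← inv_smul_smul₀ ha ξ]
      refine W.smul_mem _ ?_
      simpa using sub_mem hmem (W.smul_mem b h1)
    rw [eq_top_iff, ← ht]
    exact R.cyclic_le hW h2
  refine ⟨⟨_, 0, h0⟩, fun W₁ W₂ hW₁ hW₂ hc => ?_⟩
  have hmem : ξ ∈ W₁ ⊔ W₂ := by rw [hc.sup_eq_top]; trivial
  obtain ⟨x₁, hx₁, x₂, hx₂, hx⟩ := Submodule.mem_sup.mp hmem
  set T : Module.End ℂ M := R.L 0 - h • 1 with hT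
  have hTW : ∀ W : Submodule ℂ M, R.Stable W → ∀ x ∈ W, T x ∈ W := fun W hW x hx =>
    sub_mem (hW 0 x hx) (W.smul_mem h hx)
  have hTξ : T (T x₁) + T (T x₂) = 0 := by
    rw [← map_add, ← map_add, hx]
    exact sub_eq_zero.mpr hξ.log
  have h1 : T (T x₁) = 0 := by
    refine Submodule.disjoint_def.mp hc.disjoint _ (hTW _ hW₁ _ (hTW _ hW₁ _ hx₁)) ?_
    rw [eq_neg_of_add_eq_zero_left hTξ]
    exact neg_mem (hTW _ hW₂ _ (hTW _ hW₂ _ hx₂))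
  have h2 : T (T x₂) = 0 := by rwa [h1, zero_add] at hTξ
  have hvac : ∀ x, T (T x) = 0 → ∃ a b : ℂ, a • ξ + b • (R.L 0 ξ - h • ξ) = x := by
    intro x hx
    refine Submodule.mem_span_pair.mp (hξ.mem_vac (by rw [ht]; trivial) ?_)
    rw [Module.End.mem_maxGenEigenspace]
    exact ⟨2, by rw [pow_two]; exact hx⟩
  obtain ⟨a₁, b₁, e₁⟩ := hvac x₁ h1
  obtain ⟨a₂, b₂, e₂⟩ := hvac x₂ h2
  by_cases ha : a₁ = 0
  · left
    have ha₂ : a₂ ≠ 0 := by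
      rintro rfl
      have h3 := hξ.eq_zero_of_combination h0 1 (-(b₁ + b₂)) (by
        rw [← e₁, ← e₂, ha] at hx
        rw [one_smul, neg_smul, ← sub_eq_add_neg, sub_eq_zero]
        nth_rw 1 [← hx]
        module)
      exact one_ne_zero h3.1
    have h3 := key W₂ hW₂ a₂ b₂ ha₂ (e₂ ▸ hx₂)
    simpa [h3] using hc.inf_eq_bot
  · right
    have h3 := key W₁ hW₁ a₁ b₁ ha (e₁ ▸ hx₁)
    simpa [h3] using hc.inf_eq_bot

/-- The module generated by a logarithmic vacuum is an extension of two copies of the Verma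
module, provided that the Verma module has no singular vectors of positive level. The kernel of
the projection is generated by `(L_0 - h) ξ` because `vermaIdeal` maps `ξ` there. -/
theorem exists_exact (hξ : R.IsLogVacuum h ξ) (ht : R.cyclic ξ = ⊤)
    (h0 : R.L 0 ξ - h • ξ ≠ 0)
    (hV : ∀ n : ℕ, 0 < n → ∀ y ∈ (vermaRep c h).gen (h + n),
      (∀ m : ℤ, 0 < m → (vermaRep c h).L m y = 0) → y = 0) :
    ∃ (i : Verma c h →ₗ[ℂ] M) (p : M →ₗ[ℂ] Verma c h),
      (vermaRep c h).IsHom R i ∧ R.IsHom (vermaRep c h) p ∧ Function.Injective i ∧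
      Function.Surjective p ∧ LinearMap.range i = LinearMap.ker p ∧
      i (vermaVec c h) = R.L 0 ξ - h • ξ ∧ p ξ = vermaVec c h := by
  have hv := (vermaRep c h).isLogVacuum_of_hw (verma_zero c h) fun n hn => verma_pos c h hn
  have hgr := hv.graded (verma_cyclic c h)
  obtain ⟨i, hi, hiv⟩ := exists_hom_verma R hξ.log fun n hn => hξ.pos_partner hn
  obtain ⟨p, hp, hpξ⟩ := exists_hom_of_no_singular (χ := vermaVec c h) ht hξ hv hgr hV
    fun a b hab => by
      obtain ⟨rfl, rfl⟩ := hξ.eq_zero_of_combination h0 a b hab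
      exact zero_combination _ _
  refine ⟨i, p, hi, hp, ?_, ?_, ?_, hiv, hpξ⟩
  · rw [← LinearMap.ker_eq_bot]
    by_contra hne
    have hst : (vermaRep c h).Stable (LinearMap.ker i) := fun n v hv => by
      rw [LinearMap.mem_ker] at hv ⊢
      rw [hi, hv, map_zero]
    obtain ⟨n, z, hz, hz0, hzg, hzs⟩ := hgr.exists_singular hst hne
    rcases Nat.eq_zero_or_pos n with rfl | hn
    · have hzv := hv.mem_vac (by rw [verma_cyclic]; trivial) (by simpa using hzg)
      obtain ⟨a, b, rfl⟩ := Submodule.mem_span_pair.mp hzv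
      rw [verma_zero, sub_self, smul_zero, add_zero] at hz hz0
      rw [LinearMap.mem_ker, map_smul, hiv, smul_eq_zero] at hz
      exact hz0 ((congrArg (· • vermaVec c h) (hz.resolve_right h0)).trans (zero_csmul _))
    · exact hz0 (hV n hn z hzg hzs)
  · intro x
    obtain ⟨u, rfl⟩ := Submodule.Quotient.mk_surjective _ x
    exact ⟨R.act u ξ, by rw [hp.act_apply, hpξ, verma_act_vec]⟩
  · apply le_antisymm
    · rintro _ ⟨x, rfl⟩
      obtain ⟨u, rfl⟩ := Submodule.Quotient.mk_surjective _ x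
      rw [LinearMap.mem_ker, ← verma_act_vec, hi.act_apply, hp.act_apply, hiv, map_sub, map_smul,
        hp, hpξ, verma_zero, sub_self, map_zero]
    · intro x hx
      have hx' : x ∈ R.cyclic ξ := by rw [ht]; trivial
      rw [← range_orbit] at hx'
      obtain ⟨u, rfl⟩ := hx'
      change p (R.act u ξ) = 0 at hx
      rw [hp.act_apply, hpξ, verma_act_vec, Submodule.Quotient.mk_eq_zero] at hx
      -- Elements of `vermaIdeal` map `ξ` into the module generated by its partner.
      have hmem : R.act u ξ ∈ R.cyclic (R.L 0 ξ - h • ξ) := by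
        induction hx using Submodule.span_induction with
        | mem u hu =>
          rcases hu with ⟨n, hn, rfl⟩ | rfl
          · simp [hξ.pos n hn]
          · simpa [Algebra.algebraMap_eq_smul_one] using R.mem_cyclic (R.L 0 ξ - h • ξ)
        | zero => simp
        | add u w _ _ hu hw => simpa using add_mem hu hw
        | smul w u _ hu =>
          rw [smul_eq_mul, map_mul, Module.End.mul_apply]
          exact (R.cyclic_stable _).act_mem w _ hu
      rw [← range_orbit] at hmem
      obtain ⟨w, hw⟩ := hmem
      refine ⟨(vermaRep c h).act w (vermaVec c h), ?_⟩
      rw [hi.act_apply, hiv]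
      exact hw

end IsLogVacuum

end VirasoroRep

end SLEVir

end

open SLEVir in
theorem mainTheorem1 (κ ρ : ℝ) (hκ : 0 < κ) (hρ : ρ = (κ - 4) / 2) :
    -- `ℱ`, with the operators `L_n`, is a Virasoro module of central charge `c(κ)`
    ∃ R : VirasoroRep (cc κ) F, R.L = sleL κ ρ ∧
      -- the local martingales form a submodule
      R.Stable (kerA κ ρ) ∧
      -- `Z` is a highest weight vector, and `Λ` is its logarithmic partner
      Zpart κ ρ ∈ kerA κ ρ ∧
      R.L 0 (Zpart κ ρ) = hKac κ 0 1 • Zpart κ ρ ∧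
      (∀ n : ℤ, 0 < n → R.L n (Zpart κ ρ) = 0) ∧
      logPartner κ ∈ kerA κ ρ ∧
      (R.L 0 - hKac κ 0 1 • (1 : Module.End ℂ F)) (logPartner κ) = Zpart κ ρ ∧
      (∀ n : ℤ, 0 < n → R.L n (logPartner κ) = 0) ∧
      -- `𝒰 Λ` consists of local martingales and contains `𝒰 Z`
      R.cyclic (logPartner κ) ≤ kerA κ ρ ∧
      R.cyclic (Zpart κ ρ) ≤ R.cyclic (logPartner κ) ∧
      -- `𝒰 Λ` is an indecomposable staggered module with left module `𝒰 Z`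
      (R.sub (R.cyclic (logPartner κ)) (R.cyclic_stable _)).IsStaggered
        ((R.cyclic (Zpart κ ρ)).submoduleOf (R.cyclic (logPartner κ)))
        (hKac κ 0 1) (hKac κ 0 1) ∧
      (R.sub (R.cyclic (logPartner κ)) (R.cyclic_stable _)).Indecomposable ∧
      -- the case of irrational `κ`
      (Irrational κ →
        (∃ (i : Verma (cc κ) (hKac κ 0 1) →ₗ[ℂ] R.cyclic (logPartner κ))
            (p : R.cyclic (logPartner κ) →ₗ[ℂ] Verma (cc κ) (hKac κ 0 1)),
          (vermaRep (cc κ) (hKac κ 0 1)).IsHom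
            (R.sub (R.cyclic (logPartner κ)) (R.cyclic_stable _)) i ∧
          (R.sub (R.cyclic (logPartner κ)) (R.cyclic_stable _)).IsHom
            (vermaRep (cc κ) (hKac κ 0 1)) p ∧
          Function.Injective i ∧ Function.Surjective p ∧
          LinearMap.range i = LinearMap.ker p ∧
          (i (vermaVec (cc κ) (hKac κ 0 1)) : F) = Zpart κ ρ ∧
          p ⟨logPartner κ, R.mem_cyclic _⟩ = vermaVec (cc κ) (hKac κ 0 1)) ∧
        (R.sub (R.cyclic (logPartner κ)) (R.cyclic_stable _)).Isomorphic
          (R.sub (R.cyclic (logPartner κ)) (R.cyclic_stable _)).contragredient) := by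
  set R := sleRep κ ρ with hR
  have hstab : R.Stable (kerA κ ρ) := kerA_stable ρ hκ
  have hΛ : logPartner κ ∈ kerA κ ρ := logPartner_mem_kerA hκ hρ
  have hZ0 : R.L 0 (Zpart κ ρ) = hKac κ 0 1 • Zpart κ ρ := L_zero_Zpart hκ hρ
  have hΛ0 : (R.L 0 - hKac κ 0 1 • (1 : Module.End ℂ F)) (logPartner κ) = Zpart κ ρ :=
    L_zero_logPartner hκ hρ
  have hΛpos : ∀ n : ℤ, 0 < n → R.L n (logPartner κ) = 0 := fun n hn =>
    sleL_pos_C κ ρ (dirDeriv_powS_mul_logS_add _) hn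
  have hle : R.cyclic (logPartner κ) ≤ kerA κ ρ := R.cyclic_le hstab hΛ
  set S := R.sub (R.cyclic (logPartner κ)) (R.cyclic_stable _) with hS
  set ξ : R.cyclic (logPartner κ) := ⟨logPartner κ, R.mem_cyclic _⟩ with hξ
  -- In `𝒰 Λ` the partner `(L_0 - h) Λ` is `Z`.
  have hpart : ((S.L 0 ξ - hKac κ 0 1 • ξ : R.cyclic (logPartner κ)) : F) = Zpart κ ρ := hΛ0
  have hlog : S.IsLogVacuum (hKac κ 0 1) ξ :=
    ⟨fun n hn => Subtype.ext (hΛpos n hn), Subtype.ext (by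
      rw [VirasoroRep.sub_L_coe, Submodule.coe_smul, hpart]
      exact hZ0)⟩
  have ht : S.cyclic ξ = ⊤ := R.sub_cyclic_self _
  have hZne : Zpart κ ρ ≠ 0 := Zpart_ne_zero κ ρ
  have hne : S.L 0 ξ - hKac κ 0 1 • ξ ≠ 0 := fun h => hZne (by rw [← hpart, h]; rfl)
  have hcyc : (R.cyclic (Zpart κ ρ)).submoduleOf (R.cyclic (logPartner κ)) =
      S.cyclic (S.L 0 ξ - hKac κ 0 1 • ξ) := by
    rw [VirasoroRep.sub_cyclic, hpart]
    rfl
  -- Singular vectors of `𝒰 Λ` are local martingales.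
  have hsing : ∀ n : ℕ, 0 < n → ∀ y ∈ S.gen (hKac κ 0 1 + n),
      (∀ m : ℤ, 0 < m → S.L m y = 0) → y = 0 := fun n hn y hy hs =>
    Subtype.ext (kerA_no_singular hκ hρ (N := n) (by exact_mod_cast hn.ne') (hle y.2)
      ((R.sub_mem_gen _).mp hy) fun m hm => congrArg Subtype.val (hs m hm))
  refine ⟨R, sleRep_L κ ρ, hstab, Zpart_mem_kerA hκ hρ, hZ0,
    fun n hn => sleL_pos_C κ ρ (dirDeriv_powS_add _) hn, hΛ, hΛ0, hΛpos, hle, ?_, ?_,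
    hlog.indecomposable ht hne, fun hirr => ⟨?_, ?_⟩⟩
  · refine R.cyclic_le (R.cyclic_stable _) ?_
    rw [← hpart]
    exact Subtype.prop _
  · rw [hcyc]
    exact hlog.isStaggered ht hne
  · obtain ⟨i, p, hi, hp, hinj, hsurj, hrk, hiv, hpv⟩ := hlog.exists_exact ht hne
      fun n hn y hy hs => verma_no_singular hκ hirr hn hy hs
    exact ⟨i, p, hi, hp, hinj, hsurj, hrk, by rw [hiv, hpart], hpv⟩
  · exact hlog.isomorphic_contragredient ht (hlog.eq_zero_of_combination hne) hsing
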